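/- Let $E$ be the elliptic curve $y^2+y=x^3+x$ over $\mathbb{F}_2$ with function field $\mathbb{F}_2(E)=\mathbb{F}_2(x,y)$, and put $$f_1=\frac{(x^5+x)y+x^2+x}{x^7+x+1},\quad f_2=\frac{(x^5+x^4+x^3+x)y+x^6+x^4}{x^7+x+1},\quad f_3=\frac{(x^6+x^5)y+x^{10}+x^6+x^2+x}{x^{14}+x^2+1}$$ and $S=\mathbb{F}_2f_1+\mathbb{F}_2f_2+\mathbb{F}_2f_3\subset\mathbb{F}_2(E)$. Fix an algebraic closure of $\mathbb{F}_2(E)$. For $j\in\{1,2,3\}$ let $w_j$ be a zero of $T^2+T+f_j$ in it, and let $X_j$, $X_{12}$, $X_{123}$ be the smooth complete curves over $\mathbb{F}_2$ with function fields $\mathbb{F}_2(E)(w_j)$, $\mathbb{F}_2(E)(w_1,w_2)$, $\mathbb{F}_2(E)(w_1,w_2,w_3)$, respectively. For an $\mathbb{F}_2$-linear subspace $R\subseteq S$ let $X_R$ be the smooth complete curve whose function field $\mathbb{F}_2(X_R)$ is obtained from $\mathbb{F}_2(E)$ by adjoining the zeros of $T^2+T+r$ for all $r\in R$. Then: 1.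 $R\mapsto\mathbb{F}_2(X_R)$ is a bijection from the set of $\mathbb{F}_2$-subspaces of $S$ onto the set of fields $F$ with $\mathbb{F}_2(E)\subseteq F\subseteq\mathbb{F}_2(X_{123})$, and $R\subseteq R'$ if and only if $\mathbb{F}_2(X_R)\subseteq\mathbb{F}_2(X_{R'})$. Moreover $\mathbb{F}_2(X_{\{0\}})=\mathbb{F}_2(E)$ and $\mathbb{F}_2(X_S)=\mathbb{F}_2(X_{123})$. 2. If $R\subseteq R'\subseteq S$ are subspaces, then $[\mathbb{F}_2(X_{R'}):\mathbb{F}_2(X_R)]=\#(R'/R)$. 3. For every subspace $R\subseteq S$ the curve $X_R$ is absolutely irreducible, has genus $g(X_R)=1+7(\#R-1)$, and has $\#X_R(\mathbb{F}_2)=5\cdot\#R$ rational points. 4. In particular $X_1,X_2,X_3$ have genus $8$ and $10$ rational points over $\mathbb{F}_2$, and $X_{12}$ has genus $22$ and $20$ rational points over $\mathbb{F}_2$. -/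

import Mathlib

open scoped TensorProduct

noncomputable section

namespace FunctionFieldCurve

/-! The smooth complete curve attached to a function field `F` in one variable over `k`:
its closed points are the places of `F / k`. -/

/-- A place of `F / k`: a valuation ring of `F`, different from `F`, that contains `k`. -/
structure Place (k F : Type*) [Field k] [Field F] [Algebra k F] where
  /-- The local ring of the curve at the place. -/
  ring : ValuationSubring F
  algebraMap_mem : ∀ c : k, algebraMap k F c ∈ ring
  ne_top : ring ≠ ⊤

/-- A place is rational if its residue field is `k`: every element of the local ring is
congruent to a constant modulo the maximal ideal. -/
def Place.IsRational {k F : Type*} [Field k] [Field F] [Algebra k F] (P : Place k F) : Prop :=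
  ∀ a ∈ P.ring, ∃ c : k, P.ring.valuation (a - algebraMap k F c) < 1

/-- The number of `k`-rational points of the smooth complete curve with function field `F`. -/
def numRationalPoints (k F : Type*) [Field k] [Field F] [Algebra k F] : ℕ :=
  Nat.card {P : Place k F // P.IsRational}

/-- The differentials of `F / k` that are regular at `P`: the module generated over the local
ring by the differentials of its elements. -/
def Place.regularDifferentials {k F : Type*} [Field k] [Field F] [Algebra k F]
    (P : Place k F) : Submodule k (Ω[F⁄k]) :=
  Submodule.span k
    {ω | ∃ a ∈ P.ring, ∃ b ∈ P.ring, ω = a • KaehlerDifferential.D k F b}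

/-- The genus of the smooth complete curve with function field `F` over `k`:
the dimension of the space of everywhere regular differentials. -/
def genus (k F : Type*) [Field k] [Field F] [Algebra k F] : ℕ :=
  Module.finrank k (⨅ P : Place k F, P.regularDifferentials : Submodule k (Ω[F⁄k]))

/-- Absolute irreducibility of the curve: `k̄ ⊗ F` is a domain. -/
def IsAbsolutelyIrreducible (k F : Type*) [Field k] [Field F] [Algebra k F] : Prop :=
  IsDomain (AlgebraicClosure k ⊗[k] F)

end FunctionFieldCurve

namespace SerreCurve

open FunctionFieldCurve

/-- The elliptic curve `y² + y = x³ + x` over `𝔽₂`. -/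
def E : WeierstrassCurve.Affine (ZMod 2) where
  a₁ := 0
  a₂ := 0
  a₃ := 1
  a₄ := 1
  a₆ := 0

/-- The function field `𝔽₂(E)`. -/
abbrev K : Type := E.FunctionField

/-- The coordinate function `x` on `E`. -/
def x : K := algebraMap E.CoordinateRing K
  (WeierstrassCurve.Affine.CoordinateRing.mk E (Polynomial.C Polynomial.X))

/-- The coordinate function `y` on `E`. -/
def y : K := algebraMap E.CoordinateRing K
  (WeierstrassCurve.Affine.CoordinateRing.mk E Polynomial.X)

def f₁ : K := ((x ^ 5 + x) * y + (x ^ 2 + x)) / (x ^ 7 + x + 1)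

def f₂ : K := ((x ^ 5 + x ^ 4 + x ^ 3 + x) * y + (x ^ 6 + x ^ 4)) / (x ^ 7 + x + 1)

def f₃ : K := ((x ^ 6 + x ^ 5) * y + (x ^ 10 + x ^ 6 + x ^ 2 + x)) / (x ^ 14 + x ^ 2 + 1)

/-- The space `S = 𝔽₂ f₁ + 𝔽₂ f₂ + 𝔽₂ f₃`. -/
def S : Submodule (ZMod 2) K := Submodule.span (ZMod 2) {f₁, f₂, f₃}

/-- The extension of `𝔽₂(E)`, inside a fixed algebraic closure, obtained by adjoining all zeros
of the polynomials `T² + T + r` with `r ∈ A`. -/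
def adjoinRoots (A : Set K) : IntermediateField K (AlgebraicClosure K) :=
  IntermediateField.adjoin K
    {w | ∃ r ∈ A, w ^ 2 + w + algebraMap K (AlgebraicClosure K) r = 0}

/-- The function field `𝔽₂(X_{123})`. -/
def FX₁₂₃ : IntermediateField K (AlgebraicClosure K) := adjoinRoots {f₁, f₂, f₃}

/-- The function field `𝔽₂(X_{12})`. -/
def FX₁₂ : IntermediateField K (AlgebraicClosure K) := adjoinRoots {f₁, f₂}

/-- The function field `𝔽₂(X_R)` for a subspace `R`. -/
def FX (R : Submodule (ZMod 2) K) : IntermediateField K (AlgebraicClosure K) :=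
  adjoinRoots (R : Set K)

end SerreCurve

end

/-! On `E` the form `dx` has neither zeros nor poles, and there are five rational points: infinity
and two over each of `x = 0` and `x = 1`. Let `P` be the place of degree 7 where `x⁷ + x + 1` and `y
+ ramRoot` vanish. The functions `f₁, f₂, f₃` vanish at the five points and are regular away from
`P`, and every nonzero element of `S` acquires a simple pole at `P` after adding some `h² + h`.
Adjoining a root of `T² + T + r` is therefore totally ramified over `P` with different exponent 2,
unramified elsewhere, and split at the rational places. Each quadratic step doubles the number of
rational places and turns the order `d` of the zero of `dx` over `P` into `2d + 2`. After `n` steps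
`d = 2(2ⁿ - 1)`, and `2g - 2 = 7d` gives `g = 1 + 7(2ⁿ - 1)`.

The genus is obtained by counting. A differential `z dx` is regular everywhere exactly when `z` lies
in `L(dP)`, so the size of `L(dP)` is carried up the tower. The induction also needs the size of
`L((d+1)P)` and the vanishing of H¹ for `(d+1)P`, the latter as an approximation property. In
coordinates `a + b w` upstairs, `b` ranges over one pole space and `a` over a coset of another
(`card_poleSpace_step`). `IsLevel` collects everything the induction needs; `exists_isLevel_zero` is
the base and `IsLevel.step` the step. The delicate point is that the remaining elements of `S` can
again be reduced to a simple pole upstairs (`exists_simple_pole_step`).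

A simple pole is never a pole of some `a² + a`, so no nonzero element of `S` has this form in
`𝔽₂(E)` (`rootSpace_bot`). Artin-Schreier theory, done by counting degrees in
`rootSpace_sup_and_relfinrank`, then gives the correspondence. Absolute irreducibility follows from
the existence of a rational place. -/

open scoped TensorProduct
open WithZero Polynomial

/-- `L = F(w)` is a quadratic extension of the field `F` of characteristic two, generated by a
root `w` of `T ^ 2 + T + f`. -/
structure IsArtinSchreier (F L : Type*) [Field F] [Field L] [Algebra F L] (w : L) (f : F) :
    Prop where
  two_eq_zero : (2 : F) = 0
  eq : w ^ 2 + w = algebraMap F L f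
  exists_coords : ∀ z : L, ∃ a b : F, z = algebraMap F L a + algebraMap F L b * w
  ne_algebraMap : ∀ a : F, algebraMap F L a ≠ w

/-! ### Valuation rings and field extensions -/

section ValuationSubring

variable {F : Type*} [Field F]

lemma ValuationSubring.valuation_eq_one_iff_mem (V : ValuationSubring F) {z : F} (hz : z ≠ 0) :
    V.valuation z = 1 ↔ z ∈ V ∧ z⁻¹ ∈ V := by
  rw [← V.valuation_le_one_iff, ← V.valuation_le_one_iff, map_inv₀]
  have h0 : 0 < V.valuation z := by simpa [zero_lt_iff] using hz
  constructor
  · intro h; simp [h]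
  · rintro ⟨h1, h2⟩
    exact le_antisymm h1 ((inv_le_one₀ h0).1 h2)

lemma ValuationSubring.valuation_comap_lt_one_iff {L : Type*} [Field L] (φ : F →+* L)
    (V : ValuationSubring L) (z : F) :
    (V.comap φ).valuation z < 1 ↔ V.valuation (φ z) < 1 := by
  rw [← ValuationSubring.mem_nonunits_iff, ← ValuationSubring.mem_nonunits_iff,
    ValuationSubring.mem_nonunits_iff_or, ValuationSubring.mem_nonunits_iff_or,
    ValuationSubring.mem_comap, map_inv₀, map_eq_zero]

lemma ValuationSubring.mem_of_valuation_lt_one (V : ValuationSubring F) {z : F}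
    (hz : V.valuation z < 1) : z ∈ V := (V.valuation_le_one_iff z).1 hz.le

lemma ValuationSubring.valuation_one_add (V : ValuationSubring F) {z : F}
    (hz : V.valuation z < 1) : V.valuation (1 + z) = 1 :=
  V.valuation.map_one_add_of_lt hz

lemma ValuationSubring.valuation_add_one (V : ValuationSubring F) {z : F}
    (hz : V.valuation z < 1) : V.valuation (z + 1) = 1 := by
  rw [add_comm]; exact V.valuation_one_add hz

/-- Every valuation ring of a field is induced from any extension field. -/
lemma ValuationSubring.exists_comap_eq (V : ValuationSubring F) (L : Type*) [Field L]
    [Algebra F L] : ∃ V' : ValuationSubring L, V'.comap (algebraMap F L) = V := by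
  -- A valuation ring of `L` dominating `V`; locality of the map `V → A` yields the inclusion of the
  -- restriction in `V`.
  obtain ⟨A, hA, hloc⟩ := IsLocalRing.exists_factor_valuationRing
    ((algebraMap F L).comp V.subtype)
  refine ⟨A, ?_⟩
  ext z
  rw [ValuationSubring.mem_comap]
  refine ⟨fun hz => ?_, fun hz => hA ⟨z, hz⟩⟩
  by_contra hzV
  have hz0 : z ≠ 0 := by rintro rfl; exact hzV V.zero_mem
  have hi : z⁻¹ ∈ V := (V.mem_or_inv_mem z).resolve_left hzV
  have hu : IsUnit (⟨z⁻¹, hi⟩ : V) := by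
    refine hloc.map_nonunit _ ?_
    refine IsUnit.of_mul_eq_one (⟨algebraMap F L z, hz⟩ : A.toSubring) ?_
    apply Subtype.ext
    change algebraMap F L z⁻¹ * algebraMap F L z = 1
    rw [← map_mul, inv_mul_cancel₀ hz0, map_one]
  obtain ⟨⟨t, ht⟩, h1⟩ := hu.exists_right_inv
  have h2 : z⁻¹ * t = 1 := congrArg Subtype.val h1
  have : t = z := by field_simp at h2; exact h2
  exact hzV (this ▸ ht)

/-- A root of `T ^ 2 + T + f` is integral over every valuation ring that contains `f`. -/
lemma ValuationSubring.mem_of_sq_add_mem (V : ValuationSubring F) {w : F} (h : w ^ 2 + w ∈ V) :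
    w ∈ V := by
  by_contra hw
  have hw1 : 1 < V.valuation w := by
    rw [← V.valuation_le_one_iff] at hw; exact not_le.1 hw
  have h0 : 0 < V.valuation w := zero_lt_one.trans hw1
  have h2 : V.valuation w < V.valuation (w ^ 2) := by
    rw [map_pow, sq]; exact lt_mul_of_one_lt_left h0 hw1
  rw [← V.valuation_le_one_iff, Valuation.map_add_eq_of_lt_left _ h2] at h
  exact absurd h (not_le.2 (hw1.trans h2))

end ValuationSubring

/-! ### Places of a quadratic Artin-Schreier extension -/

namespace IsArtinSchreier

variable {F L : Type*} [Field F] [Field L] [Algebra F L] {w : L} {f : F}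

lemma two_eq_zero_right (h : IsArtinSchreier F L w f) : (2 : L) = 0 := by
  rw [← map_ofNat (algebraMap F L) 2, h.two_eq_zero, map_zero]

lemma coords_unique (h : IsArtinSchreier F L w f) {a b c d : F}
    (e : algebraMap F L a + algebraMap F L b * w = algebraMap F L c + algebraMap F L d * w) :
    a = c ∧ b = d := by
  have hbd : b = d := by
    by_contra hne
    have h1 : algebraMap F L (b - d) ≠ 0 := by simpa [sub_eq_zero] using hne
    refine h.ne_algebraMap ((c - a) / (b - d)) ?_
    rw [map_div₀, div_eq_iff h1, map_sub, map_sub]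
    linear_combination -e
  subst hbd
  exact ⟨(algebraMap F L).injective (add_right_cancel e), rfl⟩

/-- Translating the generator. -/
lemma translate (h : IsArtinSchreier F L w f) (c : F) :
    IsArtinSchreier F L (w + algebraMap F L c) (f + c ^ 2 + c) where
  two_eq_zero := h.two_eq_zero
  eq := by
    simp only [map_add, map_pow, ← h.eq]
    linear_combination w * algebraMap F L c * h.two_eq_zero_right
  exists_coords z := by
    obtain ⟨a, b, rfl⟩ := h.exists_coords z
    exact ⟨a - b * c, b, by simp only [map_sub, map_mul]; ring⟩
  ne_algebraMap a ha := h.ne_algebraMap (a - c) (by rw [map_sub, ha]; ring)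

/-- The coordinate at `1`. -/
noncomputable def fst (h : IsArtinSchreier F L w f) (z : L) : F := (h.exists_coords z).choose

/-- The coordinate at `w`. -/
noncomputable def snd (h : IsArtinSchreier F L w f) (z : L) : F :=
  (h.exists_coords z).choose_spec.choose

lemma eq_fst_add_snd (h : IsArtinSchreier F L w f) (z : L) :
    z = algebraMap F L (h.fst z) + algebraMap F L (h.snd z) * w :=
  (h.exists_coords z).choose_spec.choose_spec

lemma fst_snd_eq (h : IsArtinSchreier F L w f) {z : L} {a b : F}
    (e : z = algebraMap F L a + algebraMap F L b * w) : h.fst z = a ∧ h.snd z = b :=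
  h.coords_unique ((h.eq_fst_add_snd z).symm.trans e)

lemma coords_add (h : IsArtinSchreier F L w f) (z z' : L) :
    h.fst (z + z') = h.fst z + h.fst z' ∧ h.snd (z + z') = h.snd z + h.snd z' :=
  h.fst_snd_eq (by
    conv_lhs => rw [h.eq_fst_add_snd z, h.eq_fst_add_snd z']
    simp only [map_add]; ring)

lemma coords_mul (h : IsArtinSchreier F L w f) (z z' : L) :
    h.fst (z * z') = h.fst z * h.fst z' + h.snd z * h.snd z' * f ∧
    h.snd (z * z') = h.fst z * h.snd z' + h.snd z * h.fst z' + h.snd z * h.snd z' :=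
  h.fst_snd_eq (by
    conv_lhs => rw [h.eq_fst_add_snd z, h.eq_fst_add_snd z']
    simp only [map_add, map_mul, ← h.eq]
    linear_combination (-algebraMap F L (h.snd z) * algebraMap F L (h.snd z') * w) *
      h.two_eq_zero_right)

lemma coords_algebraMap (h : IsArtinSchreier F L w f) (a : F) :
    h.fst (algebraMap F L a) = a ∧ h.snd (algebraMap F L a) = 0 :=
  h.fst_snd_eq (by simp)

/-- The conjugation `w ↦ w + 1`. -/
noncomputable def conj (h : IsArtinSchreier F L w f) : L →+* L where
  toFun z := z + algebraMap F L (h.snd z)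
  map_one' := by
    have := (h.coords_algebraMap 1).2
    rw [map_one] at this
    simp [this]
  map_zero' := by
    have := (h.coords_algebraMap 0).2
    rw [map_zero] at this
    simp [this]
  map_add' z z' := by simp only [(h.coords_add z z').2, map_add]; ring
  map_mul' z z' := by
    simp only [(h.coords_mul z z').2, map_add, map_mul]
    linear_combination (-algebraMap F L (h.snd z')) * h.eq_fst_add_snd z -
      algebraMap F L (h.snd z) * h.eq_fst_add_snd z' -
      (w * algebraMap F L (h.snd z) * algebraMap F L (h.snd z')) * h.two_eq_zero_right

lemma conj_algebraMap (h : IsArtinSchreier F L w f) (a : F) :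
    h.conj (algebraMap F L a) = algebraMap F L a := by
  change _ + algebraMap F L (h.snd _) = _
  rw [(h.coords_algebraMap a).2]; simp

lemma conj_coords (h : IsArtinSchreier F L w f) (a b : F) :
    h.conj (algebraMap F L a + algebraMap F L b * w) =
      algebraMap F L a + algebraMap F L b * w + algebraMap F L b := by
  change _ + algebraMap F L (h.snd _) = _
  rw [(h.fst_snd_eq rfl).2]

lemma conj_gen (h : IsArtinSchreier F L w f) : h.conj w = w + 1 := by
  have := h.conj_coords 0 1
  simpa using this

lemma comap_conj_comap (h : IsArtinSchreier F L w f) (V : ValuationSubring L) :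
    (V.comap h.conj).comap (algebraMap F L) = V.comap (algebraMap F L) := by
  ext z
  simp only [ValuationSubring.mem_comap, h.conj_algebraMap]

/-- The coordinates of an element that is integral over a valuation ring containing `f`. -/
lemma coords_mem (h : IsArtinSchreier F L w f) {V : ValuationSubring F} (hf : f ∈ V) {a b : F}
    (hz : ∀ V' : ValuationSubring L, V'.comap (algebraMap F L) = V →
      algebraMap F L a + algebraMap F L b * w ∈ V') : a ∈ V ∧ b ∈ V := by
  obtain ⟨V', hV'⟩ := V.exists_comap_eq L
  have key : ∀ c : F, algebraMap F L c ∈ V' ↔ c ∈ V := fun c => by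
    rw [← hV', ValuationSubring.mem_comap]
  have h1 := hz V' hV'
  -- The conjugate valuation ring lies over `V` too. The difference of the element and its conjugate
  -- is `b`.
  have h2 := hz (V'.comap h.conj) (by rw [h.comap_conj_comap, hV'])
  rw [ValuationSubring.mem_comap, h.conj_coords] at h2
  have h3 : algebraMap F L b ∈ V' := by
    have := sub_mem h2 h1
    rwa [add_sub_cancel_left] at this
  have hw : w ∈ V' := V'.mem_of_sq_add_mem (by rwa [h.eq, key])
  have h4 : algebraMap F L a ∈ V' := by
    have := sub_mem h1 (V'.mul_mem _ _ h3 hw)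
    rwa [add_sub_cancel_right] at this
  exact ⟨(key _).1 h4, (key _).1 h3⟩

/-- Up to units of a special form, every element of `L` comes from `F`. -/
lemma exists_eq_mul_unit (h : IsArtinSchreier F L w f) (V : ValuationSubring L)
    (hf : algebraMap F L f ∈ V) (z : L) :
    ∃ s α β : F, algebraMap F L α ∈ V ∧ algebraMap F L β ∈ V ∧
      V.valuation (algebraMap F L α + algebraMap F L β * w) = 1 ∧
      (z = algebraMap F L s * (algebraMap F L α + algebraMap F L β * w) ∨
        z = algebraMap F L s * (algebraMap F L α + algebraMap F L β * w)⁻¹) := by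
  have hw : w ∈ V := V.mem_of_sq_add_mem (h.eq ▸ hf)
  have hw1 : V.valuation w ≤ 1 := (V.valuation_le_one_iff w).2 hw
  obtain ⟨a, b, rfl⟩ := h.exists_coords z
  -- The coordinate of larger value is factored out. If it is `a`, the cofactor `1 + (b / a) * w` is
  -- a unit.
  rcases lt_or_ge (V.valuation (algebraMap F L b)) (V.valuation (algebraMap F L a)) with hab | hab
  · have ha0 : algebraMap F L a ≠ 0 := by
      intro h0; rw [h0, map_zero] at hab; exact absurd hab (not_lt.2 zero_le)
    have hlt : V.valuation (algebraMap F L (b / a)) < 1 := by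
      rw [map_div₀, map_div₀]
      exact (div_lt_one₀ (by simpa [zero_lt_iff] using ha0)).2 hab
    refine ⟨a, 1, b / a, by simp [V.one_mem], V.mem_of_valuation_lt_one hlt, ?_, Or.inl ?_⟩
    · rw [map_one]
      apply V.valuation_one_add
      rw [map_mul]
      exact mul_lt_one_of_lt_of_le hlt hw1
    · rw [map_one, map_div₀]; field_simp
  · by_cases hb : b = 0
    · subst hb
      have ha : a = 0 := by simpa using hab
      subst ha
      exact ⟨0, 1, 0, by simp [V.one_mem], by simp [V.zero_mem], by simp, by simp⟩
    have hb0 : algebraMap F L b ≠ 0 := by simpa using hb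
    have hc : V.valuation (algebraMap F L (a / b)) ≤ 1 := by
      rw [map_div₀, map_div₀]
      exact (div_le_one₀ (by simpa [zero_lt_iff] using hb0)).2 hab
    have hcV := (V.valuation_le_one_iff _).1 hc
    have hz : algebraMap F L a + algebraMap F L b * w =
        algebraMap F L b * (algebraMap F L (a / b) + w) := by
      rw [map_div₀]; field_simp
    rcases V.valuation_lt_one_or_eq_one
      (⟨algebraMap F L (a / b) + w, V.add_mem _ _ hcV hw⟩ : V) with h1 | h1
    -- If `a / b + w` is not a unit, its conjugate `a / b + w + 1` is one, and their product is the
    -- norm `(a / b) ^ 2 + a / b + f`, which lies in `F`.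
    · have h2 := V.valuation_add_one h1
      have h3 : algebraMap F L (a / b + 1) + algebraMap F L 1 * w =
          algebraMap F L (a / b) + w + 1 := by simp only [map_add, map_one]; ring
      have h4 : algebraMap F L (a / b) + w + 1 ≠ 0 := by
        intro h0; rw [h0, map_zero] at h2; exact zero_ne_one h2
      refine ⟨b * ((a / b) ^ 2 + a / b + f), a / b + 1, 1, ?_, by simp [V.one_mem], ?_,
        Or.inr ?_⟩
      · rw [map_add, map_one]; exact V.add_mem _ _ hcV V.one_mem
      · rw [h3]; exact h2
      · rw [h3, eq_mul_inv_iff_mul_eq₀ h4, hz]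
        simp only [map_mul, map_add, map_pow, ← h.eq]
        linear_combination (algebraMap F L b * algebraMap F L (a / b) * w) * h.two_eq_zero_right
    · exact ⟨b, a / b, 1, hcV, by simp [V.one_mem], by simpa using h1, Or.inl (by simpa using hz)⟩

/-- Over a valuation ring whose maximal ideal contains `f` there is at most one valuation ring
whose maximal ideal contains `w`. -/
lemma le_of_comap_eq (h : IsArtinSchreier F L w f) {V V' : ValuationSubring L}
    (hV : V.comap (algebraMap F L) = V'.comap (algebraMap F L))
    (hw : V.valuation w < 1) (hw' : V'.valuation w < 1) : V ≤ V' := by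
  have key : ∀ a : F, algebraMap F L a ∈ V ↔ algebraMap F L a ∈ V' := fun a => by
    rw [← ValuationSubring.mem_comap, hV, ValuationSubring.mem_comap]
  have hf : algebraMap F L f ∈ V := by
    have := V.mem_of_valuation_lt_one hw
    rw [← h.eq]; exact V.add_mem _ _ (pow_mem this 2) this
  intro z hz
  obtain ⟨s, α, β, hα, hβ, ht, hzt⟩ := h.exists_eq_mul_unit V hf z
  have hβw : V.valuation (algebraMap F L β * w) < 1 := by
    rw [map_mul]; exact mul_lt_one_of_nonneg_of_lt_one_right ((V.valuation_le_one_iff _).2 hβ) zero_le hw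
  -- As `w` is in the maximal ideal, `α + β * w` is a unit exactly when `α` is, a condition visible
  -- in `F` and hence the same for `V'`.
  have hα1 : V.valuation (algebraMap F L α) = 1 := by
    by_contra hne
    have := lt_of_le_of_ne ((V.valuation_le_one_iff _).2 hα) hne
    exact absurd ht (ne_of_lt (V.valuation.map_add_lt this hβw))
  have hα0 : algebraMap F L α ≠ 0 := by
    intro h0; rw [h0, map_zero] at hα1; exact zero_ne_one hα1
  have hα1' : V'.valuation (algebraMap F L α) = 1 := by
    rw [ValuationSubring.valuation_eq_one_iff_mem _ hα0] at hα1 ⊢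
    rw [← map_inv₀] at hα1 ⊢
    exact ⟨(key _).1 hα1.1, (key _).1 hα1.2⟩
  have ht' : V'.valuation (algebraMap F L α + algebraMap F L β * w) = 1 := by
    rw [← hα1']
    apply Valuation.map_add_eq_of_lt_left
    rw [hα1', map_mul]
    exact mul_lt_one_of_nonneg_of_lt_one_right ((V'.valuation_le_one_iff _).2 ((key _).1 hβ)) zero_le hw'
  rw [← V'.valuation_le_one_iff]
  rw [← V.valuation_le_one_iff] at hz
  rcases hzt with rfl | rfl
  · rw [map_mul, ht, mul_one, V.valuation_le_one_iff] at hz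
    rw [map_mul, ht', mul_one, V'.valuation_le_one_iff]
    exact (key _).1 hz
  · rw [map_mul, map_inv₀, ht, inv_one, mul_one, V.valuation_le_one_iff] at hz
    rw [map_mul, map_inv₀, ht', inv_one, mul_one, V'.valuation_le_one_iff]
    exact (key _).1 hz

lemma eq_of_comap_eq (h : IsArtinSchreier F L w f) {V V' : ValuationSubring L}
    (hV : V.comap (algebraMap F L) = V'.comap (algebraMap F L))
    (hw : V.valuation w < 1) (hw' : V'.valuation w < 1) : V = V' :=
  le_antisymm (h.le_of_comap_eq hV hw hw') (h.le_of_comap_eq hV.symm hw' hw)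

lemma valuation_lt_one_or (h : IsArtinSchreier F L w f) {V : ValuationSubring L}
    (hf : V.valuation (algebraMap F L f) < 1) :
    V.valuation w < 1 ∨ V.valuation (w + 1) < 1 := by
  by_contra! hc
  have : V.valuation (algebraMap F L f) = V.valuation w * V.valuation (w + 1) := by
    rw [← h.eq, ← map_mul]; congr 1; ring
  rw [this] at hf
  exact absurd hf (not_lt.2 (one_le_mul hc.1 hc.2))

/-- One of `w`, `w + 1` vanishes at any extension of `V`, and conjugation exchanges the two. -/
lemma exists_comap_eq_and_lt_one (h : IsArtinSchreier F L w f) {V : ValuationSubring F}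
    (hf : V.valuation f < 1) :
    ∃ V' : ValuationSubring L, V'.comap (algebraMap F L) = V ∧ V'.valuation w < 1 := by
  obtain ⟨V', hV'⟩ := V.exists_comap_eq L
  have hf' : V'.valuation (algebraMap F L f) < 1 := by
    rw [← ValuationSubring.valuation_comap_lt_one_iff, hV']; exact hf
  rcases h.valuation_lt_one_or hf' with h1 | h1
  · exact ⟨V', hV', h1⟩
  · refine ⟨V'.comap h.conj, by rw [h.comap_conj_comap, hV'], ?_⟩
    rw [ValuationSubring.valuation_comap_lt_one_iff, h.conj_gen]; exact h1

lemma comap_ne_top (h : IsArtinSchreier F L w f) {V : ValuationSubring L} (hV : V ≠ ⊤) :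
    V.comap (algebraMap F L) ≠ ⊤ := by
  intro hc
  have key : ∀ a : F, algebraMap F L a ∈ V := fun a => by
    rw [← ValuationSubring.mem_comap, hc]; trivial
  apply hV
  rw [eq_top_iff]
  intro z _
  obtain ⟨a, b, rfl⟩ := h.exists_coords z
  exact V.add_mem _ _ (key a) (V.mul_mem _ _ (key b)
    (V.mem_of_sq_add_mem (h.eq ▸ key f)))

lemma comap_ne_top_iff (h : IsArtinSchreier F L w f) {V : ValuationSubring L} :
    V.comap (algebraMap F L) ≠ ⊤ ↔ V ≠ ⊤ := by
  refine ⟨?_, h.comap_ne_top⟩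
  rintro hV rfl
  exact hV (by ext; simp)

/-- In characteristic two `w ^ 2` has derivative zero, so differentiating `w ^ 2 + w` leaves only
that of `w`. -/
lemma derivation_gen (h : IsArtinSchreier F L w f) {k : Type*} [CommRing k] [Algebra k F]
    [Algebra k L] (D : Derivation k F F) (D' : Derivation k L L)
    (hD : ∀ a, D' (algebraMap F L a) = algebraMap F L (D a)) : D' w = algebraMap F L (D f) := by
  rw [← hD, ← h.eq, map_add, Derivation.leibniz_pow]
  simp only [nsmul_eq_mul, smul_eq_mul]
  linear_combination (-(w * D' w)) * h.two_eq_zero_right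

/-- If `D` preserves the valuation ring below and the valuation ring contains `f`, then `D`
preserves the valuation ring above. -/
lemma derivation_mem (h : IsArtinSchreier F L w f) {k : Type*} [CommRing k] [Algebra k F]
    [Algebra k L] (D : Derivation k F F) (D' : Derivation k L L)
    (hD : ∀ a, D' (algebraMap F L a) = algebraMap F L (D a)) (V : ValuationSubring L)
    (hV : ∀ a : F, algebraMap F L a ∈ V → algebraMap F L (D a) ∈ V)
    (hf : algebraMap F L f ∈ V) {z : L} (hz : z ∈ V) : D' z ∈ V := by
  have hw : w ∈ V := V.mem_of_sq_add_mem (h.eq ▸ hf)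
  have hDw := h.derivation_gen D D' hD
  -- Up to the units `α + β * w` the element `z` comes from below; these units have integral
  -- derivative because `D' w = D f` is integral.
  obtain ⟨s, α, β, hα, hβ, ht, hzt⟩ := h.exists_eq_mul_unit V hf z
  set t := algebraMap F L α + algebraMap F L β * w with ht_def
  have ht0 : t ≠ 0 := by intro h0; rw [h0, map_zero] at ht; exact zero_ne_one ht
  have htV := (V.valuation_eq_one_iff_mem ht0).1 ht
  have hDt : D' t ∈ V := by
    rw [ht_def, map_add, Derivation.leibniz, hD, hD, hDw, smul_eq_mul, smul_eq_mul]
    exact V.add_mem _ _ (hV _ hα) (V.add_mem _ _ (V.mul_mem _ _ hβ (hV _ hf))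
      (V.mul_mem _ _ hw (hV _ hβ)))
  rcases hzt with rfl | rfl
  · have hs : algebraMap F L s ∈ V := by
      have := V.mul_mem _ _ hz htV.2
      rwa [mul_assoc, mul_inv_cancel₀ ht0, mul_one] at this
    rw [Derivation.leibniz, hD, smul_eq_mul, smul_eq_mul]
    exact V.add_mem _ _ (V.mul_mem _ _ hs hDt) (V.mul_mem _ _ htV.1 (hV _ hs))
  · have hs : algebraMap F L s ∈ V := by
      have := V.mul_mem _ _ hz htV.1
      rwa [mul_assoc, inv_mul_cancel₀ ht0, mul_one] at this
    rw [Derivation.leibniz, Derivation.leibniz_inv, hD, smul_eq_mul, smul_eq_mul, smul_eq_mul]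
    exact V.add_mem _ _ (V.mul_mem _ _ hs (V.mul_mem _ _ (V.neg_mem _ (pow_mem htV.2 2)) hDt))
      (V.mul_mem _ _ htV.2 (hV _ hs))

end IsArtinSchreier

/-- The valuation rings of the rational places of a function field over `𝔽₂`. -/
def ratPlaces (F : Type*) [Field F] : Set (ValuationSubring F) :=
  {V | V ≠ ⊤ ∧ ∀ a ∈ V, V.valuation a < 1 ∨ V.valuation (a + 1) < 1}

/-! ### Splitting of rational places -/

namespace IsArtinSchreier

variable {F L : Type*} [Field F] [Field L] [Algebra F L] {w : L} {f : F}

lemma comap_mem_ratPlaces (h : IsArtinSchreier F L w f) {V : ValuationSubring L}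
    (hV : V ∈ ratPlaces L) : V.comap (algebraMap F L) ∈ ratPlaces F := by
  refine ⟨h.comap_ne_top hV.1, fun a ha => ?_⟩
  rw [ValuationSubring.valuation_comap_lt_one_iff, ValuationSubring.valuation_comap_lt_one_iff,
    map_add, map_one]
  exact hV.2 _ ha

lemma mem_ratPlaces_of_comap (h : IsArtinSchreier F L w f) {V : ValuationSubring L}
    (hV : V.comap (algebraMap F L) ∈ ratPlaces F) (hw : V.valuation w < 1) :
    V ∈ ratPlaces L := by
  refine ⟨h.comap_ne_top_iff.1 hV.1, fun z hz => ?_⟩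
  have hwV := V.mem_of_valuation_lt_one hw
  have hf : algebraMap F L f ∈ V := by
    rw [← h.eq]; exact V.add_mem _ _ (pow_mem hwV 2) hwV
  have key : ∀ a : F, algebraMap F L a ∈ V → V.valuation (algebraMap F L a) < 1 ∨
      V.valuation (algebraMap F L a + 1) < 1 := fun a ha => by
    have := hV.2 a ha
    rwa [ValuationSubring.valuation_comap_lt_one_iff, ValuationSubring.valuation_comap_lt_one_iff,
      map_add, map_one] at this
  obtain ⟨s, α, β, hα, hβ, ht, hzt⟩ := h.exists_eq_mul_unit V hf z
  have hβw : V.valuation (algebraMap F L β * w) < 1 := by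
    rw [map_mul]
    exact mul_lt_one_of_nonneg_of_lt_one_right ((V.valuation_le_one_iff _).2 hβ) zero_le hw
  set t := algebraMap F L α + algebraMap F L β * w with ht_def
  have ht0 : t ≠ 0 := by intro h0; rw [h0, map_zero] at ht; exact zero_ne_one ht
  -- The residue field below is `𝔽₂` and `w` reduces to zero, so the unit `t` reduces to `1`.
  have ht1 : V.valuation (t + 1) < 1 := by
    rcases key α hα with h1 | h1
    · exact absurd ht (ne_of_lt (V.valuation.map_add_lt h1 hβw))
    · have : t + 1 = (algebraMap F L α + 1) + algebraMap F L β * w := by rw [ht_def]; ring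
      rw [this]; exact V.valuation.map_add_lt h1 hβw
  rcases hzt with rfl | rfl
  · have hs : algebraMap F L s ∈ V := by
      rwa [← V.valuation_le_one_iff, map_mul, ht, mul_one, V.valuation_le_one_iff] at hz
    rcases key s hs with h1 | h1
    · left; rwa [map_mul, ht, mul_one]
    · right
      have : algebraMap F L s * t + 1 = (algebraMap F L s + 1) * t + (t + 1) := by
        linear_combination (-t) * h.two_eq_zero_right
      rw [this]
      refine V.valuation.map_add_lt ?_ ht1
      rwa [map_mul, ht, mul_one]
  · have hs : algebraMap F L s ∈ V := by
      rwa [← V.valuation_le_one_iff, map_mul, map_inv₀, ht, inv_one, mul_one,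
        V.valuation_le_one_iff] at hz
    rcases key s hs with h1 | h1
    · left; rwa [map_mul, map_inv₀, ht, inv_one, mul_one]
    · right
      have : algebraMap F L s * t⁻¹ + 1 = ((algebraMap F L s + 1) + (t + 1)) * t⁻¹ := by
        field_simp
        linear_combination (-1 : L) * h.two_eq_zero_right
      rw [this, map_mul, map_inv₀, ht, inv_one, mul_one]
      exact V.valuation.map_add_lt h1 ht1

/-- If `f` vanishes at the places in a set of rational places of `F`, they all split in `L`. -/
lemma card_ratPlaces_over (h : IsArtinSchreier F L w f) {T : Set (ValuationSubring F)}
    (hT : T ⊆ ratPlaces F) (hf : ∀ V ∈ T, V.valuation f < 1) :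
    Nat.card {V : ValuationSubring L | V ∈ ratPlaces L ∧ V.comap (algebraMap F L) ∈ T} =
      2 * Nat.card T := by
  classical
  have h' := h.translate 1
  rw [map_one] at h'
  -- A place over `T` is determined by its restriction and by which of `w`, `w + 1` vanishes at it.
  let φ : {V : ValuationSubring L | V ∈ ratPlaces L ∧ V.comap (algebraMap F L) ∈ T} →
      Bool × T := fun V =>
    (decide (V.1.valuation w < 1), ⟨V.1.comap (algebraMap F L), V.2.2⟩)
  have hφ : Function.Bijective φ := by
    constructor
    · rintro ⟨V, hV⟩ ⟨V', hV'⟩ he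
      have h1 : (V.valuation w < 1) ↔ (V'.valuation w < 1) :=
        decide_eq_decide.1 (congrArg Prod.fst he)
      have h2 : V.comap (algebraMap F L) = V'.comap (algebraMap F L) :=
        congrArg Subtype.val (congrArg Prod.snd he)
      apply Subtype.ext
      by_cases hw : V.valuation w < 1
      · exact h.eq_of_comap_eq h2 hw (h1.1 hw)
      · have hfV : ∀ V : ValuationSubring L, V.comap (algebraMap F L) ∈ T →
            ¬ V.valuation w < 1 → V.valuation (w + 1) < 1 := by
          intro V hV hw
          refine (h.valuation_lt_one_or ?_).resolve_left hw
          rw [← ValuationSubring.valuation_comap_lt_one_iff]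
          exact hf _ hV
        exact h'.eq_of_comap_eq h2 (hfV V hV.2 hw) (hfV V' hV'.2 (fun h3 => hw (h1.2 h3)))
    · rintro ⟨c, V, hV⟩
      cases c
      · have hf1 : V.valuation (f + 1 ^ 2 + 1) < 1 := by
          have : f + 1 ^ 2 + 1 = f := by linear_combination h.two_eq_zero
          rw [this]; exact hf V hV
        obtain ⟨V', hV', hw⟩ := h'.exists_comap_eq_and_lt_one hf1
        have hw1 : V'.valuation w = 1 := by
          have e : w = w + 1 + 1 := by linear_combination -h.two_eq_zero_right
          rw [e]; exact V'.valuation_add_one hw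
        refine ⟨⟨V', h'.mem_ratPlaces_of_comap (by rw [hV']; exact hT hV) hw, by rwa [hV']⟩, ?_⟩
        refine Prod.ext ?_ (Subtype.ext hV')
        simp [φ, hw1]
      · obtain ⟨V', hV', hw⟩ := h.exists_comap_eq_and_lt_one (hf V hV)
        refine ⟨⟨V', h.mem_ratPlaces_of_comap (by rw [hV']; exact hT hV) hw, by rwa [hV']⟩, ?_⟩
        refine Prod.ext ?_ (Subtype.ext hV')
        simp [φ, hw]
  rw [Nat.card_congr (Equiv.ofBijective φ hφ), Nat.card_prod]
  simp

/-- If `f` vanishes at all rational places of `F`, they all split in `L`. -/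
lemma card_ratPlaces (h : IsArtinSchreier F L w f)
    (hf : ∀ V ∈ ratPlaces F, V.valuation f < 1) :
    Nat.card (ratPlaces L) = 2 * Nat.card (ratPlaces F) := by
  rw [← h.card_ratPlaces_over subset_rfl hf]
  congr 2
  ext V
  exact ⟨fun hV => ⟨hV, h.comap_mem_ratPlaces hV⟩, fun hV => hV.1⟩

end IsArtinSchreier

/-! ### Discrete valuations -/

section WithZeroInt

lemma WithZero.eq_zero_or_exp (a : ℤᵐ⁰) : a = 0 ∨ ∃ n : ℤ, a = exp n := by
  by_cases h : a = 0
  · exact Or.inl h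
  · exact Or.inr ⟨log a, (exp_log h).symm⟩

lemma WithZero.exp_sq (n : ℤ) : (exp n : ℤᵐ⁰) ^ 2 = exp (2 * n) := by
  rw [← exp_nsmul]; simp

/-- Here `m` is `n / 2` rounded down. This and the next lemma translate pole orders between a
ramified place and the place below. -/
lemma WithZero.sq_le_exp_iff {a : ℤᵐ⁰} {n : ℤ} (m : ℤ) (h : n = 2 * m ∨ n = 2 * m + 1) :
    a ^ 2 ≤ exp n ↔ a ≤ exp m := by
  rcases eq_zero_or_exp a with rfl | ⟨k, rfl⟩
  · simp
  · rw [exp_sq, exp_le_exp, exp_le_exp]; omega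

lemma WithZero.sq_mul_exp_le_exp_iff {a : ℤᵐ⁰} {c n : ℤ} (m : ℤ)
    (h : n - c = 2 * m ∨ n - c = 2 * m + 1) :
    a ^ 2 * exp c ≤ exp n ↔ a ≤ exp m := by
  rcases eq_zero_or_exp a with rfl | ⟨k, rfl⟩
  · simp
  · rw [exp_sq, ← exp_add, exp_le_exp, exp_le_exp]; omega

lemma WithZero.lt_one_iff_le_exp {a : ℤᵐ⁰} : a < 1 ↔ a ≤ exp (-1) := by
  rcases eq_zero_or_exp a with rfl | ⟨k, rfl⟩
  · simp
  · rw [← exp_zero, exp_lt_exp, exp_le_exp]; omega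

/-- The valuation ring of a discrete valuation is a maximal proper subring. -/
lemma Valuation.valuationSubring_eq_of_le_of_ne_top {F : Type*} [Field F] {v : Valuation F ℤᵐ⁰}
    {V : ValuationSubring F} (hle : v.valuationSubring ≤ V) (hV : V ≠ ⊤) :
    v.valuationSubring = V := by
  refine le_antisymm hle fun z hz => ?_
  by_contra hzv
  rw [Valuation.mem_valuationSubring_iff, not_le] at hzv
  apply hV
  rw [eq_top_iff]
  intro y _
  have hz0 : z ≠ 0 := by rintro rfl; simp at hzv
  obtain ⟨m, hm⟩ := (eq_zero_or_exp (v z)).resolve_left (by simpa using hz0)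
  rw [hm, ← exp_zero, exp_lt_exp] at hzv
  obtain ⟨n, hn⟩ : ∃ n : ℕ, v y ≤ exp (n : ℤ) := by
    rcases eq_zero_or_exp (v y) with h0 | ⟨j, hj⟩
    · exact ⟨0, by rw [h0]; exact zero_le⟩
    · exact ⟨j.toNat, by rw [hj, exp_le_exp]; omega⟩
  -- `z` has a pole, so a high power of it absorbs the pole of any `y`.
  have hy : y = z ^ n * (y / z ^ n) := by field_simp
  rw [hy]
  refine V.mul_mem _ _ (pow_mem hz n) (hle ?_)
  have hnm : (n : ℤ) ≤ n * m := by nlinarith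
  have hzn : v (z ^ n) = exp (n * m) := by
    rw [map_pow, hm, ← exp_nsmul]; simp
  rw [Valuation.mem_valuationSubring_iff, map_div₀, hzn]
  refine div_le_one_of_le₀ (hn.trans (by rwa [exp_le_exp])) zero_le

end WithZeroInt

/-! ### The totally ramified place -/

namespace IsArtinSchreier

variable {F L : Type*} [Field F] [Field L] [Algebra F L] {w : L} {f : F}

/-- As `c` is odd, the orders of `a ^ 2` and `b ^ 2 * f` have different parity, so these terms
cannot cancel. As `c > 0`, the mixed term is strictly smaller than the larger one (when `a`, `b` are
nonzero). -/
lemma valuation_norm (v : Valuation F ℤᵐ⁰) {c : ℤ} (hc : 0 < c) (hodd : Odd c)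
    (hv : v f = exp c) (a b : F) :
    v (a ^ 2 + a * b + b ^ 2 * f) = max (v a ^ 2) (v b ^ 2 * exp c) := by
  obtain ⟨j, hj⟩ := hodd
  have hbf : v (b ^ 2 * f) = v b ^ 2 * exp c := by rw [map_mul, map_pow, hv]
  have haa : v (a ^ 2) = v a ^ 2 := map_pow _ _ _
  by_cases ha0 : a = 0
  · subst ha0; simp [hv]
  by_cases hb0 : b = 0
  · subst hb0; simp
  obtain ⟨m, hm⟩ := (eq_zero_or_exp (v a)).resolve_left (by simpa using ha0)
  obtain ⟨n, hn⟩ := (eq_zero_or_exp (v b)).resolve_left (by simpa using hb0)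
  have hab : v (a * b) = exp (m + n) := by rw [map_mul, hm, hn, exp_add]
  rw [hm, exp_sq] at haa
  rw [hn, exp_sq, ← exp_add] at hbf
  rw [hm, hn, exp_sq, exp_sq, ← exp_add]
  rcases lt_or_ge (2 * n + c) (2 * m) with h | h
  · rw [max_eq_left (by rw [exp_le_exp]; omega), add_assoc, ← haa]
    apply Valuation.map_add_eq_of_lt_left
    refine v.map_add_lt ?_ ?_
    · rw [haa, hab, exp_lt_exp]; omega
    · rw [haa, hbf, exp_lt_exp]; omega
  · rw [max_eq_right (by rw [exp_le_exp]; omega), ← hbf]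
    apply Valuation.map_add_eq_of_lt_right
    refine v.map_add_lt ?_ ?_
    · rw [haa, hbf, exp_lt_exp]; omega
    · rw [hab, hbf, exp_lt_exp]; omega

/-- The extension of a discrete valuation with a pole of odd order at `f`, normalized to be
integer valued; it is given by the norm. -/
noncomputable def ramified (h : IsArtinSchreier F L w f) (v : Valuation F ℤᵐ⁰) {c : ℤ}
    (hc : 0 < c) (hodd : Odd c) (hv : v f = exp c) : Valuation L ℤᵐ⁰ where
  toFun z := v (h.fst z ^ 2 + h.fst z * h.snd z + h.snd z ^ 2 * f)
  map_zero' := by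
    have := h.coords_algebraMap 0
    rw [map_zero] at this
    simp [this.1, this.2]
  map_one' := by
    have := h.coords_algebraMap 1
    rw [map_one] at this
    simp [this.1, this.2]
  map_mul' z z' := by
    rw [← map_mul, (h.coords_mul z z').1, (h.coords_mul z z').2]
    congr 1
    linear_combination (2 * (h.fst z * h.snd z * h.fst z' * h.snd z' * f) +
      h.snd z ^ 2 * h.snd z' ^ 2 * f +
      h.snd z * h.snd z' * f * (h.fst z * h.snd z' + h.snd z * h.fst z')) * h.two_eq_zero
  map_add_le_max' z z' := by
    rw [(h.coords_add z z').1, (h.coords_add z z').2]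
    simp only [valuation_norm v hc hodd hv]
    rw [max_le_iff]
    constructor
    · rcases le_max_iff.1 (v.map_add (h.fst z) (h.fst z')) with h1 | h1
      · exact le_max_of_le_left (le_max_of_le_left (pow_le_pow_left₀ zero_le h1 2))
      · exact le_max_of_le_right (le_max_of_le_left (pow_le_pow_left₀ zero_le h1 2))
    · rcases le_max_iff.1 (v.map_add (h.snd z) (h.snd z')) with h1 | h1
      · exact le_max_of_le_left (le_max_of_le_right
          (mul_le_mul_left (pow_le_pow_left₀ zero_le h1 2) _))
      · exact le_max_of_le_right (le_max_of_le_right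
          (mul_le_mul_left (pow_le_pow_left₀ zero_le h1 2) _))

variable (h : IsArtinSchreier F L w f) {v : Valuation F ℤᵐ⁰} {c : ℤ} (hc : 0 < c)
  (hodd : Odd c) (hv : v f = exp c)
include h hc hodd hv

lemma ramified_coords (a b : F) :
    h.ramified v hc hodd hv (algebraMap F L a + algebraMap F L b * w) =
      max (v a ^ 2) (v b ^ 2 * exp c) := by
  obtain ⟨h1, h2⟩ := h.fst_snd_eq (z := algebraMap F L a + algebraMap F L b * w) rfl
  change v _ = _
  rw [h1, h2, valuation_norm v hc hodd hv]

lemma ramified_algebraMap (a : F) :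
    h.ramified v hc hodd hv (algebraMap F L a) = v a ^ 2 := by
  have := h.ramified_coords hc hodd hv a 0
  simpa using this

lemma ramified_gen : h.ramified v hc hodd hv w = exp c := by
  have := h.ramified_coords hc hodd hv 0 1
  simpa using this

lemma comap_ramified :
    (h.ramified v hc hodd hv).valuationSubring.comap (algebraMap F L) = v.valuationSubring := by
  ext a
  rw [ValuationSubring.mem_comap, Valuation.mem_valuationSubring_iff,
    Valuation.mem_valuationSubring_iff, h.ramified_algebraMap hc hodd hv, ← exp_zero,
    sq_le_exp_iff 0 (by omega)]

/-- The ramified place is the only one over its restriction. -/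
lemma eq_ramified {V : ValuationSubring L}
    (hV : V.comap (algebraMap F L) = v.valuationSubring) (hv1 : ∃ π, v π = exp (-1)) :
    V = (h.ramified v hc hodd hv).valuationSubring := by
  have key : ∀ a : F, algebraMap F L a ∈ V ↔ v a ≤ 1 := fun a => by
    rw [← ValuationSubring.mem_comap, hV, Valuation.mem_valuationSubring_iff]
  obtain ⟨π, hπ⟩ := hv1
  -- A discrete valuation ring is maximal among proper subrings, so one inclusion suffices.
  refine (Valuation.valuationSubring_eq_of_le_of_ne_top ?_ ?_).symm
  · intro z hz
    obtain ⟨a, b, rfl⟩ := h.exists_coords z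
    rw [Valuation.mem_valuationSubring_iff, h.ramified_coords hc hodd hv, max_le_iff,
      ← exp_zero, sq_le_exp_iff 0 (by omega)] at hz
    refine V.add_mem _ _ ((key a).2 (by simpa using hz.1)) ?_
    by_contra hbw
    have hbw1 : 1 < V.valuation (algebraMap F L b * w) := by
      rw [← V.valuation_le_one_iff] at hbw; exact not_le.1 hbw
    -- Because `f` has a pole, integrality of `b * w` for the ramified valuation puts `b` in the
    -- maximal ideal.
    have hb1 : V.valuation (algebraMap F L b) < 1 := by
      have hvb : v b ≤ exp (-1) := by
        obtain ⟨j, hj⟩ := hodd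
        have := hz.2
        rcases eq_zero_or_exp (v b) with h0 | ⟨n, hn⟩
        · rw [h0]; exact zero_le
        · rw [hn, exp_sq, ← exp_add, exp_le_exp] at this
          rw [hn, exp_le_exp]; omega
      rw [← ValuationSubring.mem_nonunits_iff, ValuationSubring.mem_nonunits_iff_or]
      by_cases hb0 : b = 0
      · left; simp [hb0]
      · right
        rw [← map_inv₀, key, map_inv₀, not_le]
        obtain ⟨n, hn⟩ := (eq_zero_or_exp (v b)).resolve_left (by simpa using hb0)
        rw [hn, exp_le_exp] at hvb
        rw [hn, ← exp_neg, ← exp_zero, exp_lt_exp]; omega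
    -- `(b w)² = b² f + b · (b w)` with `b² f` integral
    have e2 : (algebraMap F L b * w) ^ 2 =
        algebraMap F L (b ^ 2 * f) + (-algebraMap F L b) * (algebraMap F L b * w) := by
      simp only [map_mul, map_pow, ← h.eq]; ring
    have hbf : V.valuation (algebraMap F L (b ^ 2 * f)) ≤ 1 := by
      rw [V.valuation_le_one_iff, key, map_mul, map_pow, hv]
      simpa using hz.2
    have h0 : 0 < V.valuation (algebraMap F L b * w) := zero_lt_one.trans hbw1
    have h3 : V.valuation ((algebraMap F L b * w) ^ 2) ≤ V.valuation (algebraMap F L b * w) := by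
      rw [e2]
      refine (V.valuation.map_add _ _).trans (max_le (hbf.trans hbw1.le) ?_)
      rw [map_mul, Valuation.map_neg]
      exact mul_le_of_le_one_left zero_le hb1.le
    rw [map_pow, sq] at h3
    exact absurd h3 (not_le.2 (lt_mul_of_one_lt_left h0 hbw1))
  · apply h.comap_ne_top_iff.1
    rw [hV]
    intro ht
    have : π⁻¹ ∈ v.valuationSubring := ht ▸ ValuationSubring.mem_top _
    rw [Valuation.mem_valuationSubring_iff, map_inv₀, hπ, ← exp_neg, ← exp_zero, exp_le_exp] at this
    omega

end IsArtinSchreier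

/-- The functions without poles outside the place of `v`. -/
def regularAway {F : Type*} [Field F] (v : Valuation F ℤᵐ⁰) : Set F :=
  {z | ∀ V : ValuationSubring F, V ≠ ⊤ → V ≠ v.valuationSubring → z ∈ V}

/-- The functions whose only pole is at the place of `v`, of order at most `c`. -/
def poleSpace {F : Type*} [Field F] (v : Valuation F ℤᵐ⁰) (c : ℤ) : Set F :=
  {z | z ∈ regularAway v ∧ v z ≤ exp c}

/-- The order of the zero of the invariant differential at the ramified place. -/
def diffExp (n : ℕ) : ℤ := 2 * (2 ^ n - 1)

/-- Hurwitz's formula for one step: the order is multiplied by the ramification index 2 and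
increased by the different exponent 2. -/
lemma diffExp_succ (n : ℕ) : diffExp (n + 1) = 2 * diffExp n + 2 := by
  simp only [diffExp, pow_succ]; ring

/-- The state of knowledge about the field `F` obtained by adjoining the roots of `T ^ 2 + T + r`,
`r ∈ R`, in a tower of extensions of `K` that are totally ramified at one place `v`, unramified
elsewhere, and in which the rational places split; the elements of `S` are available for further
extensions. -/
structure IsLevel {K F : Type*} [Field K] [Field F] [Algebra K F] [Algebra (ZMod 2) K]
    [Algebra (ZMod 2) F] (S R : Submodule (ZMod 2) K) (D : Derivation (ZMod 2) F F)
    (v : Valuation F ℤᵐ⁰) (n : ℕ) : Prop where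
  -- With the next field: `dx` vanishes at the place of `v` to order exactly `diffExp n`.
  derivation_le : ∀ z, v z ≤ 1 → v (D z) ≤ exp (diffExp n)
  exists_uniformizer : ∃ π, v π = exp (-1) ∧ v (D π) = exp (diffExp n)
  perfect : ∀ c, v c ≤ 1 → ∃ γ, v γ ≤ 1 ∧ v (γ ^ 2 - c) < 1
  -- A pole of order one is odd, which forces total ramification, and gives different exponent 2.
  exists_simple_pole : ∀ r ∈ S, r ∉ R → ∃ h, v (algebraMap K F r + h ^ 2 + h) = exp 1
  -- With the next field: `dx` has neither zeros nor poles at the other places.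
  derivation_mem : ∀ V : ValuationSubring F, V ≠ ⊤ → V ≠ v.valuationSubring → ∀ z ∈ V, D z ∈ V
  exists_derivation_unit : ∀ V : ValuationSubring F, V ≠ ⊤ → V ≠ v.valuationSubring →
    ∃ b ∈ V, D b ≠ 0 ∧ (D b)⁻¹ ∈ V
  regular : ∀ r ∈ S, algebraMap K F r ∈ regularAway v
  -- With `g = 7 * 2 ^ n - 6` these are the Riemann-Roch dimensions: `g` for the canonical divisor,
  -- and `g + 6` for a divisor of degree `2g - 2 + 7`.
  card_low : Nat.card (poleSpace v (diffExp n)) = 2 ^ (7 * 2 ^ n - 6)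
  card_high : Nat.card (poleSpace v (diffExp n + 1)) = 2 ^ (7 * 2 ^ n)
  -- The vanishing of H¹ for the divisor `(diffExp n + 1) P`.
  approx : ∀ z, ∃ r ∈ regularAway v, v (z - r) ≤ exp (diffExp n + 1)
  card_ratPlaces : Nat.card (ratPlaces F) = 5 * 2 ^ n
  vanish : ∀ V ∈ ratPlaces F, ∀ r ∈ S, V.valuation (algebraMap K F r) < 1

lemma regularAway.add {F : Type*} [Field F] {v : Valuation F ℤᵐ⁰} {a b : F}
    (ha : a ∈ regularAway v) (hb : b ∈ regularAway v) : a + b ∈ regularAway v :=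
  fun V h1 h2 => V.add_mem _ _ (ha V h1 h2) (hb V h1 h2)

lemma regularAway.sub {F : Type*} [Field F] {v : Valuation F ℤᵐ⁰} {a b : F}
    (ha : a ∈ regularAway v) (hb : b ∈ regularAway v) : a - b ∈ regularAway v :=
  fun V h1 h2 => sub_mem (ha V h1 h2) (hb V h1 h2)

lemma regularAway.mul {F : Type*} [Field F] {v : Valuation F ℤᵐ⁰} {a b : F}
    (ha : a ∈ regularAway v) (hb : b ∈ regularAway v) : a * b ∈ regularAway v :=
  fun V h1 h2 => V.mul_mem _ _ (ha V h1 h2) (hb V h1 h2)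

/-! ### Poles of `e² + e` -/

section Valuation

variable {F : Type*} [Field F] {v : Valuation F ℤᵐ⁰}

lemma Valuation.ne_zero_of_eq_exp {z : F} {c : ℤ} (h : v z = exp c) : z ≠ 0 := by
  rintro rfl
  rw [map_zero] at h
  exact exp_ne_zero h.symm

lemma Valuation.sq_add_self_of_one_lt {e : F} (he : 1 < v e) : v (e ^ 2 + e) = v e ^ 2 := by
  rw [← map_pow]
  apply Valuation.map_add_eq_of_lt_left
  rw [map_pow, sq]
  exact lt_mul_of_one_lt_left (zero_lt_one.trans he) he

lemma Valuation.sq_add_self_le_one {e : F} (he : v e ≤ 1) : v (e ^ 2 + e) ≤ 1 := by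
  refine (v.map_add _ _).trans (max_le ?_ he)
  rw [map_pow]; exact pow_le_one₀ zero_le he

lemma Valuation.le_one_of_sq_add_self_le {e : F} (he : v (e ^ 2 + e) ≤ exp 1) : v e ≤ 1 := by
  by_contra hc
  rw [not_le] at hc
  rw [v.sq_add_self_of_one_lt hc, sq_le_exp_iff 0 (by omega), exp_zero] at he
  exact absurd he (not_le.2 hc)

/-- A pole of `e` is doubled in `e ^ 2 + e`, so the order is never one. -/
lemma Valuation.sq_add_self_ne (e : F) : v (e ^ 2 + e) ≠ exp 1 := by
  intro h
  have := v.sq_add_self_le_one (v.le_one_of_sq_add_self_le h.le)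
  rw [h, ← exp_zero, exp_le_exp] at this
  omega

end Valuation

/-! ### One step of the tower -/

namespace IsLevel

variable {K F L : Type*} [Field K] [Field F] [Field L] [Algebra K F] [Algebra K L] [Algebra F L]
  [IsScalarTower K F L] [Algebra (ZMod 2) K] [Algebra (ZMod 2) F] [Algebra (ZMod 2) L]
  {S R : Submodule (ZMod 2) K} {D : Derivation (ZMod 2) F F} {D' : Derivation (ZMod 2) L L}
  {v : Valuation F ℤᵐ⁰} {n : ℕ}

/-- If `r = a ^ 2 + a`, then `r + h ^ 2 + h = (a + h) ^ 2 + (a + h)`, which has no simple pole. -/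
lemma root_not_mem (hl : IsLevel S R D v n) {r : K} (hr : r ∈ S) (hrR : r ∉ R) (a : F) :
    a ^ 2 + a ≠ algebraMap K F r := by
  have h2 : (2 : F) = 0 := by
    have := CharP.cast_eq_zero (ZMod 2) 2
    rw [← map_ofNat (algebraMap (ZMod 2) F) 2, show (OfNat.ofNat 2 : ZMod 2) = 0 from this,
      map_zero]
  intro ha
  obtain ⟨h, hh⟩ := hl.exists_simple_pole r hr hrR
  apply v.sq_add_self_ne (a + h)
  rw [← hh, ← ha]
  congr 1
  linear_combination a * h * h2

/-- For `t = u * π` with a unit `u`, the term `π * D u` is strictly smaller than `u * D π`. -/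
lemma derivation_uniformizer (hl : IsLevel S R D v n) {t : F} (ht : v t = exp (-1)) :
    v (D t) = exp (diffExp n) := by
  obtain ⟨π, hπ, hDπ⟩ := hl.exists_uniformizer
  have hπ0 : π ≠ 0 := v.ne_zero_of_eq_exp hπ
  have hu : v (t / π) = 1 := by rw [map_div₀, ht, hπ]; exact div_self exp_ne_zero
  have e : t = (t / π) * π := by field_simp
  rw [e, Derivation.leibniz, smul_eq_mul, smul_eq_mul]
  have h1 : v (t / π * D π) = exp (diffExp n) := by rw [map_mul, hu, one_mul, hDπ]
  rw [← h1]
  apply Valuation.map_add_eq_of_lt_left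
  rw [h1, map_mul, hπ]
  calc exp (-1) * v (D (t / π)) ≤ exp (-1) * exp (diffExp n) :=
        mul_le_mul_right (hl.derivation_le _ hu.le) _
    _ < exp (diffExp n) := by rw [← exp_add, exp_lt_exp]; omega

/-- `g⁻¹` is a uniformizer and `D g = -g ^ 2 * D g⁻¹`. -/
lemma derivation_simple_pole (hl : IsLevel S R D v n) {g : F} (hg : v g = exp 1) :
    v (D g) = exp (diffExp n + 2) := by
  have h1 : v (D g⁻¹) = exp (diffExp n) :=
    hl.derivation_uniformizer (by rw [map_inv₀, hg, exp_neg])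
  have e : D g = -(g ^ 2 * D g⁻¹) := by
    have hg0 : g ≠ 0 := v.ne_zero_of_eq_exp hg
    rw [Derivation.leibniz_inv, smul_eq_mul]; field_simp
  rw [e, Valuation.map_neg, map_mul, h1, map_pow, hg, exp_sq, ← exp_add]
  congr 1; ring

section Step

set_option linter.unusedSectionVars false

variable {w : L} {f : K} {h₀ : F}

/-- Away from the ramified place `f` is integral, so integrality over a place below can be tested on
the coordinates with respect to `w`. -/
lemma mem_regularAway_step (hl : IsLevel S R D v n) (hfS : f ∈ S)
    (h : IsArtinSchreier F L w (algebraMap K F f))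
    (hv : v (algebraMap K F f + h₀ ^ 2 + h₀) = exp 1) (a b : F) :
    algebraMap F L a + algebraMap F L b * w ∈
      regularAway ((h.translate h₀).ramified v one_pos odd_one hv) ↔
      a ∈ regularAway v ∧ b ∈ regularAway v := by
  obtain ⟨π, hπ, -⟩ := hl.exists_uniformizer
  have hu := h.translate h₀
  constructor
  · intro hz
    have main : ∀ V : ValuationSubring F, V ≠ ⊤ → V ≠ v.valuationSubring → a ∈ V ∧ b ∈ V := by
      intro V hV hVv
      refine h.coords_mem (hl.regular f hfS V hV hVv) fun U hU =>
        hz U (h.comap_ne_top_iff.1 (hU ▸ hV)) ?_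
      rintro rfl
      exact hVv (hU.symm.trans (hu.comap_ramified one_pos odd_one hv))
    exact ⟨fun V h1 h2 => (main V h1 h2).1, fun V h1 h2 => (main V h1 h2).2⟩
  · rintro ⟨ha, hb⟩ V hV hVv
    have h1 := h.comap_ne_top hV
    have h2 : V.comap (algebraMap F L) ≠ v.valuationSubring := fun hc =>
      hVv (hu.eq_ramified one_pos odd_one hv hc ⟨π, hπ⟩)
    have hw : w ∈ V := V.mem_of_sq_add_mem (by
      rw [h.eq]; exact hl.regular f hfS _ h1 h2)
    exact V.add_mem _ _ (ha _ h1 h2) (V.mul_mem _ _ (hb _ h1 h2) hw)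

/-- The norm formula is valid for the generator `w + h₀`, whose equation has a simple pole;
returning to `w` shifts `a` by `b * h₀`. -/
lemma ramified_step (h : IsArtinSchreier F L w (algebraMap K F f))
    (hv : v (algebraMap K F f + h₀ ^ 2 + h₀) = exp 1) (a b : F) :
    (h.translate h₀).ramified v one_pos odd_one hv (algebraMap F L a + algebraMap F L b * w) =
      max (v (a - b * h₀) ^ 2) (v b ^ 2 * exp 1) := by
  rw [← (h.translate h₀).ramified_coords one_pos odd_one hv]
  congr 1
  simp only [map_sub, map_mul]; ring

/-- Coordinates with respect to `w` govern the poles elsewhere, those with respect to `w + h₀` the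
pole at the ramified place. They differ by `b * h₀`, which `approx` replaces by a regular function
`s b` up to pole order `diffExp n + 1`; hence `b` and `a - s b` vary independently. The bounds `m`
and `diffExp n + 1` are the halves of `M - 1` and `M`, rounded down. -/
lemma card_poleSpace_step (hl : IsLevel S R D v n) (hfS : f ∈ S)
    (h : IsArtinSchreier F L w (algebraMap K F f))
    (hv : v (algebraMap K F f + h₀ ^ 2 + h₀) = exp 1) {m M : ℤ}
    (hM : M - 1 = 2 * m ∨ M - 1 = 2 * m + 1)
    (hM' : M = 2 * (diffExp n + 1) ∨ M = 2 * (diffExp n + 1) + 1) :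
    Nat.card (poleSpace ((h.translate h₀).ramified v one_pos odd_one hv) M) =
      Nat.card (poleSpace v m) * Nat.card (poleSpace v (diffExp n + 1)) := by
  choose s hs hsv using fun b : F => hl.approx (b * h₀)
  have key : ∀ a b : F, algebraMap F L a + algebraMap F L b * w ∈
      poleSpace ((h.translate h₀).ramified v one_pos odd_one hv) M ↔
      b ∈ poleSpace v m ∧ a - s b ∈ poleSpace v (diffExp n + 1) := by
    intro a b
    have e1 : a - b * h₀ = (a - s b) - (b * h₀ - s b) := by ring
    have e2 : a - s b = (a - b * h₀) + (b * h₀ - s b) := by ring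
    simp only [poleSpace, Set.mem_ofPred_eq, hl.mem_regularAway_step hfS h hv,
      ramified_step h hv, max_le_iff, sq_le_exp_iff _ hM', sq_mul_exp_le_exp_iff _ hM]
    constructor
    · rintro ⟨⟨ha, hb⟩, h1, h2⟩
      refine ⟨⟨hb, h2⟩, regularAway.sub ha (hs b), ?_⟩
      rw [e2]; exact v.map_add_le h1 (hsv b)
    · rintro ⟨⟨hb, h2⟩, ha, h1⟩
      refine ⟨⟨?_, hb⟩, ?_, h2⟩
      · have := regularAway.add ha (hs b)
        rwa [sub_add_cancel] at this
      · rw [e1]; exact v.map_sub_le h1 (hsv b)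
  let φ : poleSpace v m × poleSpace v (diffExp n + 1) →
      poleSpace ((h.translate h₀).ramified v one_pos odd_one hv) M := fun x =>
    ⟨algebraMap F L (x.2.1 + s x.1.1) + algebraMap F L x.1.1 * w,
      (key _ _).2 ⟨x.1.2, by rw [add_sub_cancel_right]; exact x.2.2⟩⟩
  have hφ : Function.Bijective φ := by
    constructor
    · rintro ⟨⟨b, hb⟩, ⟨a, ha⟩⟩ ⟨⟨b', hb'⟩, ⟨a', ha'⟩⟩ he
      obtain ⟨h1, h2⟩ := h.coords_unique (congrArg Subtype.val he)
      simp only at h1 h2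
      subst h2
      have h3 := add_right_cancel h1
      subst h3
      rfl
    · rintro ⟨z, hz⟩
      obtain ⟨a, b, rfl⟩ := h.exists_coords z
      obtain ⟨hb, ha⟩ := (key a b).1 hz
      exact ⟨(⟨b, hb⟩, ⟨a - s b, ha⟩), Subtype.ext (by simp [φ])⟩
  rw [← Nat.card_congr (Equiv.ofBijective φ hφ), Nat.card_prod]

/-- Put `u = w + h₀`, so `u ^ 2 + u = g` has a simple pole below. The reduced form `q` of `r` gets a
double pole upstairs, which `(γ * u) ^ 2` cancels when `γ ^ 2` is the ratio of leading coefficients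
of `q` and `g`. What remains is `γ * (γ + 1) * u` plus an integral element, a simple pole provided
`γ` is neither `0` nor `1` in the residue field; the latter is excluded because `r + f` is also
outside `R`. -/
lemma exists_simple_pole_step (hl : IsLevel S R D v n)
    (h : IsArtinSchreier F L w (algebraMap K F f))
    (hv : v (algebraMap K F f + h₀ ^ 2 + h₀) = exp 1) {r : K} (hr : r ∈ S) (hrR : r ∉ R)
    (hfS : f ∈ S) (hrf : r + f ∉ R) :
    ∃ e, (h.translate h₀).ramified v one_pos odd_one hv (algebraMap K L r + e ^ 2 + e) =
      exp 1 := by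
  have h2 := h.two_eq_zero
  have h2' := h.two_eq_zero_right
  obtain ⟨h₁, hh₁⟩ := hl.exists_simple_pole r hr hrR
  obtain ⟨h₂, hh₂⟩ := hl.exists_simple_pole (r + f) (S.add_mem hr hfS) hrf
  have hu := h.translate h₀
  set g := algebraMap K F f + h₀ ^ 2 + h₀ with hg
  set q := algebraMap K F r + h₁ ^ 2 + h₁ with hq
  set t := algebraMap K F (r + f) + h₂ ^ 2 + h₂ with ht
  have hg0 : g ≠ 0 := v.ne_zero_of_eq_exp hv
  have e1 : (h₀ + h₁ + h₂) ^ 2 + (h₀ + h₁ + h₂) = q + g - t := by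
    rw [hg, hq, ht, map_add]
    linear_combination (h₀ * h₁ + h₀ * h₂ + h₁ * h₂ + h₂ ^ 2 + h₂) * h2
  -- The pole order of `q + g - t` is at most one, but for an element of the form `e ^ 2 + e` it is
  -- even, hence zero. So `q + g` keeps the simple pole of `t`.
  have h3 : v ((h₀ + h₁ + h₂) ^ 2 + (h₀ + h₁ + h₂)) ≤ 1 := by
    apply v.sq_add_self_le_one
    apply v.le_one_of_sq_add_self_le
    rw [e1]
    exact v.map_sub_le (v.map_add_le hh₁.le hv.le) hh₂.le
  have h4 : v (q + g) = exp 1 := by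
    have : q + g = t + ((h₀ + h₁ + h₂) ^ 2 + (h₀ + h₁ + h₂)) := by rw [e1]; ring
    rw [this, ← hh₂]
    apply Valuation.map_add_eq_of_lt_left
    refine h3.trans_lt ?_
    rw [hh₂, ← exp_zero, exp_lt_exp]; norm_num
  have hqg : v (q / g) = 1 := by rw [map_div₀, hh₁, hv]; exact div_self exp_ne_zero
  have hqg1 : v (q / g + 1) = 1 := by
    have : q / g + 1 = (q + g) / g := by field_simp
    rw [this, map_div₀, h4, hv]; exact div_self exp_ne_zero
  obtain ⟨γ, hγ, hγq⟩ := hl.perfect (q / g) hqg.le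
  have hγ1 : v γ = 1 := by
    have : v (γ ^ 2) = 1 := by
      have e : γ ^ 2 = q / g + (γ ^ 2 - q / g) := by ring
      rw [e, ← hqg]
      apply Valuation.map_add_eq_of_lt_left
      rwa [hqg]
    rw [map_pow] at this
    exact (pow_eq_one_iff_of_nonneg zero_le two_ne_zero).1 this
  have hγ2 : v (γ + 1) = 1 := by
    have : v ((γ + 1) ^ 2) = 1 := by
      have e : (γ + 1) ^ 2 = (q / g + 1) + (γ ^ 2 - q / g) := by linear_combination γ * h2
      rw [e, ← hqg1]
      apply Valuation.map_add_eq_of_lt_left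
      rwa [hqg1]
    rw [map_pow] at this
    exact (pow_eq_one_iff_of_nonneg zero_le two_ne_zero).1 this
  refine ⟨algebraMap F L h₁ + algebraMap F L γ * (w + algebraMap F L h₀), ?_⟩
  have e5 : algebraMap K L r +
      (algebraMap F L h₁ + algebraMap F L γ * (w + algebraMap F L h₀)) ^ 2 +
      (algebraMap F L h₁ + algebraMap F L γ * (w + algebraMap F L h₀)) =
      algebraMap F L (q + γ ^ 2 * g) +
        algebraMap F L (γ * (γ + 1)) * (w + algebraMap F L h₀) := by
    rw [IsScalarTower.algebraMap_apply K F L r]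
    have := hu.eq
    simp only [map_add, map_mul, map_pow, map_one, hq] at this ⊢
    linear_combination (algebraMap F L γ) ^ 2 * this +
      (algebraMap F L h₁ * (algebraMap F L γ * (w + algebraMap F L h₀)) -
        (algebraMap F L γ) ^ 2 * (w + algebraMap F L h₀)) * h2'
  rw [e5, hu.ramified_coords one_pos odd_one hv, map_mul, hγ1, hγ2]
  have h6 : v (q + γ ^ 2 * g) ≤ exp 0 := by
    have e : q + γ ^ 2 * g = g * (γ ^ 2 - q / g) + 2 * q := by field_simp; ring
    rw [e, h2, zero_mul, add_zero, map_mul, hv]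
    calc exp 1 * v (γ ^ 2 - q / g) ≤ exp 1 * exp (-1) :=
          mul_le_mul_right (lt_one_iff_le_exp.1 hγq) _
      _ = exp 0 := by rw [← exp_add]; norm_num
  have h7 : v (q + γ ^ 2 * g) ^ 2 ≤ exp 1 := (sq_le_exp_iff 0 (by omega)).2 h6
  simp [h7]

/-- One step up in the tower. -/
theorem step (hl : IsLevel S R D v n) (h : IsArtinSchreier F L w (algebraMap K F f))
    (hD : ∀ a, D' (algebraMap F L a) = algebraMap F L (D a)) (hfS : f ∈ S) (hfR : f ∉ R)
    {R' : Submodule (ZMod 2) K} (hRR' : R ≤ R') (hfR' : f ∈ R') :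
    ∃ v' : Valuation L ℤᵐ⁰, IsLevel S R' D' v' (n + 1) := by
  obtain ⟨h₀, hv⟩ := hl.exists_simple_pole f hfS hfR
  obtain ⟨π, hπ, hDπ⟩ := hl.exists_uniformizer
  have hu := h.translate h₀
  have hgD := hl.derivation_simple_pole hv
  have hDu := hu.derivation_gen D D' hD
  have below : ∀ V : ValuationSubring L, V ≠ ⊤ →
      V ≠ (hu.ramified v one_pos odd_one hv).valuationSubring →
      V.comap (algebraMap F L) ≠ ⊤ ∧ V.comap (algebraMap F L) ≠ v.valuationSubring :=
    fun V h1 h2 => ⟨h.comap_ne_top h1, fun hc =>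
      h2 (hu.eq_ramified one_pos odd_one hv hc ⟨π, hπ⟩)⟩
  refine ⟨hu.ramified v one_pos odd_one hv, ?_, ?_, ?_, ?_, ?_, ?_, ?_, ?_, ?_, ?_, ?_, ?_⟩
  · intro z hz
    obtain ⟨a, b, rfl⟩ := hu.exists_coords z
    rw [hu.ramified_coords one_pos odd_one hv, max_le_iff, ← exp_zero,
      sq_le_exp_iff 0 (by omega), sq_mul_exp_le_exp_iff (-1) (by omega)] at hz
    have hb1 : v b ≤ 1 := hz.2.trans (by rw [← exp_zero, exp_le_exp]; omega)
    rw [map_add, Derivation.leibniz, hD, hD, hDu, smul_eq_mul, smul_eq_mul, diffExp_succ]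
    have ha := hl.derivation_le a (by simpa using hz.1)
    have hb := hl.derivation_le b hb1
    refine Valuation.map_add_le _ ?_ (Valuation.map_add_le _ ?_ ?_)
    · rw [hu.ramified_algebraMap one_pos odd_one hv]
      exact (pow_le_pow_left₀ zero_le ha 2).trans (by rw [exp_sq, exp_le_exp]; omega)
    · rw [map_mul, hu.ramified_algebraMap one_pos odd_one hv,
        hu.ramified_algebraMap one_pos odd_one hv, hgD, exp_sq]
      rw [sq_mul_exp_le_exp_iff (-1) (by left; ring)]
      exact hz.2
    · rw [map_mul, hu.ramified_gen one_pos odd_one hv,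
        hu.ramified_algebraMap one_pos odd_one hv, mul_comm,
        sq_mul_exp_le_exp_iff (diffExp n) (by omega)]
      exact hb
  -- Upstairs `π` has a zero of order 2 and `w + h₀` a pole of order 1. In the derivative of the
  -- product the term with `D g` dominates.
  · refine ⟨algebraMap F L π * (w + algebraMap F L h₀), ?_, ?_⟩
    · rw [map_mul, hu.ramified_gen one_pos odd_one hv,
        hu.ramified_algebraMap one_pos odd_one hv, hπ, exp_sq, ← exp_add]; norm_num
    · rw [Derivation.leibniz, hD, hDu, smul_eq_mul, smul_eq_mul]
      have h1 : hu.ramified v one_pos odd_one hv (algebraMap F L π *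
          algebraMap F L (D (algebraMap K F f + h₀ ^ 2 + h₀))) = exp (diffExp (n + 1)) := by
        rw [map_mul, hu.ramified_algebraMap one_pos odd_one hv,
          hu.ramified_algebraMap one_pos odd_one hv, hgD, hπ, exp_sq, exp_sq, ← exp_add,
          diffExp_succ]
        congr 1; ring
      rw [← h1]
      apply Valuation.map_add_eq_of_lt_left
      rw [h1, map_mul, hu.ramified_gen one_pos odd_one hv,
        hu.ramified_algebraMap one_pos odd_one hv, hDπ, exp_sq, ← exp_add, exp_lt_exp,
        diffExp_succ]
      omega
  -- The residue field does not grow: in an integral `a + b * (w + h₀)` the second term lies in the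
  -- maximal ideal.
  · intro c hc
    obtain ⟨a, b, rfl⟩ := hu.exists_coords c
    rw [hu.ramified_coords one_pos odd_one hv, max_le_iff, ← exp_zero,
      sq_le_exp_iff 0 (by omega), sq_mul_exp_le_exp_iff (-1) (by omega)] at hc
    obtain ⟨γ, hγ, hγa⟩ := hl.perfect a (by simpa using hc.1)
    refine ⟨algebraMap F L γ, ?_, ?_⟩
    · rw [hu.ramified_algebraMap one_pos odd_one hv]; exact pow_le_one₀ zero_le hγ
    · have e : algebraMap F L γ ^ 2 - (algebraMap F L a + algebraMap F L b *
          (w + algebraMap F L h₀)) =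
          algebraMap F L (γ ^ 2 - a) + algebraMap F L (-b) * (w + algebraMap F L h₀) := by
        simp only [map_sub, map_neg, map_pow]; ring
      rw [e, hu.ramified_coords one_pos odd_one hv, Valuation.map_neg, lt_one_iff_le_exp,
        max_le_iff, sq_le_exp_iff (-1) (by omega), sq_mul_exp_le_exp_iff (-1) (by omega)]
      exact ⟨lt_one_iff_le_exp.1 hγa, hc.2⟩
  · intro r hr hrR'
    exact hl.exists_simple_pole_step h hv hr (fun hc => hrR' (hRR' hc)) hfS (fun hc => hrR' (by
      have := R'.sub_mem (hRR' hc) hfR'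
      rwa [add_sub_cancel_right] at this))
  · intro V h1 h2 z hz
    obtain ⟨h3, h4⟩ := below V h1 h2
    exact h.derivation_mem D D' hD V (hl.derivation_mem _ h3 h4)
      (hl.regular f hfS _ h3 h4) hz
  · intro V h1 h2
    obtain ⟨h3, h4⟩ := below V h1 h2
    obtain ⟨b, hb, hb0, hbi⟩ := hl.exists_derivation_unit _ h3 h4
    refine ⟨algebraMap F L b, hb, ?_, ?_⟩
    · rw [hD]; simpa using hb0
    · rw [hD, ← map_inv₀]; exact hbi
  · intro r hr V h1 h2
    obtain ⟨h3, h4⟩ := below V h1 h2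
    rw [IsScalarTower.algebraMap_apply K F L]
    exact hl.regular r hr _ h3 h4
  -- The exponents add: `(7 * 2 ^ n - 6) + 7 * 2 ^ n`.
  · rw [hl.card_poleSpace_step hfS h hv (m := diffExp n) (by rw [diffExp_succ]; omega)
      (by rw [diffExp_succ]; omega), hl.card_low, hl.card_high, ← pow_add]
    congr 1
    have : 1 ≤ 2 ^ n := Nat.one_le_two_pow
    rw [pow_succ]; omega
  · rw [hl.card_poleSpace_step hfS h hv (m := diffExp n + 1) (by rw [diffExp_succ]; omega)
      (by rw [diffExp_succ]; omega), hl.card_high, ← pow_add]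
    congr 1
    rw [pow_succ]; ring
  · intro z
    obtain ⟨a, b, rfl⟩ := h.exists_coords z
    -- First `b` is approximated by `s`, then `a` corrected by the error `(b - s) * h₀` that this
    -- leaves at the ramified place.
    obtain ⟨s, hs, hsv⟩ := hl.approx b
    obtain ⟨r, hr, hrv⟩ := hl.approx (a - (b - s) * h₀)
    refine ⟨algebraMap F L r + algebraMap F L s * w,
      (hl.mem_regularAway_step hfS h hv r s).2 ⟨hr, hs⟩, ?_⟩
    have e : algebraMap F L a + algebraMap F L b * w - (algebraMap F L r + algebraMap F L s * w) =
        algebraMap F L (a - r) + algebraMap F L (b - s) * w := by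
      simp only [map_sub]; ring
    rw [e, ramified_step h hv, max_le_iff, diffExp_succ, sq_le_exp_iff (diffExp n + 1) (by omega),
      sq_mul_exp_le_exp_iff (diffExp n + 1) (by omega)]
    refine ⟨?_, hsv⟩
    rwa [show a - r - (b - s) * h₀ = a - (b - s) * h₀ - r by ring]
  · rw [h.card_ratPlaces fun V hV => hl.vanish V hV f hfS, hl.card_ratPlaces, pow_succ]; ring
  · intro V hV r hr
    rw [IsScalarTower.algebraMap_apply K F L, ← ValuationSubring.valuation_comap_lt_one_iff]
    exact hl.vanish _ (h.comap_mem_ratPlaces hV) r hr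

end Step

end IsLevel

/-! ### Arithmetic modulo `X⁷ + X + 1` -/

section Polynomials

lemma Polynomial.two_eq_zero_zmod : (2 : (ZMod 2)[X]) = 0 := CharTwo.two_eq_zero

/-- The polynomial `X ^ 7 + X + 1`, whose zeros are the `x`-coordinates of the ramified points. -/
noncomputable def ramPoly : (ZMod 2)[X] := X ^ 7 + X + 1

/-- The `y`-coordinate of the ramified place, modulo `ramPoly`. -/
noncomputable def ramRoot : (ZMod 2)[X] := X ^ 6 + X ^ 5 + X ^ 2 + X

/-- The `y`-coordinate of the ramified place, modulo `ramPoly ^ 2`. -/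
noncomputable def ramRootSq : (ZMod 2)[X] := X ^ 12 + X ^ 10 + X ^ 4 + X ^ 3 + X ^ 2 + X

lemma ramPoly_monic : ramPoly.Monic := by unfold ramPoly; monicity!

lemma natDegree_ramPoly : ramPoly.natDegree = 7 := by unfold ramPoly; compute_degree!

lemma ramPoly_ne_zero : ramPoly ≠ 0 := ramPoly_monic.ne_zero

lemma ramRoot_eq : X ^ 3 + X + ramRoot ^ 2 + ramRoot = ramPoly * (X ^ 5 + X ^ 3) := by
  unfold ramRoot ramPoly
  linear_combination (X ^ 11 + X ^ 8 + 2 * X ^ 7 + X ^ 6 + X ^ 3 + X ^ 2 + X : (ZMod 2)[X]) *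
    two_eq_zero_zmod

/-- `ramRootSq` is `ramRoot ^ 2 + X ^ 3 + X`, one Newton step from `ramRoot`. The second-order
precision is needed for the double pole of `f₃`. -/
lemma ramRootSq_eq :
    X ^ 3 + X + ramRootSq ^ 2 + ramRootSq = ramPoly ^ 2 * (X ^ 10 + X ^ 6) := by
  unfold ramRootSq ramPoly
  linear_combination (X ^ 22 - X ^ 18 - X ^ 17 + X ^ 16 + X ^ 15 + X ^ 14 + X ^ 13 + X ^ 12 +
    X ^ 6 + 2 * X ^ 5 + 2 * X ^ 4 + 2 * X ^ 3 + X ^ 2 + X : (ZMod 2)[X]) * two_eq_zero_zmod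

lemma ramRootSq_sub_ramRoot : ramRootSq - ramRoot = ramPoly * (X ^ 5 + X ^ 3) := by
  unfold ramRootSq ramRoot ramPoly
  linear_combination (-X ^ 6 - X ^ 5 : (ZMod 2)[X]) * two_eq_zero_zmod

/-- A proper factor would give an irreducible one of degree `d ≤ 3`, which divides `X ^ 2 ^ d - X`;
explicit Bézout identities show these to be coprime to `ramPoly`. -/
lemma ramPoly_irreducible : Irreducible ramPoly := by
  have hp1 : ramPoly ≠ 1 := by
    intro h
    have := natDegree_ramPoly
    rw [h, natDegree_one] at this
    omega
  rw [ramPoly_monic.irreducible_iff_lt_natDegree_lt hp1]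
  intro q hq hdeg hdvd
  rw [natDegree_ramPoly, Finset.mem_Ioc] at hdeg
  obtain ⟨r, hr, hrq⟩ := WfDvdMonoid.exists_irreducible_factor
    (show ¬ IsUnit q from fun hu => by
      rw [hq.isUnit_iff.1 hu, natDegree_one] at hdeg; omega) hq.ne_zero
  have hrp := hrq.trans hdvd
  have hd1 : r.natDegree ≤ 3 := (natDegree_le_of_dvd hrq hq.ne_zero).trans (by omega)
  have hd0 : 0 < r.natDegree := hr.natDegree_pos
  have hX := (hr.natDegree_dvd_iff_dvd_X_pow_card_pow_sub_X).1 (dvd_refl r.natDegree)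
  rw [Nat.card_zmod] at hX
  have key : ∀ u v : (ZMod 2)[X], u * ramPoly + v * (X ^ 2 ^ r.natDegree - X) = 1 → False :=
    fun u v huv => hr.not_isUnit (isUnit_of_dvd_one (huv ▸
      dvd_add (hrp.mul_left u) (hX.mul_left v)))
  unfold ramPoly at key
  interval_cases r.natDegree
  · refine key 1 (X ^ 5 + X ^ 4 + X ^ 3 + X ^ 2 + X + 1) ?_
    linear_combination (X ^ 7 : (ZMod 2)[X]) * two_eq_zero_zmod
  · refine key 1 (X ^ 3 + 1) ?_
    linear_combination (X ^ 7 : (ZMod 2)[X]) * two_eq_zero_zmod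
  · refine key (X ^ 7 + X ^ 6 + 1) (X ^ 6 + X ^ 5 + 1) ?_
    linear_combination (X ^ 14 + X ^ 13 + X ^ 8 + X ^ 7 : (ZMod 2)[X]) * two_eq_zero_zmod

/-- Every polynomial is a square modulo `ramPoly`. -/
lemma exists_sq_sub_dvd (b : (ZMod 2)[X]) : ∃ γ : (ZMod 2)[X], ramPoly ∣ γ ^ 2 - b := by
  induction b using Polynomial.induction_on' with
  | add b c hb hc =>
    obtain ⟨γ, hγ⟩ := hb
    obtain ⟨δ, hδ⟩ := hc
    refine ⟨γ + δ, ?_⟩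
    have : (γ + δ) ^ 2 - (b + c) = (γ ^ 2 - b) + (δ ^ 2 - c) := by
      linear_combination γ * δ * two_eq_zero_zmod
    rw [this]; exact dvd_add hγ hδ
  | monomial n c =>
    induction n with
    | zero =>
      refine ⟨C c, ?_⟩
      have : c ^ 2 = c := by revert c; decide
      rw [← C_pow, this, monomial_zero_left, sub_self]
      exact dvd_zero _
    | succ n ih =>
      obtain ⟨γ, hγ⟩ := ih
      -- `X ^ 4 + X` is a square root of `X` modulo `ramPoly`, as `X ^ 8 + X ^ 2 + X = X * ramPoly`.
      refine ⟨γ * (X ^ 4 + X), ?_⟩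
      have : (γ * (X ^ 4 + X)) ^ 2 - monomial (n + 1) c =
          (γ ^ 2 - monomial n c) * X + ramPoly * (γ ^ 2 * X) := by
        rw [← monomial_mul_X]
        unfold ramPoly
        linear_combination (γ ^ 2 * X ^ 5 - γ ^ 2 * X) * two_eq_zero_zmod
      rw [this]
      exact dvd_add (hγ.mul_right X) (dvd_mul_right _ _)

end Polynomials

/-! ### Places of the projective line over `𝔽₂` -/

section RatFuncPlaces

/-- The function field of the projective line over `𝔽₂`. -/
abbrev RF : Type := RatFunc (ZMod 2)

/-- The valuation at infinity of `𝔽₂(x)`. -/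
noncomputable def infVal : Valuation RF ℤᵐ⁰ := by
  classical exact RatFunc.inftyValuation (ZMod 2)

/-- The height one prime of an irreducible polynomial. -/
noncomputable def irrPrime {q : (ZMod 2)[X]} (hq : Irreducible q) :
    IsDedekindDomain.HeightOneSpectrum (ZMod 2)[X] where
  asIdeal := Ideal.span {q}
  isPrime := (Ideal.span_singleton_prime hq.ne_zero).2 hq.prime
  ne_bot := by simpa using hq.ne_zero

/-- The valuation of `𝔽₂(x)` at an irreducible polynomial. -/
noncomputable def irrVal {q : (ZMod 2)[X]} (hq : Irreducible q) : Valuation RF ℤᵐ⁰ :=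
  (irrPrime hq).valuation RF

variable {q : (ZMod 2)[X]} (hq : Irreducible q)

lemma irrVal_self : irrVal hq (algebraMap _ RF q) = exp (-1) := by
  unfold irrVal
  rw [IsDedekindDomain.HeightOneSpectrum.valuation_of_algebraMap]
  exact (irrPrime hq).intValuation_singleton hq.ne_zero rfl

lemma irrVal_le_one (a : (ZMod 2)[X]) : irrVal hq (algebraMap _ RF a) ≤ 1 :=
  (irrPrime hq).valuation_le_one a

lemma irrVal_lt_one_iff (a : (ZMod 2)[X]) : irrVal hq (algebraMap _ RF a) < 1 ↔ q ∣ a := by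
  unfold irrVal
  rw [IsDedekindDomain.HeightOneSpectrum.valuation_lt_one_iff_mem]
  exact Ideal.mem_span_singleton

lemma irrVal_eq_one_iff (a : (ZMod 2)[X]) : irrVal hq (algebraMap _ RF a) = 1 ↔ ¬ q ∣ a := by
  rw [← irrVal_lt_one_iff hq, not_lt]
  exact ⟨fun h => h.ge, fun h => le_antisymm (irrVal_le_one hq a) h⟩

lemma irrVal_ne_top : (irrVal hq).valuationSubring ≠ ⊤ := by
  intro ht
  have : (algebraMap _ RF q)⁻¹ ∈ (irrVal hq).valuationSubring := ht ▸ ValuationSubring.mem_top _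
  rw [Valuation.mem_valuationSubring_iff, map_inv₀, irrVal_self, ← exp_neg, ← exp_zero,
    exp_le_exp] at this
  omega

lemma ValuationSubring.algebraMap_polynomial_mem {V : ValuationSubring RF}
    (hX : algebraMap (ZMod 2)[X] RF X ∈ V) (a : (ZMod 2)[X]) : algebraMap _ RF a ∈ V := by
  induction a using Polynomial.induction_on' with
  | add a b ha hb => rw [map_add]; exact V.add_mem _ _ ha hb
  | monomial n c =>
    rw [← C_mul_X_pow_eq_monomial, map_mul, map_pow]
    refine V.mul_mem _ _ ?_ (pow_mem hX n)
    have : c = 0 ∨ c = 1 := by revert c; decide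
    rcases this with rfl | rfl
    · simp [V.zero_mem]
    · simp [V.one_mem]

/-- A finite place of `𝔽₂(x)` consists of fractions whose denominators are units. -/
lemma ValuationSubring.exists_eq_div {V : ValuationSubring RF}
    (hX : algebraMap (ZMod 2)[X] RF X ∈ V) {z : RF} (hz : z ∈ V) :
    ∃ a b : (ZMod 2)[X], V.valuation (algebraMap _ RF b) = 1 ∧
      z = algebraMap _ RF a / algebraMap _ RF b := by
  refine ⟨z.num, z.denom, ?_, (RatFunc.num_div_denom z).symm⟩
  have hd0 : algebraMap (ZMod 2)[X] RF z.denom ≠ 0 := by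
    simpa using RatFunc.denom_ne_zero z
  refine le_antisymm ((V.valuation_le_one_iff _).2 (algebraMap_polynomial_mem hX _)) ?_
  by_contra hlt
  rw [not_le] at hlt
  -- A denominator in the maximal ideal would put the numerator there too, against coprimality.
  have hnum : V.valuation (algebraMap _ RF z.num) < 1 := by
    have e : algebraMap (ZMod 2)[X] RF z.num = z * algebraMap _ RF z.denom :=
      (div_eq_iff hd0).1 (RatFunc.num_div_denom z)
    rw [e, map_mul]
    exact mul_lt_one_of_nonneg_of_lt_one_right ((V.valuation_le_one_iff _).2 hz) zero_le hlt
  obtain ⟨u, t, hut⟩ := RatFunc.isCoprime_num_denom z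
  have h1 : V.valuation (algebraMap (ZMod 2)[X] RF (u * z.num + t * z.denom)) < 1 := by
    rw [map_add, map_mul, map_mul]
    refine V.valuation.map_add_lt ?_ ?_ <;> rw [map_mul] <;>
      refine mul_lt_one_of_nonneg_of_lt_one_right
        ((V.valuation_le_one_iff _).2 (algebraMap_polynomial_mem hX _)) zero_le ?_ <;>
      assumption
  rw [hut, map_one, map_one] at h1
  exact lt_irrefl _ h1

/-- The finite place at which an irreducible polynomial vanishes. -/
lemma ValuationSubring.eq_irrVal {V : ValuationSubring RF}
    (hX : algebraMap (ZMod 2)[X] RF X ∈ V) (hV : V.valuation (algebraMap _ RF q) < 1) :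
    V = (irrVal hq).valuationSubring := by
  symm
  refine Valuation.valuationSubring_eq_of_le_of_ne_top (fun z hz => ?_) ?_
  · obtain ⟨n, ⟨d, hd⟩, hnd⟩ :=
      (irrPrime hq).exists_primeCompl_mul_eq_of_integer z hz
    have hqd : ¬ q ∣ d := fun h => hd (Ideal.mem_span_singleton.2 h)
    obtain ⟨u, t, hut⟩ := (hq.coprime_iff_not_dvd.2 hqd)
    -- Bézout: `d` is prime to `q`, and `q` is in the maximal ideal of `V`.
    have hd1 : V.valuation (algebraMap (ZMod 2)[X] RF d) = 1 := by
      refine le_antisymm ((V.valuation_le_one_iff _).2 (algebraMap_polynomial_mem hX _)) ?_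
      by_contra hlt
      rw [not_le] at hlt
      have h1 : V.valuation (algebraMap (ZMod 2)[X] RF (u * q + t * d)) < 1 := by
        rw [map_add, map_mul, map_mul]
        refine V.valuation.map_add_lt ?_ ?_ <;> rw [map_mul] <;>
          refine mul_lt_one_of_nonneg_of_lt_one_right
            ((V.valuation_le_one_iff _).2 (algebraMap_polynomial_mem hX _)) zero_le ?_ <;>
          assumption
      rw [hut, map_one, map_one] at h1
      exact lt_irrefl _ h1
    have h2 : V.valuation z * 1 ≤ 1 := by
      have h3 := congrArg V.valuation hnd
      rw [map_mul] at h3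
      change _ * V.valuation (algebraMap (ZMod 2)[X] RF d) = _ at h3
      rw [hd1] at h3
      rw [h3]
      exact (V.valuation_le_one_iff _).2 (algebraMap_polynomial_mem hX _)
    rwa [mul_one, V.valuation_le_one_iff] at h2
  · rintro rfl
    rw [← ValuationSubring.mem_nonunits_iff, ValuationSubring.mem_nonunits_iff_or] at hV
    rcases hV with h0 | h0
    · exact hq.ne_zero (by simpa using h0)
    · exact h0 (ValuationSubring.mem_top _)

instance ValuationSubring.isTrivialOn_zmod (F : Type*) [Field F] [Algebra (ZMod 2) F]
    (V : ValuationSubring F) : V.valuation.IsTrivialOn (ZMod 2) where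
  eq_one c hc := by
    have : c = 1 := by revert c; decide
    rw [this, map_one, map_one]

lemma ValuationSubring.eq_infVal {V : ValuationSubring RF}
    (hX : algebraMap (ZMod 2)[X] RF X ∉ V) : V = infVal.valuationSubring := by
  classical
  have h1 : 1 < V.valuation (RatFunc.X : RF) := by
    rw [RatFunc.algebraMap_X, ← V.valuation_le_one_iff] at hX; exact not_le.1 hX
  have h2 := RatFunc.valuation_isEquiv_inftyValuation_of_one_lt_valuation_X h1
  have h3 := (Valuation.isEquiv_iff_valuationSubring _ _).1 h2
  rw [ValuationSubring.valuationSubring_valuation] at h3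
  rw [h3]
  unfold infVal
  congr!

lemma infVal_polynomial {a : (ZMod 2)[X]} (ha : a ≠ 0) :
    infVal (algebraMap _ RF a) = exp (a.natDegree : ℤ) := by
  classical
  have := RatFunc.inftyValuation.polynomial (ZMod 2) ha
  rw [← this]
  unfold infVal
  rw [← RatFunc.inftyValuation_apply]

lemma infVal_polynomial_le {a : (ZMod 2)[X]} {n : ℕ} (ha : a.natDegree ≤ n) :
    infVal (algebraMap _ RF a) ≤ exp (n : ℤ) := by
  by_cases h0 : a = 0
  · simp [h0]
  · rw [infVal_polynomial h0, exp_le_exp]; exact_mod_cast ha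

lemma infVal_div_ramPoly_pow (m : ℕ) (a : (ZMod 2)[X]) {n : ℤ} (ha : a.natDegree ≤ n + 7 * m) :
    infVal (algebraMap _ RF a / algebraMap _ RF ramPoly ^ m) ≤ exp n := by
  have h1 : infVal (algebraMap _ RF ramPoly ^ m) = exp (7 * m : ℤ) := by
    rw [map_pow, infVal_polynomial ramPoly_ne_zero, natDegree_ramPoly, ← exp_nsmul]
    congr 1; simp; ring
  rw [map_div₀, h1]
  by_cases h0 : a = 0
  · simp [h0]
  · rw [infVal_polynomial h0, ← exp_sub, exp_le_exp]; omega

end RatFuncPlaces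

/-! ### Extension of a discrete valuation to an unramified place -/

namespace IsArtinSchreier

/-- A discrete valuation extends, without change of the value group, to an unramified place. -/
lemma exists_unramified {F L : Type*} [Field F] [Field L] [Algebra F L] {w : L} {f : F}
    (h : IsArtinSchreier F L w f) {v : Valuation F ℤᵐ⁰} {V : ValuationSubring L}
    (hV : V.comap (algebraMap F L) = v.valuationSubring) (hf : v f ≤ 1) :
    ∃ v' : Valuation L ℤᵐ⁰, v'.valuationSubring = V ∧ ∀ a, v' (algebraMap F L a) = v a := by
  have key : ∀ a : F, algebraMap F L a ∈ V ↔ v a ≤ 1 := fun a => by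
    rw [← ValuationSubring.mem_comap, hV, Valuation.mem_valuationSubring_iff]
  have cmp : ∀ a b : F, V.valuation (algebraMap F L a) ≤ V.valuation (algebraMap F L b) ↔
      v a ≤ v b := by
    intro a b
    by_cases hb : b = 0
    · simp [hb]
    have h1 : 0 < V.valuation (algebraMap F L b) := by simpa [zero_lt_iff] using hb
    have h2 : 0 < v b := by simpa [zero_lt_iff] using hb
    rw [← div_le_one₀ h1, ← div_le_one₀ h2, ← map_div₀, ← map_div₀, ← map_div₀,
      V.valuation_le_one_iff, key]
  -- Every `z` has the value of some `s z` in `F`, so `v (s z)` extends `v`; by `cmp` it is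
  -- independent of the choice.
  have ex : ∀ z : L, ∃ s : F, V.valuation (algebraMap F L s) = V.valuation z := by
    intro z
    obtain ⟨s, α, β, -, -, ht, hz⟩ := h.exists_eq_mul_unit V ((key f).2 hf) z
    refine ⟨s, ?_⟩
    rcases hz with rfl | rfl
    · rw [map_mul, ht, mul_one]
    · rw [map_mul, map_inv₀, ht, inv_one, mul_one]
  choose s hs using ex
  have cong : ∀ a b : F, V.valuation (algebraMap F L a) = V.valuation (algebraMap F L b) →
      v a = v b := fun a b hab => le_antisymm ((cmp a b).1 hab.le) ((cmp b a).1 hab.ge)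
  refine ⟨⟨⟨⟨fun z => v (s z), ?_⟩, ?_, ?_⟩, ?_⟩, ?_, ?_⟩
  · rw [← map_zero v]; apply cong; rw [hs, map_zero, map_zero, map_zero]
  · rw [← map_one v]; apply cong; rw [hs, map_one, map_one, map_one]
  · intro z z'
    change v (s (z * z')) = v (s z) * v (s z')
    rw [← map_mul]; apply cong; rw [hs, map_mul, map_mul, map_mul, hs, hs]
  · intro z z'
    change v (s (z + z')) ≤ max (v (s z)) (v (s z'))
    rw [le_max_iff, ← cmp, ← cmp, hs, hs, hs, ← le_max_iff]
    exact V.valuation.map_add z z'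
  · ext z
    rw [Valuation.mem_valuationSubring_iff]
    change v (s z) ≤ 1 ↔ _
    rw [← key, ← V.valuation_le_one_iff, hs, V.valuation_le_one_iff]
  · intro a
    exact cong _ _ (hs _)

end IsArtinSchreier

/-- The valuation of `K = 𝔽₂(x)(y)` at the zero of `ramPoly` and `y + ramRoot`. -/
structure IsRamVal {K : Type*} [Field K] [Algebra (ZMod 2)[X] K] [Algebra RF K] (y : K)
    (v : Valuation K ℤᵐ⁰) : Prop where
  map : ∀ a : RF, v (algebraMap RF K a) = irrVal ramPoly_irreducible a
  root : v (y + algebraMap _ K ramRoot) < 1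

/-! ### The ramified place and the place at infinity on `E` -/

section Base

set_option linter.unusedSectionVars false

variable {K : Type*} [Field K] [Algebra (ZMod 2)[X] K] [Algebra RF K]
  [IsScalarTower (ZMod 2)[X] RF K] {y : K} {v : Valuation K ℤᵐ⁰}

lemma algebraMap_poly_eq (a : (ZMod 2)[X]) :
    algebraMap RF K (algebraMap _ RF a) = algebraMap _ K a :=
  (IsScalarTower.algebraMap_apply _ RF K a).symm

lemma algebraMap_poly_ne_zero {a : (ZMod 2)[X]} (ha : a ≠ 0) : algebraMap (ZMod 2)[X] K a ≠ 0 := by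
  rw [← algebraMap_poly_eq]; simpa using ha

namespace ValuationSubring

variable {V : ValuationSubring K}

lemma poly_mem (hx : algebraMap _ K (X : (ZMod 2)[X]) ∈ V) (a : (ZMod 2)[X]) :
    algebraMap _ K a ∈ V := by
  rw [← algebraMap_poly_eq] at hx ⊢
  exact ValuationSubring.algebraMap_polynomial_mem (V := V.comap (algebraMap RF K)) hx a

lemma poly_le_one (hx : algebraMap _ K (X : (ZMod 2)[X]) ∈ V) (a : (ZMod 2)[X]) :
    V.valuation (algebraMap _ K a) ≤ 1 := (V.valuation_le_one_iff _).2 (poly_mem hx a)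

lemma poly_lt_one_of_dvd (hx : algebraMap _ K (X : (ZMod 2)[X]) ∈ V) {q a : (ZMod 2)[X]}
    (hq : V.valuation (algebraMap _ K q) < 1) (hqa : q ∣ a) :
    V.valuation (algebraMap _ K a) < 1 := by
  obtain ⟨b, rfl⟩ := hqa
  rw [map_mul, map_mul, mul_comm]
  exact mul_lt_one_of_nonneg_of_lt_one_right (poly_le_one hx b) zero_le hq

end ValuationSubring

namespace IsArtinSchreier

variable (h : IsArtinSchreier RF K y (algebraMap (ZMod 2)[X] RF (X ^ 3 + X)))
include h

lemma sq_add_poly (B : (ZMod 2)[X]) : (y + algebraMap _ K B) * (y + algebraMap _ K B + 1) =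
    algebraMap _ K (X ^ 3 + X + B ^ 2 + B) := by
  have := (h.translate (algebraMap _ RF B)).eq
  rw [← map_pow, ← map_add, ← map_add, algebraMap_poly_eq, algebraMap_poly_eq] at this
  rw [← this]; ring

lemma y_mem {V : ValuationSubring K} (hx : algebraMap _ K (X : (ZMod 2)[X]) ∈ V) : y ∈ V := by
  apply V.mem_of_sq_add_mem
  rw [h.eq, algebraMap_poly_eq]
  exact ValuationSubring.poly_mem hx _

lemma eq_of_root {V V' : ValuationSubring K} (hx : algebraMap _ K (X : (ZMod 2)[X]) ∈ V)
    (hx' : algebraMap _ K (X : (ZMod 2)[X]) ∈ V')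
    {q B : (ZMod 2)[X]} (hq : Irreducible q) (h1 : V.valuation (algebraMap _ K q) < 1)
    (h1' : V'.valuation (algebraMap _ K q) < 1)
    (h2 : V.valuation (y + algebraMap _ K B) < 1)
    (h2' : V'.valuation (y + algebraMap _ K B) < 1) : V = V' := by
  have aux : ∀ U : ValuationSubring K, algebraMap _ K (X : (ZMod 2)[X]) ∈ U →
      U.valuation (algebraMap _ K q) < 1 →
      U.comap (algebraMap RF K) = (irrVal hq).valuationSubring := by
    intro U hU hUq
    apply ValuationSubring.eq_irrVal hq
    · rw [ValuationSubring.mem_comap, algebraMap_poly_eq]; exact hU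
    · rw [ValuationSubring.valuation_comap_lt_one_iff, algebraMap_poly_eq]; exact hUq
  refine (h.translate (algebraMap _ RF B)).eq_of_comap_eq
    ((aux V hx h1).trans (aux V' hx' h1').symm) ?_ ?_
  · rwa [algebraMap_poly_eq]
  · rwa [algebraMap_poly_eq]

lemma exists_place_of_root {q B : (ZMod 2)[X]} (hq : Irreducible q)
    (hB : q ∣ X ^ 3 + X + B ^ 2 + B) : ∃ V : ValuationSubring K,
      V.comap (algebraMap RF K) = (irrVal hq).valuationSubring ∧
      V.valuation (y + algebraMap _ K B) < 1 := by
  have hlt : (irrVal hq).valuationSubring.valuation (algebraMap (ZMod 2)[X] RF (X ^ 3 + X) +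
      (algebraMap _ RF B) ^ 2 + algebraMap _ RF B) < 1 := by
    rw [← map_pow, ← map_add, ← map_add]
    rw [← (Valuation.isEquiv_valuation_valuationSubring (irrVal hq)).lt_one_iff_lt_one]
    exact (irrVal_lt_one_iff hq _).2 hB
  obtain ⟨V, hV, hlt'⟩ := (h.translate (algebraMap _ RF B)).exists_comap_eq_and_lt_one hlt
  rw [algebraMap_poly_eq] at hlt'
  exact ⟨V, hV, hlt'⟩

lemma exists_isRamVal : ∃ v : Valuation K ℤᵐ⁰, IsRamVal y v := by
  obtain ⟨V, hV, hlt⟩ := h.exists_place_of_root ramPoly_irreducible (B := ramRoot)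
    (Dvd.intro _ ramRoot_eq.symm)
  obtain ⟨v, hv, hmap⟩ := h.exists_unramified hV (irrVal_le_one ramPoly_irreducible (X ^ 3 + X))
  refine ⟨v, hmap, ?_⟩
  rwa [(Valuation.isEquiv_valuation_valuationSubring v).lt_one_iff_lt_one, hv]

/-- The valuation at infinity. -/
noncomputable def infPlace : Valuation K ℤᵐ⁰ :=
  h.ramified (c := 3) infVal (by norm_num) (by decide) (by
    have : (X ^ 3 + X : (ZMod 2)[X]).natDegree = 3 := by compute_degree!
    rw [infVal_polynomial (fun h0 => by rw [h0] at this; simp at this), this]; rfl)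

lemma infPlace_coords (a b : RF) : h.infPlace (algebraMap RF K a + algebraMap RF K b * y) =
    max (infVal a ^ 2) (infVal b ^ 2 * exp 3) := h.ramified_coords ..

lemma eq_infPlace {V : ValuationSubring K} (hx : algebraMap _ K (X : (ZMod 2)[X]) ∉ V) :
    V = h.infPlace.valuationSubring := by
  refine h.eq_ramified _ _ _ (ValuationSubring.eq_infVal ?_)
    ⟨(algebraMap (ZMod 2)[X] RF X)⁻¹, ?_⟩
  · rwa [ValuationSubring.mem_comap, algebraMap_poly_eq]
  · rw [map_inv₀, infVal_polynomial X_ne_zero, natDegree_X, ← exp_neg]; rfl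

/-- At infinity `x` has a pole of order 2, `y` of order 3, and `ramPoly` of order 14. -/
lemma infPlace_le (m : ℕ) (a b : (ZMod 2)[X]) {n : ℤ} (ha : 2 * a.natDegree ≤ n + 14 * m)
    (hb : 2 * b.natDegree + 3 ≤ n + 14 * m) :
    h.infPlace ((algebraMap _ K a + algebraMap _ K b * y) / algebraMap _ K ramPoly ^ m) ≤
      exp n := by
  have e : (algebraMap _ K a + algebraMap _ K b * y) / algebraMap _ K ramPoly ^ m =
      algebraMap RF K (algebraMap _ RF a / algebraMap _ RF ramPoly ^ m) +
      algebraMap RF K (algebraMap _ RF b / algebraMap _ RF ramPoly ^ m) * y := by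
    simp only [map_div₀, map_pow, algebraMap_poly_eq]; ring
  rw [e, infPlace_coords, max_le_iff, sq_le_exp_iff (n / 2) (by omega),
    sq_mul_exp_le_exp_iff ((n - 3) / 2) (by omega)]
  exact ⟨infVal_div_ramPoly_pow m a (by omega), infVal_div_ramPoly_pow m b (by omega)⟩

end IsArtinSchreier

namespace IsRamVal

lemma map_poly (hv : IsRamVal y v) (a : (ZMod 2)[X]) :
    v (algebraMap _ K a) = irrVal ramPoly_irreducible (algebraMap _ RF a) := by
  rw [← algebraMap_poly_eq, hv.map]

lemma poly_le_one (hv : IsRamVal y v) (a : (ZMod 2)[X]) : v (algebraMap _ K a) ≤ 1 := by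
  rw [hv.map_poly]; exact irrVal_le_one _ a

lemma poly_lt_one_iff (hv : IsRamVal y v) (a : (ZMod 2)[X]) :
    v (algebraMap _ K a) < 1 ↔ ramPoly ∣ a := by
  rw [hv.map_poly]; exact irrVal_lt_one_iff _ a

lemma poly_eq_one (hv : IsRamVal y v) {a : (ZMod 2)[X]} (ha : a ≠ 0) (hd : a.natDegree < 7) :
    v (algebraMap _ K a) = 1 := by
  rw [hv.map_poly, irrVal_eq_one_iff]
  intro hdvd
  have := natDegree_le_of_dvd hdvd ha
  rw [natDegree_ramPoly] at this
  omega

lemma ramPoly_eq (hv : IsRamVal y v) : v (algebraMap _ K ramPoly) = exp (-1) := by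
  rw [hv.map_poly, irrVal_self]

lemma x_mem (hv : IsRamVal y v) : algebraMap _ K (X : (ZMod 2)[X]) ∈ v.valuationSubring :=
  hv.poly_le_one X

lemma comap_eq (hv : IsRamVal y v) :
    v.valuationSubring.comap (algebraMap RF K) =
      (irrVal ramPoly_irreducible).valuationSubring := by
  ext a
  rw [ValuationSubring.mem_comap, Valuation.mem_valuationSubring_iff,
    Valuation.mem_valuationSubring_iff, hv.map]

lemma root_sub_dvd (hv : IsRamVal y v) {B : (ZMod 2)[X]} (hB : ramPoly ∣ B - ramRoot) :
    v (y + algebraMap _ K B) < 1 := by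
  have e : y + algebraMap _ K B = (y + algebraMap _ K ramRoot) + algebraMap _ K (B - ramRoot) := by
    rw [map_sub]; ring
  rw [e]
  exact v.map_add_lt hv.root ((hv.poly_lt_one_iff _).2 hB)

variable (h : IsArtinSchreier RF K y (algebraMap (ZMod 2)[X] RF (X ^ 3 + X)))
include h

/-- The conjugate factor `y + B + 1` is a unit at the ramified place, so `y + B` has the full order
of the norm. -/
lemma root_le (hv : IsRamVal y v) {m : ℕ} {B e : (ZMod 2)[X]} (hB : ramPoly ∣ B - ramRoot)
    (he : X ^ 3 + X + B ^ 2 + B = ramPoly ^ m * e) :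
    v (y + algebraMap _ K B) ≤ exp (-m : ℤ) := by
  have h1 : v (y + algebraMap _ K B + 1) = 1 := by
    rw [add_comm]; exact v.map_one_add_of_lt (hv.root_sub_dvd hB)
  have h2 := congrArg v (h.sq_add_poly B)
  rw [map_mul, h1, mul_one] at h2
  rw [h2, he, map_mul, map_mul, map_pow, map_pow, hv.ramPoly_eq, ← exp_nsmul]
  calc exp (m • (-1 : ℤ)) * v (algebraMap _ K e) ≤ exp (m • (-1 : ℤ)) * 1 :=
        mul_le_mul_right (hv.poly_le_one e) _
    _ = exp (-m : ℤ) := by rw [mul_one]; simp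

/-- Where `ramPoly` vanishes away from the place of `v`, the factor `y + B` is a unit, and the norm
equation makes the conjugate factor divisible by `ramPoly ^ m`. -/
lemma root_div_mem (hv : IsRamVal y v) {V : ValuationSubring K}
    (hx : algebraMap _ K (X : (ZMod 2)[X]) ∈ V) (hV : V ≠ v.valuationSubring) {m : ℕ}
    {B e : (ZMod 2)[X]} (hB : ramPoly ∣ B - ramRoot)
    (he : X ^ 3 + X + B ^ 2 + B = ramPoly ^ m * e) :
    (y + algebraMap _ K B + 1) / algebraMap _ K ramPoly ^ m ∈ V := by
  have hy := h.y_mem hx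
  have hyB : ∀ B : (ZMod 2)[X], y + algebraMap _ K B ∈ V := fun B =>
    V.add_mem _ _ hy (V.poly_mem hx B)
  have hp0 : algebraMap _ K ramPoly ≠ 0 := algebraMap_poly_ne_zero ramPoly_ne_zero
  by_cases hp : V.valuation (algebraMap _ K ramPoly) < 1
  · have h1 : V.valuation (y + algebraMap _ K B) = 1 := by
      refine le_antisymm ((V.valuation_le_one_iff _).2 (hyB B)) ?_
      by_contra hlt
      rw [not_le] at hlt
      apply hV
      refine h.eq_of_root hx hv.x_mem ramPoly_irreducible hp ?_ hlt ?_
      · rw [← (Valuation.isEquiv_valuation_valuationSubring v).lt_one_iff_lt_one, hv.ramPoly_eq,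
          ← exp_zero, exp_lt_exp]; omega
      · rw [← (Valuation.isEquiv_valuation_valuationSubring v).lt_one_iff_lt_one]
        exact hv.root_sub_dvd hB
    have h0 : y + algebraMap _ K B ≠ 0 := by
      intro h0; rw [h0, map_zero] at h1; exact zero_ne_one h1
    have e1 : (y + algebraMap _ K B + 1) / algebraMap _ K ramPoly ^ m =
        algebraMap _ K e * (y + algebraMap _ K B)⁻¹ := by
      have := h.sq_add_poly B
      rw [he, map_mul, map_pow] at this
      field_simp
      linear_combination this
    rw [e1]
    exact V.mul_mem _ _ (V.poly_mem hx e) ((V.valuation_eq_one_iff_mem h0).1 h1).2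
  · have h1 : V.valuation (algebraMap _ K ramPoly) = 1 :=
      le_antisymm (V.poly_le_one hx _) (not_lt.1 hp)
    have h2 := ((V.valuation_eq_one_iff_mem hp0).1 h1).2
    rw [div_eq_mul_inv, ← inv_pow]
    exact V.mul_mem _ _ (V.add_mem _ _ (hyB B) V.one_mem) (pow_mem h2 m)

/-- Functions whose only pole is the ramified place. -/
lemma mem_regularAway (hv : IsRamVal y v) {m : ℕ} {B e a b c : (ZMod 2)[X]}
    (hB : ramPoly ∣ B - ramRoot) (he : X ^ 3 + X + B ^ 2 + B = ramPoly ^ m * e)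
    (hab : a = b * (B + 1) + ramPoly ^ m * c) (ha : a.natDegree ≤ 7 * m)
    (hb : b.natDegree + 2 ≤ 7 * m) :
    (algebraMap _ K a + algebraMap _ K b * y) / algebraMap _ K ramPoly ^ m ∈ regularAway v := by
  intro V hV hVv
  have hp0 : algebraMap _ K ramPoly ≠ 0 := algebraMap_poly_ne_zero ramPoly_ne_zero
  by_cases hx : algebraMap _ K (X : (ZMod 2)[X]) ∈ V
  -- Modulo `ramPoly ^ m` the numerator is `b * (y + B + 1)`, which cancels the pole at the
  -- conjugate place. At infinity the degree bounds suffice.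
  · have e1 : (algebraMap _ K a + algebraMap _ K b * y) / algebraMap _ K ramPoly ^ m =
        algebraMap _ K b * ((y + algebraMap _ K B + 1) / algebraMap _ K ramPoly ^ m) +
          algebraMap _ K c := by
      rw [hab]
      simp only [map_add, map_mul, map_pow, map_one]
      field_simp
      ring
    rw [e1]
    exact V.add_mem _ _ (V.mul_mem _ _ (V.poly_mem hx b) (hv.root_div_mem h hx hVv hB he))
      (V.poly_mem hx c)
  · rw [h.eq_infPlace hx, Valuation.mem_valuationSubring_iff, ← exp_zero]
    exact h.infPlace_le m a b (by omega) (by omega)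

/-- The residue field at the ramified place is `𝔽₂[X] / ramPoly`. -/
lemma exists_residue (hv : IsRamVal y v) {z : K} (hz : v z ≤ 1) :
    ∃ b : (ZMod 2)[X], b.natDegree < 7 ∧ v (z - algebraMap _ K b) < 1 := by
  suffices ∃ b : (ZMod 2)[X], v (z - algebraMap _ K b) < 1 by
    obtain ⟨b, hb⟩ := this
    refine ⟨b %ₘ ramPoly, ?_, ?_⟩
    · have := natDegree_modByMonic_lt b ramPoly_monic (fun h1 => by
        have := natDegree_ramPoly
        rw [h1, natDegree_one] at this; omega)
      rwa [natDegree_ramPoly] at this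
    · have e : z - algebraMap _ K (b %ₘ ramPoly) =
          (z - algebraMap _ K b) + algebraMap _ K (ramPoly * (b /ₘ ramPoly)) := by
        conv_rhs => enter [1, 2]; rw [← modByMonic_add_div b ramPoly]
        rw [map_add]; ring
      rw [e]
      exact v.map_add_lt hb ((hv.poly_lt_one_iff _).2 (dvd_mul_right _ _))
  have hbase : ∀ a : RF, v (algebraMap RF K a) ≤ 1 → ∃ b : (ZMod 2)[X],
      v (algebraMap RF K a - algebraMap _ K b) < 1 := by
    intro a ha
    rw [hv.map] at ha
    obtain ⟨b, hb⟩ := (irrPrime ramPoly_irreducible).exists_valuation_sub_lt_of_integer ha 1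
    refine ⟨b, ?_⟩
    rw [← algebraMap_poly_eq, ← map_sub, hv.map, Valuation.map_sub_swap]
    exact hb
  have hmul : ∀ z z' : K, ∀ b b' : (ZMod 2)[X], v z ≤ 1 → v (z - algebraMap _ K b) < 1 →
      v (z' - algebraMap _ K b') < 1 → v (z * z' - algebraMap _ K (b * b')) < 1 := by
    intro z z' b b' h1 h2 h3
    have e : z * z' - algebraMap _ K (b * b') =
        z * (z' - algebraMap _ K b') + algebraMap _ K b' * (z - algebraMap _ K b) := by
      rw [map_mul]; ring
    rw [e]
    refine v.map_add_lt ?_ ?_ <;> rw [map_mul]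
    · exact mul_lt_one_of_nonneg_of_lt_one_right h1 zero_le h3
    · exact mul_lt_one_of_nonneg_of_lt_one_right (hv.poly_le_one _) zero_le h2
  have hlt : ∀ z, v.valuationSubring.valuation z < 1 ↔ v z < 1 := fun z =>
    (Valuation.isEquiv_valuation_valuationSubring v).lt_one_iff_lt_one.symm
  have hone : ∀ z, v.valuationSubring.valuation z = 1 → v z = 1 := by
    intro z hz
    refine le_antisymm ?_ (not_lt.1 fun hc => ?_)
    · rw [← Valuation.mem_valuationSubring_iff, ← ValuationSubring.valuation_le_one_iff, hz]
    · exact absurd hz (ne_of_lt ((hlt z).2 hc))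
  -- `z` is an element of `𝔽₂(x)` times `t` or `t⁻¹`. As `y` reduces to `-ramRoot`, the unit `t`
  -- reduces to a polynomial, which Bézout inverts modulo `ramPoly`.
  obtain ⟨s, α, β, hα, hβ, ht, hzt⟩ := h.exists_eq_mul_unit v.valuationSubring
    (hv.comap_eq ▸ (irrVal_le_one ramPoly_irreducible (X ^ 3 + X)) :
      algebraMap (ZMod 2)[X] RF (X ^ 3 + X) ∈ v.valuationSubring.comap (algebraMap RF K)) z
  rw [Valuation.mem_valuationSubring_iff] at hα hβ
  replace ht := hone _ ht
  set t := algebraMap RF K α + algebraMap RF K β * y with ht_def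
  have ht0 : t ≠ 0 := by intro h0; rw [h0, map_zero] at ht; exact zero_ne_one ht
  obtain ⟨a, ha⟩ := hbase α hα
  obtain ⟨b, hb⟩ := hbase β hβ
  have hy : v (y - algebraMap _ K (-ramRoot)) < 1 := by
    rw [map_neg, sub_neg_eq_add]; exact hv.root
  obtain ⟨c, hc⟩ : ∃ c : (ZMod 2)[X], v (t - algebraMap _ K c) < 1 := by
    refine ⟨a + b * (-ramRoot), ?_⟩
    have e : t - algebraMap _ K (a + b * (-ramRoot)) = (algebraMap RF K α - algebraMap _ K a) +
        (algebraMap RF K β * y - algebraMap _ K (b * (-ramRoot))) := by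
      rw [ht_def, map_add]; ring
    rw [e]
    exact v.map_add_lt ha (hmul _ _ _ _ hβ hb hy)
  rcases hzt with rfl | rfl
  · rw [map_mul, ht, mul_one] at hz
    obtain ⟨d, hd⟩ := hbase s hz
    exact ⟨_, hmul _ _ _ _ hz hd hc⟩
  · rw [map_mul, map_inv₀, ht, inv_one, mul_one] at hz
    obtain ⟨d, hd⟩ := hbase s hz
    have hcdvd : ¬ ramPoly ∣ c := by
      rw [← hv.poly_lt_one_iff]
      intro hlt
      have := v.map_add_lt hc hlt
      rw [sub_add_cancel, ht] at this
      exact lt_irrefl _ this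
    obtain ⟨u, r, hur⟩ := ramPoly_irreducible.coprime_iff_not_dvd.2 hcdvd
    refine ⟨_, hmul _ _ _ r hz hd ?_⟩
    have e : t⁻¹ - algebraMap _ K r = t⁻¹ * (algebraMap _ K (u * ramPoly) -
        algebraMap _ K r * (t - algebraMap _ K c)) := by
      have := congrArg (algebraMap (ZMod 2)[X] K) hur
      simp only [map_add, map_mul, map_one] at this ⊢
      field_simp
      linear_combination -this
    rw [e, map_mul, map_inv₀, ht, inv_one, one_mul]
    refine v.map_sub_lt ?_ ?_
    · exact (hv.poly_lt_one_iff _).2 (dvd_mul_left _ _)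
    · rw [map_mul]
      exact mul_lt_one_of_nonneg_of_lt_one_right (hv.poly_le_one _) zero_le hc

lemma perfect (hv : IsRamVal y v) {c : K} (hc : v c ≤ 1) :
    ∃ γ, v γ ≤ 1 ∧ v (γ ^ 2 - c) < 1 := by
  obtain ⟨b, -, hb⟩ := hv.exists_residue h hc
  obtain ⟨γ, hγ⟩ := exists_sq_sub_dvd b
  refine ⟨algebraMap _ K γ, hv.poly_le_one γ, ?_⟩
  have e : algebraMap _ K γ ^ 2 - c = algebraMap _ K (γ ^ 2 - b) - (c - algebraMap _ K b) := by
    rw [map_sub, map_pow]; ring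
  rw [e]
  exact v.map_sub_lt ((hv.poly_lt_one_iff _).2 hγ) hb

end IsRamVal

end Base

/-! ### Rational places and derivatives on the projective line -/

section RatFuncPlaces

lemma exists_poly_of_irrVal_le_one {a : RF}
    (ha : ∀ (q : (ZMod 2)[X]) (hq : Irreducible q), irrVal hq a ≤ 1) :
    ∃ A : (ZMod 2)[X], algebraMap _ RF A = a := by
  refine IsDedekindDomain.HeightOneSpectrum.mem_integers_of_valuation_le_one _ a fun P => ?_
  obtain ⟨q, hq⟩ := IsPrincipalIdealRing.principal P.asIdeal
  have hq' : P.asIdeal = Ideal.span {q} := hq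
  have hq0 : q ≠ 0 := by
    rintro rfl
    exact P.ne_bot (by rw [hq']; simp)
  have hirr : Irreducible q :=
    ((Ideal.span_singleton_prime hq0).1 (hq' ▸ P.isPrime)).irreducible
  have : P = irrPrime hirr := IsDedekindDomain.HeightOneSpectrum.ext hq'
  rw [this]
  exact ha q hirr

/-- The place of `𝔽₂(x)` at a rational point of the affine line. -/
noncomputable def pointPlace (c : ZMod 2) : ValuationSubring RF :=
  (irrVal (irreducible_X_sub_C c)).valuationSubring

lemma pointPlace_lt_one_iff (c : ZMod 2) (a : (ZMod 2)[X]) :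
    (pointPlace c).valuation (algebraMap _ RF a) < 1 ↔ a.eval c = 0 := by
  unfold pointPlace
  rw [← (Valuation.isEquiv_valuation_valuationSubring _).lt_one_iff_lt_one, irrVal_lt_one_iff,
    dvd_iff_isRoot, IsRoot.def]

lemma X_mem_pointPlace (c : ZMod 2) : algebraMap (ZMod 2)[X] RF X ∈ pointPlace c :=
  irrVal_le_one _ X

lemma pointPlace_mem_ratPlaces (c : ZMod 2) : pointPlace c ∈ ratPlaces RF := by
  refine ⟨irrVal_ne_top _, fun z hz => ?_⟩
  obtain ⟨a, b, hb, rfl⟩ := ValuationSubring.exists_eq_div (X_mem_pointPlace c) hz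
  have hb0 : algebraMap (ZMod 2)[X] RF b ≠ 0 := by
    intro h0; rw [h0, map_zero] at hb; exact zero_ne_one hb
  have hb1 : b.eval c = 1 := by
    have : ¬ b.eval c = 0 := by rw [← pointPlace_lt_one_iff, hb]; exact lt_irrefl _
    generalize b.eval c = d at this
    revert d; decide
  have h2 : algebraMap (ZMod 2)[X] RF a / algebraMap _ RF b + 1 =
      algebraMap _ RF (a + b) / algebraMap _ RF b := by
    rw [map_add]; field_simp
  rw [h2, map_div₀, map_div₀, hb, div_one, div_one, pointPlace_lt_one_iff, pointPlace_lt_one_iff,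
    eval_add, hb1]
  generalize a.eval c = d
  revert d; decide

lemma pointPlace_injective : Function.Injective pointPlace := by
  intro c d hcd
  have h1 := pointPlace_lt_one_iff c (X - C d)
  rw [hcd, pointPlace_lt_one_iff] at h1
  have : c - d = 0 := by simpa using h1.1 (by simp)
  exact sub_eq_zero.1 this

lemma finite_ratPlaces_eq :
    {V : ValuationSubring RF | V ∈ ratPlaces RF ∧ algebraMap (ZMod 2)[X] RF X ∈ V} =
      Set.range pointPlace := by
  ext V
  constructor
  · rintro ⟨hV, hX⟩
    rcases hV.2 _ hX with h1 | h1
    · refine ⟨0, (ValuationSubring.eq_irrVal _ hX ?_).symm⟩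
      simpa using h1
    · refine ⟨1, (ValuationSubring.eq_irrVal _ hX ?_).symm⟩
      have : (X - C 1 : (ZMod 2)[X]) = X + 1 := by
        rw [map_one]; linear_combination (-1 : (ZMod 2)[X]) * two_eq_zero_zmod
      rwa [this, map_add, map_one]
  · rintro ⟨c, rfl⟩
    exact ⟨pointPlace_mem_ratPlaces c, X_mem_pointPlace c⟩

/-- Numerator and denominator have equal degree and, over `𝔽₂`, leading coefficient `1`, so their
difference has smaller degree. -/
lemma infVal_add_one_lt {a : RF} (ha : infVal a = 1) : infVal (a + 1) < 1 := by
  have hd0 : a.denom ≠ 0 := RatFunc.denom_ne_zero a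
  have hd0' : algebraMap (ZMod 2)[X] RF a.denom ≠ 0 := by simpa using hd0
  have hn0 : a.num ≠ 0 := by
    intro h0
    have : a = 0 := by rw [← RatFunc.num_div_denom a, h0]; simp
    rw [this, map_zero] at ha; exact zero_ne_one ha
  rw [← RatFunc.num_div_denom a, map_div₀, infVal_polynomial hn0, infVal_polynomial hd0,
    ← exp_sub, exp_eq_one] at ha
  have hlc : ∀ b : (ZMod 2)[X], b ≠ 0 → b.leadingCoeff = 1 := by
    intro b hb
    have := leadingCoeff_ne_zero.2 hb
    generalize b.leadingCoeff = d at this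
    revert d; decide
  have e : a + 1 = algebraMap _ RF (a.num - a.denom) / algebraMap _ RF a.denom := by
    have h2 : (2 : RF) = 0 := CharTwo.two_eq_zero
    have h3 := (div_eq_iff hd0').1 (RatFunc.num_div_denom a)
    rw [eq_div_iff hd0', map_sub, h3]
    linear_combination (algebraMap (ZMod 2)[X] RF a.denom) * h2
  rw [e, map_div₀, infVal_polynomial hd0]
  refine (div_lt_one₀ exp_pos).2 ?_
  by_cases h0 : a.num - a.denom = 0
  · rw [h0, map_zero, map_zero]; exact exp_pos
  · rw [infVal_polynomial h0, exp_lt_exp]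
    have hdeg : a.num.natDegree = a.denom.natDegree := by omega
    have := degree_sub_lt_left (p := a.num) (q := a.denom)
      (by rw [degree_eq_natDegree hn0, degree_eq_natDegree hd0, hdeg]) hn0
      (by rw [hlc _ hn0, hlc _ hd0])
    have := natDegree_lt_natDegree h0 this
    omega

lemma infVal_derivative_le (a : (ZMod 2)[X]) :
    infVal (algebraMap _ RF (derivative a)) ≤ infVal (algebraMap _ RF a) * exp (-1) := by
  by_cases h0 : derivative a = 0
  · rw [h0, map_zero, map_zero]; exact zero_le
  have ha : a ≠ 0 := by rintro rfl; simp at h0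
  have hd : a.natDegree ≠ 0 := fun h1 => h0 (derivative_of_natDegree_zero h1)
  rw [infVal_polynomial h0, infVal_polynomial ha, ← exp_add, exp_le_exp]
  have := natDegree_derivative_lt hd
  omega

lemma infVal_derivation_le {D : Derivation (ZMod 2) RF RF}
    (hD : ∀ a : (ZMod 2)[X], D (algebraMap _ RF a) = algebraMap _ RF (derivative a)) (a : RF) :
    infVal (D a) ≤ infVal a * exp (-1) := by
  have hd0' : algebraMap (ZMod 2)[X] RF a.denom ≠ 0 := by simpa using RatFunc.denom_ne_zero a
  have e : D a * algebraMap _ RF a.denom = algebraMap _ RF (derivative a.num) -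
      a * algebraMap _ RF (derivative a.denom) := by
    have h3 := (div_eq_iff hd0').1 (RatFunc.num_div_denom a)
    have h4 := congrArg D h3
    rw [Derivation.leibniz, hD, hD, smul_eq_mul, smul_eq_mul] at h4
    rw [h4]; ring
  have hpos : 0 < infVal (algebraMap _ RF a.denom) := by
    simpa [zero_lt_iff] using RatFunc.denom_ne_zero a
  refine le_of_mul_le_mul_right ?_ hpos
  rw [← map_mul, e]
  refine infVal.map_sub_le ?_ ?_
  · refine (infVal_derivative_le _).trans ?_
    have h3 := (div_eq_iff hd0').1 (RatFunc.num_div_denom a)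
    rw [h3, map_mul]
    exact le_of_eq (mul_right_comm _ _ _)
  · rw [map_mul, mul_assoc, mul_comm (exp (-1))]
    exact mul_le_mul_right (infVal_derivative_le _) _

end RatFuncPlaces

/-! ### Rational places of `E` and the invariant differential -/

section Base

set_option linter.unusedSectionVars false

variable {K : Type*} [Field K] [Algebra (ZMod 2)[X] K] [Algebra RF K]
  [IsScalarTower (ZMod 2)[X] RF K] {y : K} {v : Valuation K ℤᵐ⁰}

namespace IsArtinSchreier

variable (h : IsArtinSchreier RF K y (algebraMap (ZMod 2)[X] RF (X ^ 3 + X)))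
include h

lemma infPlace_algebraMap (a : RF) : h.infPlace (algebraMap RF K a) = infVal a ^ 2 := by
  have := h.infPlace_coords a 0
  simpa using this

lemma x_notMem_infPlace :
    algebraMap _ K (X : (ZMod 2)[X]) ∉ h.infPlace.valuationSubring := by
  rw [Valuation.mem_valuationSubring_iff, ← algebraMap_poly_eq, h.infPlace_algebraMap,
    infVal_polynomial X_ne_zero, natDegree_X, exp_sq, ← exp_zero, exp_le_exp]
  norm_num

lemma infPlace_ne_top : h.infPlace.valuationSubring ≠ ⊤ := by
  intro ht
  exact h.x_notMem_infPlace (ht ▸ ValuationSubring.mem_top _)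

lemma mem_infPlace_iff (a b : RF) :
    algebraMap RF K a + algebraMap RF K b * y ∈ h.infPlace.valuationSubring ↔
      infVal a ≤ 1 ∧ infVal b ≤ exp (-2) := by
  rw [Valuation.mem_valuationSubring_iff, h.infPlace_coords, max_le_iff, ← exp_zero,
    sq_le_exp_iff 0 (by omega), sq_mul_exp_le_exp_iff (-2) (by omega)]

lemma infPlace_mem_ratPlaces : h.infPlace.valuationSubring ∈ ratPlaces K := by
  refine ⟨h.infPlace_ne_top, fun z hz => ?_⟩
  simp only [← (Valuation.isEquiv_valuation_valuationSubring _).lt_one_iff_lt_one]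
  obtain ⟨a, b, rfl⟩ := h.exists_coords z
  rw [h.mem_infPlace_iff] at hz
  have key : ∀ a' : RF, infVal a' < 1 →
      h.infPlace (algebraMap RF K a' + algebraMap RF K b * y) < 1 := by
    intro a' ha'
    rw [h.infPlace_coords, lt_one_iff_le_exp, max_le_iff, sq_le_exp_iff (-1) (by omega),
      sq_mul_exp_le_exp_iff (-2) (by omega)]
    exact ⟨lt_one_iff_le_exp.1 ha', hz.2⟩
  rcases lt_or_eq_of_le hz.1 with h1 | h1
  · exact Or.inl (key a h1)
  · right
    have e : algebraMap RF K a + algebraMap RF K b * y + 1 =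
        algebraMap RF K (a + 1) + algebraMap RF K b * y := by rw [map_add, map_one]; ring
    rw [e]
    exact key _ (infVal_add_one_lt h1)

/-- `x ^ 3 + x` vanishes at both rational points of the affine line, so each splits; infinity
contributes the fifth place. -/
lemma card_ratPlaces_base : Nat.card (ratPlaces K) = 5 := by
  have h1 := h.card_ratPlaces_over (T := Set.range pointPlace)
    (by rintro _ ⟨c, rfl⟩; exact pointPlace_mem_ratPlaces c) (by
      rintro _ ⟨c, rfl⟩
      rw [pointPlace_lt_one_iff]
      simp only [eval_add, eval_pow, eval_X]
      revert c; decide)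
  rw [Nat.card_range_of_injective pointPlace_injective, Nat.card_zmod] at h1
  set A := {V : ValuationSubring K | V ∈ ratPlaces K ∧
    V.comap (algebraMap RF K) ∈ Set.range pointPlace} with hA
  have hx : ∀ V ∈ ratPlaces K, V ∈ A ↔ algebraMap _ K (X : (ZMod 2)[X]) ∈ V := by
    intro V hV
    rw [hA, Set.mem_ofPred_eq, ← finite_ratPlaces_eq, Set.mem_ofPred_eq,
      ValuationSubring.mem_comap, algebraMap_poly_eq]
    exact ⟨fun h => h.2.2, fun h' => ⟨hV, h.comap_mem_ratPlaces hV, h'⟩⟩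
  have hU : ratPlaces K = insert h.infPlace.valuationSubring A := by
    ext V
    rw [Set.mem_insert_iff]
    constructor
    · intro hV
      by_cases hxV : algebraMap _ K (X : (ZMod 2)[X]) ∈ V
      · exact Or.inr ((hx V hV).2 hxV)
      · exact Or.inl (h.eq_infPlace hxV)
    · rintro (rfl | hV)
      · exact h.infPlace_mem_ratPlaces
      · exact hV.1
  rw [Nat.card_coe_set_eq] at h1 ⊢
  rw [hU, Set.ncard_insert_of_notMem _ (Set.finite_of_ncard_ne_zero (by omega)), h1]
  rw [hx _ h.infPlace_mem_ratPlaces]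
  exact h.x_notMem_infPlace

variable [Algebra (ZMod 2) K] {D₀ : Derivation (ZMod 2) RF RF} {D : Derivation (ZMod 2) K K}
  (hD₀ : ∀ a : (ZMod 2)[X], D₀ (algebraMap _ RF a) = algebraMap _ RF (derivative a))
  (hD : ∀ a, D (algebraMap RF K a) = algebraMap RF K (D₀ a))
include hD₀ hD

lemma derivation_mem_finite {V : ValuationSubring K}
    (hx : algebraMap _ K (X : (ZMod 2)[X]) ∈ V) {z : K} (hz : z ∈ V) : D z ∈ V := by
  have hx' : algebraMap _ RF (X : (ZMod 2)[X]) ∈ V.comap (algebraMap RF K) := by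
    rwa [ValuationSubring.mem_comap, algebraMap_poly_eq]
  have hp : ∀ a : (ZMod 2)[X], algebraMap RF K (algebraMap _ RF a) ∈ V := fun a => by
    rw [algebraMap_poly_eq]; exact V.poly_mem hx a
  refine h.derivation_mem D₀ D hD V (fun a ha => ?_) (hp _) hz
  obtain ⟨n, d, hd, rfl⟩ := ValuationSubring.exists_eq_div hx' ha
  have hd0 : algebraMap (ZMod 2)[X] RF d ≠ 0 := by
    intro h0; rw [h0, map_zero] at hd; exact zero_ne_one hd
  have hdi : algebraMap RF K (algebraMap _ RF d)⁻¹ ∈ V :=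
    ((ValuationSubring.valuation_eq_one_iff_mem _ hd0).1 hd).2
  rw [div_eq_mul_inv, Derivation.leibniz, Derivation.leibniz_inv, hD₀, hD₀]
  simp only [smul_eq_mul, map_add, map_mul, map_neg, map_pow]
  exact V.add_mem _ _ (V.mul_mem _ _ (hp _) (V.mul_mem _ _ (V.neg_mem _ (pow_mem hdi 2)) (hp _)))
    (V.mul_mem _ _ hdi (hp _))

lemma derivation_coords (a b : RF) : D (algebraMap RF K a + algebraMap RF K b * y) =
    algebraMap RF K (D₀ a + b * algebraMap (ZMod 2)[X] RF (X ^ 2 + 1)) +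
      algebraMap RF K (D₀ b) * y := by
  have hd : derivative (X ^ 3 + X : (ZMod 2)[X]) = X ^ 2 + 1 := by
    simp only [derivative_add, derivative_X_pow, derivative_X]
    have : (C ((3 : ℕ) : ZMod 2) : (ZMod 2)[X]) = 1 := by
      rw [← map_one C]; rfl
    rw [this]; norm_num
  rw [map_add, Derivation.leibniz, hD, hD, h.derivation_gen D₀ D hD, hD₀, hd, smul_eq_mul,
    smul_eq_mul]
  simp only [map_add, map_mul]; ring

/-- Integrality at infinity bounds `b` by degree `-2`, which compensates `D y = x ^ 2 + 1`. -/
lemma derivation_mem_infPlace {z : K} (hz : z ∈ h.infPlace.valuationSubring) :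
    D z ∈ h.infPlace.valuationSubring := by
  obtain ⟨a, b, rfl⟩ := h.exists_coords z
  rw [h.mem_infPlace_iff] at hz
  rw [h.derivation_coords hD₀ hD, h.mem_infPlace_iff]
  have hm : ∀ c : RF, ∀ n : ℤ, infVal c ≤ exp n → infVal (D₀ c) ≤ exp (n - 1) := by
    intro c n hc
    refine (infVal_derivation_le hD₀ c).trans ((mul_le_mul_left hc _).trans ?_)
    rw [← exp_add, exp_le_exp]; omega
  refine ⟨infVal.map_add_le ?_ ?_, ?_⟩
  · refine (hm a 0 (by simpa using hz.1)).trans ?_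
    rw [← exp_zero, exp_le_exp]; omega
  · rw [map_mul]
    have h2 : infVal (algebraMap (ZMod 2)[X] RF (X ^ 2 + 1)) ≤ exp ((2 : ℕ) : ℤ) :=
      infVal_polynomial_le (by compute_degree)
    refine (mul_le_mul' hz.2 h2).trans ?_
    rw [← exp_add, ← exp_zero, exp_le_exp]; norm_num
  · refine (hm b (-2) hz.2).trans ?_
    rw [exp_le_exp]; omega

/-- The witness is the uniformizer `y / x ^ 2`. Since `D` kills `x ^ 2`, its derivative is the unit
`(x ^ 2 + 1) / x ^ 2`. -/
lemma exists_derivation_unit_infPlace : ∃ b ∈ h.infPlace.valuationSubring,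
    D b ≠ 0 ∧ (D b)⁻¹ ∈ h.infPlace.valuationSubring := by
  have hX : infVal (algebraMap (ZMod 2)[X] RF (X ^ 2)) = exp 2 := by
    rw [infVal_polynomial (pow_ne_zero 2 X_ne_zero), natDegree_X_pow]; rfl
  have hX1 : infVal (algebraMap (ZMod 2)[X] RF (X ^ 2 + 1)) = exp 2 := by
    have hd : (X ^ 2 + 1 : (ZMod 2)[X]).natDegree = 2 := by compute_degree!
    rw [infVal_polynomial (fun h0 => by rw [h0] at hd; simp at hd), hd]; rfl
  have hDX : D₀ (algebraMap (ZMod 2)[X] RF (X ^ 2))⁻¹ = 0 := by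
    have : derivative (X ^ 2 : (ZMod 2)[X]) = 0 := by
      rw [derivative_X_pow]
      have : (C ((2 : ℕ) : ZMod 2) : (ZMod 2)[X]) = 0 := by rw [← map_zero C]; rfl
      rw [this, zero_mul]
    rw [Derivation.leibniz_inv, hD₀, this, map_zero, smul_zero]
  have e := h.derivation_coords hD₀ hD 0 (algebraMap (ZMod 2)[X] RF (X ^ 2))⁻¹
  simp only [hDX, map_zero, zero_mul, add_zero, zero_add] at e
  have hval : h.infPlace (algebraMap RF K ((algebraMap (ZMod 2)[X] RF (X ^ 2))⁻¹ *
      algebraMap (ZMod 2)[X] RF (X ^ 2 + 1))) = 1 := by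
    rw [h.infPlace_algebraMap, map_mul, map_inv₀, hX, hX1, inv_mul_cancel₀ exp_ne_zero, one_pow]
  refine ⟨algebraMap RF K 0 + algebraMap RF K (algebraMap (ZMod 2)[X] RF (X ^ 2))⁻¹ * y, ?_, ?_⟩
  · rw [h.mem_infPlace_iff, map_inv₀, hX, ← exp_neg]; simp
  · rw [map_zero, zero_add, e]
    refine ⟨fun h0 => ?_, ?_⟩
    · rw [h0, map_zero] at hval; exact zero_ne_one hval
    · rw [Valuation.mem_valuationSubring_iff, map_inv₀, hval, inv_one]

end IsArtinSchreier

end Base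

/-! ### Functions on `E` with poles only at the ramified place -/

section Base

set_option linter.unusedSectionVars false

variable {K : Type*} [Field K] [Algebra (ZMod 2)[X] K] [Algebra RF K]
  [IsScalarTower (ZMod 2)[X] RF K] {y : K} {v : Valuation K ℤᵐ⁰}

/-- A function with at most a simple pole at the ramified place and leading coefficient `b`. -/
noncomputable def ramFun (y : K) (b : (ZMod 2)[X]) : K :=
  (algebraMap _ K ((b * (ramRoot + 1)) %ₘ ramPoly) + algebraMap _ K b * y) /
    algebraMap _ K ramPoly

namespace IsRamVal

variable (hv : IsRamVal y v)
  (h : IsArtinSchreier RF K y (algebraMap (ZMod 2)[X] RF (X ^ 3 + X)))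
include hv

/-- The numerator is `b * (y + ramRoot + 1)` modulo `ramPoly`, and `y + ramRoot` vanishes at the
place. -/
lemma ramFun_lead (b : (ZMod 2)[X]) :
    v (algebraMap _ K ramPoly * ramFun y b - algebraMap _ K b) < 1 := by
  have hp0 : algebraMap (ZMod 2)[X] K ramPoly ≠ 0 := algebraMap_poly_ne_zero ramPoly_ne_zero
  have e : algebraMap _ K ramPoly * ramFun y b - algebraMap _ K b =
      algebraMap _ K b * (y + algebraMap _ K ramRoot) -
        algebraMap _ K (ramPoly * ((b * (ramRoot + 1)) /ₘ ramPoly)) := by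
    unfold ramFun
    rw [mul_div_cancel₀ _ hp0]
    have := congrArg (algebraMap (ZMod 2)[X] K)
      (modByMonic_add_div (b * (ramRoot + 1)) ramPoly)
    simp only [map_add, map_mul, map_one] at this ⊢
    linear_combination this
  rw [e]
  refine v.map_sub_lt ?_ ((hv.poly_lt_one_iff _).2 (dvd_mul_right _ _))
  rw [map_mul]
  exact mul_lt_one_of_nonneg_of_lt_one_right (hv.poly_le_one b) zero_le hv.root

lemma ramFun_le (b : (ZMod 2)[X]) : v (ramFun y b) ≤ exp 1 := by
  have hp0 : algebraMap (ZMod 2)[X] K ramPoly ≠ 0 := algebraMap_poly_ne_zero ramPoly_ne_zero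
  have h1 : v (algebraMap _ K ramPoly * ramFun y b) ≤ 1 := by
    have := v.map_add_le (hv.ramFun_lead b).le (hv.poly_le_one b)
    rwa [sub_add_cancel] at this
  have e : ramFun y b =
      (algebraMap _ K ramPoly)⁻¹ * (algebraMap _ K ramPoly * ramFun y b) := by
    field_simp
  rw [e, map_mul, map_inv₀, hv.ramPoly_eq, ← exp_neg, neg_neg]
  exact mul_le_of_le_one_right zero_le h1

include h

/-- The bound 5 is the condition at infinity: `2 * 5 + 3 ≤ 14`. -/
lemma ramFun_mem {b : (ZMod 2)[X]} (hb : b.natDegree ≤ 5) : ramFun y b ∈ regularAway v := by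
  have h1 : ramPoly ≠ 1 := fun h1 => by
    have := natDegree_ramPoly
    rw [h1, natDegree_one] at this; omega
  have := hv.mem_regularAway h (m := 1) (B := ramRoot) (e := X ^ 5 + X ^ 3) (b := b)
    (a := (b * (ramRoot + 1)) %ₘ ramPoly) (c := -((b * (ramRoot + 1)) /ₘ ramPoly))
    (by rw [sub_self]; exact dvd_zero _) (by rw [pow_one]; exact ramRoot_eq)
    (by
      rw [pow_one]
      linear_combination modByMonic_add_div (b * (ramRoot + 1)) ramPoly)
    (by
      have := natDegree_modByMonic_lt (b * (ramRoot + 1)) ramPoly_monic h1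
      rw [natDegree_ramPoly] at this; omega) (by omega)
  rwa [pow_one] at this

lemma const_mem (c : ZMod 2) : algebraMap _ K (C c : (ZMod 2)[X]) ∈ regularAway v := by
  intro V _ _
  have : c = 0 ∨ c = 1 := by revert c; decide
  rcases this with rfl | rfl
  · simp [V.zero_mem]
  · simp [V.one_mem]

/-- The Riemann-Roch space of the ramified place. -/
lemma exists_of_mem_poleSpace_one {z : K} (hz : z ∈ poleSpace v 1) :
    ∃ (b : (ZMod 2)[X]) (c : ZMod 2), b.natDegree ≤ 5 ∧
      z = ramFun y b + algebraMap _ K (C c) := by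
  obtain ⟨hzr, hzv⟩ := hz
  have hp0 : algebraMap (ZMod 2)[X] K ramPoly ≠ 0 := algebraMap_poly_ne_zero ramPoly_ne_zero
  have hp0' : algebraMap (ZMod 2)[X] RF ramPoly ≠ 0 := by simpa using ramPoly_ne_zero
  -- `ramPoly * z` has no finite poles, so its coordinates are polynomials.
  obtain ⟨a', b', hab⟩ := h.exists_coords (algebraMap _ K ramPoly * z)
  have hcoord : ∀ (q : (ZMod 2)[X]) (hq : Irreducible q),
      a' ∈ (irrVal hq).valuationSubring ∧ b' ∈ (irrVal hq).valuationSubring := by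
    intro q hq
    refine h.coords_mem (irrVal_le_one hq (X ^ 3 + X)) fun V hV => ?_
    rw [← hab]
    by_cases hVv : V = v.valuationSubring
    · rw [hVv, Valuation.mem_valuationSubring_iff, map_mul, hv.ramPoly_eq]
      refine (mul_le_mul_right hzv _).trans ?_
      rw [← exp_add]; simp
    · have hx : algebraMap _ K (X : (ZMod 2)[X]) ∈ V := by
        rw [← algebraMap_poly_eq, ← ValuationSubring.mem_comap, hV]
        exact irrVal_le_one hq X
      exact V.mul_mem _ _ (V.poly_mem hx _)
        (hzr V (h.comap_ne_top_iff.1 (hV ▸ irrVal_ne_top hq)) hVv)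
  obtain ⟨A, rfl⟩ := exists_poly_of_irrVal_le_one fun q hq => (hcoord q hq).1
  obtain ⟨B, rfl⟩ := exists_poly_of_irrVal_le_one fun q hq => (hcoord q hq).2
  rw [algebraMap_poly_eq, algebraMap_poly_eq] at hab
  have hz : z = (algebraMap _ K A + algebraMap _ K B * y) / algebraMap _ K ramPoly := by
    rw [eq_div_iff hp0, ← hab]; ring
  -- degrees
  have hinf : z ∈ h.infPlace.valuationSubring := by
    refine hzr _ h.infPlace_ne_top fun hc => h.x_notMem_infPlace ?_
    rw [hc]; exact hv.x_mem
  have e1 : z = algebraMap RF K (algebraMap _ RF A / algebraMap _ RF ramPoly) +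
      algebraMap RF K (algebraMap _ RF B / algebraMap _ RF ramPoly) * y := by
    rw [hz]; simp only [map_div₀, algebraMap_poly_eq]; ring
  rw [e1, h.mem_infPlace_iff, map_div₀, map_div₀, infVal_polynomial ramPoly_ne_zero,
    natDegree_ramPoly] at hinf
  have hA : A.natDegree ≤ 7 := by
    by_cases h0 : A = 0
    · simp [h0]
    · have := hinf.1
      rw [infVal_polynomial h0, ← exp_sub, ← exp_zero, exp_le_exp] at this
      omega
  have hB : B.natDegree ≤ 5 := by
    by_cases h0 : B = 0
    · simp [h0]
    · have := hinf.2
      rw [infVal_polynomial h0, ← exp_sub, exp_le_exp] at this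
      omega
  -- the conjugate place
  have hdvd : ramPoly ∣ A - B * (ramRoot + 1) := by
    obtain ⟨V, hV, hVy⟩ := h.exists_place_of_root ramPoly_irreducible (B := ramRoot + 1)
      (Dvd.intro (X ^ 5 + X ^ 3) (by
        rw [← ramRoot_eq]
        linear_combination (-ramRoot - 1) * two_eq_zero_zmod))
    have hx : algebraMap _ K (X : (ZMod 2)[X]) ∈ V := by
      rw [← algebraMap_poly_eq, ← ValuationSubring.mem_comap, hV]
      exact irrVal_le_one _ X
    have hpV : V.valuation (algebraMap _ K ramPoly) < 1 := by
      rw [← algebraMap_poly_eq, ← ValuationSubring.valuation_comap_lt_one_iff, hV,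
        ← (Valuation.isEquiv_valuation_valuationSubring _).lt_one_iff_lt_one, irrVal_lt_one_iff]
    have hVv : V ≠ v.valuationSubring := by
      rintro rfl
      rw [← (Valuation.isEquiv_valuation_valuationSubring _).lt_one_iff_lt_one,
        map_add (algebraMap (ZMod 2)[X] K), map_one (algebraMap (ZMod 2)[X] K), ← add_assoc] at hVy
      have := v.map_one_add_of_lt hv.root
      rw [add_comm, this] at hVy
      exact lt_irrefl _ hVy
    have hzV := hzr V (h.comap_ne_top_iff.1 (hV ▸ irrVal_ne_top _)) hVv
    have e2 : algebraMap _ K (A - B * (ramRoot + 1)) = z * algebraMap _ K ramPoly -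
        algebraMap _ K B * (y + algebraMap _ K (ramRoot + 1)) := by
      rw [hz, div_mul_cancel₀ _ hp0]
      simp only [map_sub, map_mul]; ring
    have h3 : V.valuation (algebraMap _ K (A - B * (ramRoot + 1))) < 1 := by
      rw [e2]
      refine V.valuation.map_sub_lt ?_ ?_ <;> rw [map_mul]
      · exact mul_lt_one_of_nonneg_of_lt_one_right ((V.valuation_le_one_iff _).2 hzV) zero_le hpV
      · exact mul_lt_one_of_nonneg_of_lt_one_right (V.poly_le_one hx _) zero_le hVy
    rwa [← algebraMap_poly_eq, ← ValuationSubring.valuation_comap_lt_one_iff, hV,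
        ← (Valuation.isEquiv_valuation_valuationSubring _).lt_one_iff_lt_one,
        irrVal_lt_one_iff] at h3
  have hmod : A %ₘ ramPoly = (B * (ramRoot + 1)) %ₘ ramPoly := by
    rw [← sub_eq_zero, ← sub_modByMonic]
    exact (modByMonic_eq_zero_iff_dvd ramPoly_monic).2 hdvd
  have hdiv : A /ₘ ramPoly = C ((A /ₘ ramPoly).coeff 0) := by
    apply eq_C_of_natDegree_le_zero
    rw [natDegree_divByMonic _ ramPoly_monic, natDegree_ramPoly]; omega
  refine ⟨B, (A /ₘ ramPoly).coeff 0, hB, ?_⟩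
  rw [hz, ramFun, ← hmod, ← hdiv, div_add' _ _ _ hp0]
  congr 1
  have := congrArg (algebraMap (ZMod 2)[X] K) (modByMonic_add_div A ramPoly)
  rw [map_add, map_mul] at this
  linear_combination -this

lemma ramFun_add_const_inj {b b' : (ZMod 2)[X]} {c c' : ZMod 2}
    (e : ramFun y b + algebraMap _ K (C c) = ramFun y b' + algebraMap _ K (C c')) :
    b = b' ∧ c = c' := by
  have hp0 : algebraMap (ZMod 2)[X] RF ramPoly ≠ 0 := by simpa using ramPoly_ne_zero
  have key : ∀ (b : (ZMod 2)[X]) (c : ZMod 2), ramFun y b + algebraMap _ K (C c) =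
      algebraMap RF K (algebraMap _ RF ((b * (ramRoot + 1)) %ₘ ramPoly) /
        algebraMap _ RF ramPoly + algebraMap _ RF (C c)) +
      algebraMap RF K (algebraMap _ RF b / algebraMap _ RF ramPoly) * y := by
    intro b c
    unfold ramFun
    rw [map_add, map_div₀, map_div₀]
    simp only [algebraMap_poly_eq]; ring
  rw [key, key] at e
  obtain ⟨h1, h2⟩ := h.coords_unique e
  have hb : b = b' := by
    have := (div_left_inj' hp0).1 h2
    exact RatFunc.algebraMap_injective _ this
  subst hb
  exact ⟨rfl, C_injective (RatFunc.algebraMap_injective _ (add_left_cancel h1))⟩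

/-- Six coefficients of `b` and one additive constant. -/
lemma card_poleSpace_one : Nat.card (poleSpace v 1) = 2 ^ 7 := by
  have hdeg : ∀ b ∈ degreeLT (ZMod 2) 6, b.natDegree ≤ 5 := by
    intro b hb
    rw [mem_degreeLT] at hb
    by_cases h0 : b = 0
    · simp [h0]
    · have := (natDegree_lt_iff_degree_lt h0).2 hb
      omega
  let φ : degreeLT (ZMod 2) 6 × ZMod 2 → poleSpace v 1 := fun x =>
    ⟨ramFun y x.1.1 + algebraMap _ K (C x.2),
      regularAway.add (hv.ramFun_mem h (hdeg _ x.1.2)) (hv.const_mem h x.2),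
      v.map_add_le (hv.ramFun_le _) ((hv.poly_le_one _).trans
        (by rw [← exp_zero, exp_le_exp]; norm_num))⟩
  have hφ : Function.Bijective φ := by
    constructor
    · rintro ⟨⟨b, hb⟩, c⟩ ⟨⟨b', hb'⟩, c'⟩ he
      obtain ⟨h1, h2⟩ := hv.ramFun_add_const_inj h (congrArg Subtype.val he)
      simp only at h1 h2
      subst h1 h2
      rfl
    · rintro ⟨z, hz⟩
      obtain ⟨b, c, hb, rfl⟩ := hv.exists_of_mem_poleSpace_one h hz
      refine ⟨(⟨b, ?_⟩, c), rfl⟩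
      rw [mem_degreeLT]
      exact lt_of_le_of_lt degree_le_natDegree (by exact_mod_cast Nat.lt_succ_of_le hb)
  rw [← Nat.card_congr (Equiv.ofBijective φ hφ), Nat.card_prod,
    Nat.card_congr (degreeLTEquiv (ZMod 2) 6).toEquiv]
  simp

/-- Without a pole the leading coefficient `b`, of degree less than 7, must be zero; only constants
remain. -/
lemma card_poleSpace_zero : Nat.card (poleSpace v 0) = 2 := by
  let φ : ZMod 2 → poleSpace v 0 := fun c =>
    ⟨algebraMap _ K (C c : (ZMod 2)[X]), hv.const_mem h c, hv.poly_le_one _⟩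
  have h0 : ramFun y 0 = 0 := by simp [ramFun]
  have hφ : Function.Bijective φ := by
    constructor
    · intro c c' he
      refine (hv.ramFun_add_const_inj h (b := 0) (b' := 0) ?_).2
      rw [h0, zero_add, zero_add]
      exact congrArg Subtype.val he
    · rintro ⟨z, hz⟩
      obtain ⟨b, c, hb, rfl⟩ := hv.exists_of_mem_poleSpace_one h
        ⟨hz.1, hz.2.trans (by rw [exp_le_exp]; norm_num)⟩
      have hb0 : b = 0 := by
        by_contra hb0
        have h1 := hv.poly_eq_one hb0 (by omega)
        have hp : v (algebraMap _ K ramPoly) < 1 := (hv.poly_lt_one_iff _).2 dvd_rfl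
        have e : algebraMap _ K b = algebraMap _ K ramPoly *
            (ramFun y b + algebraMap _ K (C c)) - algebraMap _ K ramPoly * algebraMap _ K (C c) -
            (algebraMap _ K ramPoly * ramFun y b - algebraMap _ K b) := by ring
        have h2 : v (algebraMap _ K b) < 1 := by
          rw [e]
          refine v.map_sub_lt (v.map_sub_lt ?_ ?_) (hv.ramFun_lead b)
          · rw [map_mul, mul_comm]
            exact mul_lt_one_of_nonneg_of_lt_one_right (by simpa using hz.2) zero_le hp
          · rw [map_mul, mul_comm]
            exact mul_lt_one_of_nonneg_of_lt_one_right (hv.poly_le_one _) zero_le hp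
        exact absurd h1 (ne_of_lt h2)
      subst hb0
      exact ⟨c, Subtype.ext (by simp [φ, h0])⟩
  rw [← Nat.card_congr (Equiv.ofBijective φ hφ), Nat.card_zmod]

/-- Every residue is the leading coefficient of a function with a given pole order at least two
at the ramified place and no other poles. -/
lemma exists_regular_lead (m : ℕ) {b : (ZMod 2)[X]} (hb : b.natDegree < 7) :
    ∃ r ∈ regularAway v, v (algebraMap _ K ramPoly ^ (m + 2) * r - algebraMap _ K b) < 1 := by
  have hmul : ∀ z z' : K, ∀ b b' : (ZMod 2)[X], v (z - algebraMap _ K b) < 1 →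
      v (z' - algebraMap _ K b') < 1 → v (z * z' - algebraMap _ K (b * b')) < 1 := by
    intro z z' b b' h2 h3
    have h1 : v z ≤ 1 := by
      have := v.map_add_le h2.le (hv.poly_le_one b)
      rwa [sub_add_cancel] at this
    have e : z * z' - algebraMap _ K (b * b') =
        z * (z' - algebraMap _ K b') + algebraMap _ K b' * (z - algebraMap _ K b) := by
      rw [map_mul]; ring
    rw [e]
    refine v.map_add_lt ?_ ?_ <;> rw [map_mul]
    · exact mul_lt_one_of_nonneg_of_lt_one_right h1 zero_le h3
    · exact mul_lt_one_of_nonneg_of_lt_one_right (hv.poly_le_one _) zero_le h2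
  have hpow : ∀ m : ℕ, ∃ r ∈ regularAway v,
      v (algebraMap _ K ramPoly ^ m * r - algebraMap _ K (1 : (ZMod 2)[X])) < 1 := by
    intro m
    induction m with
    | zero => exact ⟨1, fun V _ _ => V.one_mem, by simp⟩
    | succ m ih =>
      obtain ⟨r, hr, hrv⟩ := ih
      refine ⟨r * ramFun y 1, regularAway.mul hr (hv.ramFun_mem h (by simp)), ?_⟩
      have := hmul _ _ _ _ hrv (hv.ramFun_lead 1)
      rw [mul_one] at this
      rwa [show algebraMap _ K ramPoly ^ (m + 1) * (r * ramFun y 1) =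
        algebraMap _ K ramPoly ^ m * r * (algebraMap _ K ramPoly * ramFun y 1) by ring]
  obtain ⟨r₁, hr₁, hrv₁⟩ := hpow (m + 1)
  obtain ⟨r₂, hr₂, hrv₂⟩ := hpow m
  have hlow : b.eraseLead.natDegree ≤ 5 := by
    have := eraseLead_natDegree_le b; omega
  -- A simple pole only realizes residues of degree at most 5. The missing `X ^ 6` is `X ^ 3 * X ^
  -- 3`, from a product of two simple poles; hence pole order at least two.
  by_cases h6 : b.natDegree = 6
  · have hb0 : b ≠ 0 := by rintro rfl; simp at h6
    have hlc : b.leadingCoeff = 1 := by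
      have := leadingCoeff_ne_zero.2 hb0
      generalize b.leadingCoeff = d at this
      revert d; decide
    have hbe : b = b.eraseLead + X ^ 6 := by
      conv_lhs => rw [← eraseLead_add_C_mul_X_pow b, hlc, h6]
      simp
    have hX3 : (X ^ 3 : (ZMod 2)[X]).natDegree ≤ 5 := by rw [natDegree_X_pow]; norm_num
    refine ⟨r₁ * ramFun y b.eraseLead + r₂ * (ramFun y (X ^ 3) * ramFun y (X ^ 3)),
      regularAway.add (regularAway.mul hr₁ (hv.ramFun_mem h hlow))
        (regularAway.mul hr₂ (regularAway.mul (hv.ramFun_mem h hX3) (hv.ramFun_mem h hX3))), ?_⟩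
    have h1 := hmul _ _ _ _ hrv₁ (hv.ramFun_lead b.eraseLead)
    have h2 := hmul _ _ _ _ hrv₂ (hmul _ _ _ _ (hv.ramFun_lead (X ^ 3)) (hv.ramFun_lead (X ^ 3)))
    have h3 := v.map_add_lt h1 h2
    refine lt_of_eq_of_lt (congrArg v ?_) h3
    have : algebraMap _ K b = algebraMap _ K b.eraseLead + algebraMap _ K (X ^ 6 : (ZMod 2)[X]) := by
      rw [← map_add, ← hbe]
    rw [this]
    simp only [map_mul, map_pow, map_one]
    ring
  · have hb5 : b.natDegree ≤ 5 := by omega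
    refine ⟨r₁ * ramFun y b, regularAway.mul hr₁ (hv.ramFun_mem h hb5), ?_⟩
    have h1 := hmul _ _ _ _ hrv₁ (hv.ramFun_lead b)
    rw [one_mul] at h1
    rwa [show algebraMap _ K ramPoly ^ (m + 2) * (r₁ * ramFun y b) =
      algebraMap _ K ramPoly ^ (m + 1) * r₁ * (algebraMap _ K ramPoly * ramFun y b) by ring]

/-- Leading terms of pole order at least two are removed one after the other by
`exists_regular_lead`. -/
lemma approx (z : K) : ∃ r ∈ regularAway v, v (z - r) ≤ exp 1 := by
  have hp0 : algebraMap (ZMod 2)[X] K ramPoly ≠ 0 := algebraMap_poly_ne_zero ramPoly_ne_zero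
  have key : ∀ (m : ℕ) (z : K), v z ≤ exp (m + 1 : ℤ) →
      ∃ r ∈ regularAway v, v (z - r) ≤ exp 1 := by
    intro m
    induction m with
    | zero =>
      intro z hz
      exact ⟨0, fun V _ _ => V.zero_mem, by simpa using hz⟩
    | succ m ih =>
      intro z hz
      have hpp : v (algebraMap _ K ramPoly ^ (m + 2)) = exp (-(m + 2) : ℤ) := by
        rw [map_pow, hv.ramPoly_eq, ← exp_nsmul]; congr 1; simp
      have h1 : v (algebraMap _ K ramPoly ^ (m + 2) * z) ≤ 1 := by
        rw [map_mul, hpp]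
        refine (mul_le_mul_right hz _).trans ?_
        rw [← exp_add, ← exp_zero, exp_le_exp]; push_cast; omega
      obtain ⟨b, hb, hbv⟩ := hv.exists_residue h h1
      obtain ⟨r, hr, hrv⟩ := hv.exists_regular_lead h m hb
      have h2 : v (z - r) ≤ exp (m + 1 : ℤ) := by
        have h3 := v.map_sub_lt hbv hrv
        rw [show algebraMap _ K ramPoly ^ (m + 2) * z - algebraMap _ K b -
          (algebraMap _ K ramPoly ^ (m + 2) * r - algebraMap _ K b) =
          algebraMap _ K ramPoly ^ (m + 2) * (z - r) by ring, map_mul, hpp] at h3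
        rcases eq_zero_or_exp (v (z - r)) with h0 | ⟨n, hn⟩
        · rw [h0]; exact zero_le
        · rw [hn, ← exp_add, ← exp_zero, exp_lt_exp] at h3
          rw [hn, exp_le_exp]; omega
      obtain ⟨s, hs, hsv⟩ := ih _ h2
      exact ⟨r + s, regularAway.add hr hs, by rwa [← sub_sub]⟩
  rcases eq_zero_or_exp (v z) with h0 | ⟨n, hn⟩
  · exact key 0 z (by rw [h0]; exact zero_le)
  · exact key n.toNat z (by rw [hn, exp_le_exp]; omega)

end IsRamVal

end Base

/-! ### The functions `f₁`, `f₂`, `f₃` and the bottom of the tower -/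

section Base

set_option linter.unusedSectionVars false

variable {K : Type*} [Field K] [Algebra (ZMod 2)[X] K] [Algebra RF K]
  [IsScalarTower (ZMod 2)[X] RF K] {y : K} {v : Valuation K ℤᵐ⁰}

/-- The functions of the form `(a y + b) / ramPoly ^ m`. -/
noncomputable def polarFun (y : K) (m : ℕ) (a b : (ZMod 2)[X]) : K :=
  (algebraMap _ K b + algebraMap _ K a * y) / algebraMap _ K ramPoly ^ m

/-- The function `f₁` on the elliptic curve. -/
noncomputable def polarFun₁ (y : K) : K := polarFun y 1 (X ^ 5 + X) (X ^ 2 + X)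

/-- The function `f₂` on the elliptic curve. -/
noncomputable def polarFun₂ (y : K) : K :=
  polarFun y 1 (X ^ 5 + X ^ 4 + X ^ 3 + X) (X ^ 6 + X ^ 4)

/-- The function `f₃` on the elliptic curve. -/
noncomputable def polarFun₃ (y : K) : K :=
  polarFun y 2 (X ^ 6 + X ^ 5) (X ^ 10 + X ^ 6 + X ^ 2 + X)

section Identities

lemma polarFun₁_eq : (X ^ 2 + X : (ZMod 2)[X]) =
    (X ^ 5 + X) * (ramRoot + 1) + ramPoly ^ 1 * (X ^ 4 + X ^ 3) := by
  unfold ramRoot ramPoly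
  linear_combination (-(X ^ 11 + X ^ 10 + X ^ 7 + X ^ 6 + X ^ 5 + X ^ 4 + X ^ 3) : (ZMod 2)[X]) * two_eq_zero_zmod

lemma polarFun₂_eq : (X ^ 6 + X ^ 4 : (ZMod 2)[X]) =
    (X ^ 5 + X ^ 4 + X ^ 3 + X) * (ramRoot + 1) + ramPoly ^ 1 * (X ^ 4 + X) := by
  unfold ramRoot ramPoly
  linear_combination (-(X ^ 11 + X ^ 10 + X ^ 9 + X ^ 8 + X ^ 7 + X ^ 6 + 2 * X ^ 5 + X ^ 4 + X ^ 3 + X ^ 2 + X) :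
    (ZMod 2)[X]) * two_eq_zero_zmod

lemma polarFun₃_eq : (X ^ 10 + X ^ 6 + X ^ 2 + X : (ZMod 2)[X]) =
    (X ^ 6 + X ^ 5) * (ramRootSq + 1) + ramPoly ^ 2 * (X ^ 4 + X ^ 3 + X ^ 2 + X) := by
  unfold ramRootSq ramPoly
  linear_combination (-(X ^ 18 + X ^ 17 + X ^ 16 + X ^ 15 + X ^ 12 + 2 * X ^ 11 + 2 * X ^ 10 + 3 * X ^ 9 +
    2 * X ^ 8 + X ^ 7 + X ^ 6 + 2 * X ^ 5 + 2 * X ^ 4 + 2 * X ^ 3 + X ^ 2) : (ZMod 2)[X]) * two_eq_zero_zmod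

end Identities

namespace IsRamVal

variable (hv : IsRamVal y v)
  (h : IsArtinSchreier RF K y (algebraMap (ZMod 2)[X] RF (X ^ 3 + X)))
include hv h

/-- The numerator is `a + a * (y + B)` modulo `ramPoly ^ m`, and `y + B` vanishes to order `m`, so
`a / ramPoly ^ m` is the polar part. -/
lemma polarFun_sub_le {m : ℕ} {B e a b c : (ZMod 2)[X]}
    (hB : ramPoly ∣ B - ramRoot) (he : X ^ 3 + X + B ^ 2 + B = ramPoly ^ m * e)
    (hab : b = a * (B + 1) + ramPoly ^ m * c) :
    v (polarFun y m a b - algebraMap _ K a / algebraMap _ K ramPoly ^ m) ≤ 1 := by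
  have hp0 : algebraMap (ZMod 2)[X] K ramPoly ≠ 0 := algebraMap_poly_ne_zero ramPoly_ne_zero
  have e1 : polarFun y m a b - algebraMap _ K a / algebraMap _ K ramPoly ^ m =
      algebraMap _ K a * ((y + algebraMap _ K B) / algebraMap _ K ramPoly ^ m) +
        algebraMap _ K c := by
    rw [polarFun, hab]
    simp only [map_add, map_mul, map_pow, map_one]
    field_simp
    ring
  rw [e1]
  refine v.map_add_le ?_ (hv.poly_le_one c)
  rw [map_mul, map_div₀, map_pow, hv.ramPoly_eq, ← exp_nsmul]
  refine mul_le_one' (hv.poly_le_one a) ?_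
  refine (div_le_div_of_nonneg_right (hv.root_le h hB he) zero_le).trans ?_
  rw [← exp_sub, ← exp_zero, exp_le_exp]; simp

lemma polarFun₁_mem : polarFun₁ y ∈ regularAway v :=
  hv.mem_regularAway h (by rw [sub_self]; exact dvd_zero _) (by rw [pow_one]; exact ramRoot_eq)
    polarFun₁_eq (by compute_degree!) (by
      have : (X ^ 5 + X : (ZMod 2)[X]).natDegree ≤ 5 := by compute_degree!
      omega)

lemma polarFun₂_mem : polarFun₂ y ∈ regularAway v :=
  hv.mem_regularAway h (by rw [sub_self]; exact dvd_zero _) (by rw [pow_one]; exact ramRoot_eq)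
    polarFun₂_eq (by compute_degree!) (by
      have : (X ^ 5 + X ^ 4 + X ^ 3 + X : (ZMod 2)[X]).natDegree ≤ 5 := by compute_degree!
      omega)

lemma polarFun₃_mem : polarFun₃ y ∈ regularAway v :=
  hv.mem_regularAway h (Dvd.intro _ ramRootSq_sub_ramRoot.symm) ramRootSq_eq
    polarFun₃_eq (by compute_degree!) (by
      have : (X ^ 6 + X ^ 5 : (ZMod 2)[X]).natDegree ≤ 6 := by compute_degree!
      omega)

/-- The double pole of `f₃` has coefficient `X ^ 6 + X ^ 5`, congruent to the square of `X ^ 6`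
modulo `ramPoly`. So `g = ε₃ X ^ 6 / ramPoly` cancels it, leaving `q / ramPoly` up to an integral
element, with `q` of degree less than 7. -/
lemma exists_simple_pole {ε₁ ε₂ ε₃ : ZMod 2} (hε : ¬ (ε₁ = 0 ∧ ε₂ = 0 ∧ ε₃ = 0)) :
    ∃ g : K, v (algebraMap _ K (C ε₁ : (ZMod 2)[X]) * polarFun₁ y +
      algebraMap _ K (C ε₂ : (ZMod 2)[X]) * polarFun₂ y +
      algebraMap _ K (C ε₃ : (ZMod 2)[X]) * polarFun₃ y + g ^ 2 + g) = exp 1 := by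
  have hp0 : algebraMap (ZMod 2)[X] K ramPoly ≠ 0 := algebraMap_poly_ne_zero ramPoly_ne_zero
  set q : (ZMod 2)[X] := C ε₁ * (X ^ 5 + X) + C ε₂ * (X ^ 5 + X ^ 4 + X ^ 3 + X) +
    C ε₃ * (X ^ 6 + X ^ 5) with hq
  have hqd : q.natDegree < 7 := by
    refine Nat.lt_succ_of_le ?_
    rw [hq]; compute_degree
  have hq0 : q ≠ 0 := by
    intro h0
    apply hε
    -- The coefficients at 6, 4 and 1 are `ε₃`, `ε₂` and `ε₁ + ε₂`.
    have h6 := congrArg (fun q => coeff q 6) h0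
    have h4 := congrArg (fun q => coeff q 4) h0
    have h1 := congrArg (fun q => coeff q 1) h0
    simp [hq, coeff_X, coeff_X_pow, coeff_C_mul] at h6 h4 h1
    refine ⟨?_, h4, h6⟩
    rwa [h4, add_zero] at h1
  have hqp : v (algebraMap _ K q / algebraMap _ K ramPoly) = exp 1 := by
    rw [map_div₀, hv.poly_eq_one hq0 hqd, hv.ramPoly_eq, one_div, ← exp_neg, neg_neg]
  have h1 := hv.polarFun_sub_le h (B := ramRoot) (by rw [sub_self]; exact dvd_zero _)
    (by rw [pow_one]; exact ramRoot_eq) polarFun₁_eq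
  have h2 := hv.polarFun_sub_le h (B := ramRoot) (by rw [sub_self]; exact dvd_zero _)
    (by rw [pow_one]; exact ramRoot_eq) polarFun₂_eq
  have h3 := hv.polarFun_sub_le h (Dvd.intro _ ramRootSq_sub_ramRoot.symm) ramRootSq_eq
    polarFun₃_eq
  have hm : ∀ (ε : ZMod 2) {z : K}, v z ≤ 1 → v (algebraMap _ K (C ε : (ZMod 2)[X]) * z) ≤ 1 :=
    fun ε z hz => by rw [map_mul]; exact mul_le_one' (hv.poly_le_one _) hz
  have hs := v.map_add_le (v.map_add_le (hm ε₁ h1) (hm ε₂ h2)) (hm ε₃ h3)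
  refine ⟨algebraMap _ K (C ε₃ * X ^ 6 : (ZMod 2)[X]) / algebraMap _ K ramPoly, ?_⟩
  rw [← hqp]
  have hcc : algebraMap _ K (C ε₃ : (ZMod 2)[X]) ^ 2 = algebraMap _ K (C ε₃ : (ZMod 2)[X]) := by
    rw [← map_pow, ← map_pow]; congr 2; clear * -; revert ε₃; decide
  have hid : algebraMap (ZMod 2)[X] K X ^ 12 + algebraMap (ZMod 2)[X] K (X ^ 6 + X ^ 5) =
      algebraMap (ZMod 2)[X] K ramPoly * algebraMap (ZMod 2)[X] K X ^ 5 := by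
    rw [← map_pow, ← map_pow, ← map_add, ← map_mul]
    congr 1; unfold ramPoly; ring
  refine Eq.trans (congrArg v ?_) (Valuation.map_add_eq_of_lt_left v
    (lt_of_le_of_lt hs (by rw [hqp, ← exp_zero, exp_lt_exp]; omega)))
  unfold polarFun₁ polarFun₂ polarFun₃
  have hq' : algebraMap _ K q = algebraMap (ZMod 2)[X] K (C ε₁) *
      algebraMap (ZMod 2)[X] K (X ^ 5 + X) + algebraMap (ZMod 2)[X] K (C ε₂) *
      algebraMap (ZMod 2)[X] K (X ^ 5 + X ^ 4 + X ^ 3 + X) + algebraMap (ZMod 2)[X] K (C ε₃) *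
      (algebraMap (ZMod 2)[X] K X ^ 6 + algebraMap (ZMod 2)[X] K X ^ 5) := by
    rw [hq]; simp only [map_add, map_mul, map_pow]
  rw [hq']
  generalize polarFun y 1 (X ^ 5 + X) (X ^ 2 + X) = F₁
  generalize polarFun y 1 (X ^ 5 + X ^ 4 + X ^ 3 + X) (X ^ 6 + X ^ 4) = F₂
  generalize polarFun y 2 (X ^ 6 + X ^ 5) (X ^ 10 + X ^ 6 + X ^ 2 + X) = F₃
  rw [map_mul, map_pow]
  generalize algebraMap (ZMod 2)[X] K (X ^ 6 + X ^ 5) = A₃ at *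
  generalize algebraMap (ZMod 2)[X] K ramPoly = p at *
  generalize algebraMap (ZMod 2)[X] K (C ε₃) = c at *
  rw [← sub_eq_zero]
  field_simp
  linear_combination (algebraMap (ZMod 2)[X] K X) ^ 12 * hcc + c * hid

end IsRamVal

lemma exists_eq_of_mem_span_polarFun [Algebra (ZMod 2) K] {z : K}
    (hz : z ∈ Submodule.span (ZMod 2) {polarFun₁ y, polarFun₂ y, polarFun₃ y}) :
    ∃ ε₁ ε₂ ε₃ : ZMod 2, z = algebraMap _ K (C ε₁ : (ZMod 2)[X]) * polarFun₁ y +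
      algebraMap _ K (C ε₂ : (ZMod 2)[X]) * polarFun₂ y +
      algebraMap _ K (C ε₃ : (ZMod 2)[X]) * polarFun₃ y := by
  obtain ⟨a, b, c, rfl⟩ := Submodule.mem_span_triple.1 hz
  have key : ∀ (ε : ZMod 2) (z : K), ε • z = algebraMap _ K (C ε : (ZMod 2)[X]) * z := by
    intro ε z
    have : ε = 0 ∨ ε = 1 := by revert ε; decide
    rcases this with rfl | rfl <;> simp
  exact ⟨a, b, c, by simp only [key]⟩

namespace IsArtinSchreier

variable (h : IsArtinSchreier RF K y (algebraMap (ZMod 2)[X] RF (X ^ 3 + X)))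
include h

/-- At a finite rational place `x` is `0` or `1`, so `x ^ 2 + x` vanishes and `ramPoly` is `1`
there. At infinity the degree bounds give a zero. -/
lemma polarFun_lt_one {m : ℕ} {a b : (ZMod 2)[X]} (ha : X ^ 2 + X ∣ a) (hb : X ^ 2 + X ∣ b)
    (hda : 2 * a.natDegree + 4 ≤ 14 * m) (hdb : 2 * b.natDegree + 1 ≤ 14 * m)
    {V : ValuationSubring K} (hV : V ∈ ratPlaces K) : V.valuation (polarFun y m a b) < 1 := by
  by_cases hx : algebraMap _ K (X : (ZMod 2)[X]) ∈ V
  · have hq : V.valuation (algebraMap _ K (X ^ 2 + X : (ZMod 2)[X])) < 1 := by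
      have e : algebraMap _ K (X ^ 2 + X : (ZMod 2)[X]) =
          algebraMap _ K (X : (ZMod 2)[X]) * (algebraMap _ K (X : (ZMod 2)[X]) + 1) := by
        simp only [map_add, map_pow]; ring
      rw [e, map_mul]
      rcases hV.2 _ hx with h1 | h1
      · rw [mul_comm]
        exact mul_lt_one_of_nonneg_of_lt_one_right
          ((V.valuation_le_one_iff _).2 (V.add_mem _ _ hx V.one_mem)) zero_le h1
      · exact mul_lt_one_of_nonneg_of_lt_one_right ((V.valuation_le_one_iff _).2 hx) zero_le h1
    have hp : V.valuation (algebraMap _ K ramPoly) = 1 := by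
      have : ramPoly = 1 + (X ^ 2 + X) * (X ^ 5 + X ^ 4 + X ^ 3 + X ^ 2 + X + 1) := by
        unfold ramPoly
        linear_combination (-X ^ 6 - X ^ 5 - X ^ 4 - X ^ 3 - X ^ 2 : (ZMod 2)[X]) *
          two_eq_zero_zmod
      rw [this, map_add, map_one]
      exact V.valuation_one_add (V.poly_lt_one_of_dvd hx hq (dvd_mul_right _ _))
    rw [polarFun, map_div₀, map_pow, hp, one_pow, div_one]
    refine V.valuation.map_add_lt (V.poly_lt_one_of_dvd hx hq hb) ?_
    rw [map_mul, mul_comm]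
    exact mul_lt_one_of_nonneg_of_lt_one_right ((V.valuation_le_one_iff _).2 (h.y_mem hx))
      zero_le (V.poly_lt_one_of_dvd hx hq ha)
  · rw [h.eq_infPlace hx, ← (Valuation.isEquiv_valuation_valuationSubring _).lt_one_iff_lt_one]
    refine lt_of_le_of_lt (h.infPlace_le m b a (n := -1) (by omega) (by omega)) ?_
    rw [← exp_zero, exp_lt_exp]; omega

lemma polarFun₁_lt_one {V : ValuationSubring K} (hV : V ∈ ratPlaces K) :
    V.valuation (polarFun₁ y) < 1 := by
  have hd : (X ^ 5 + X : (ZMod 2)[X]).natDegree ≤ 5 := by compute_degree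
  have hd' : (X ^ 2 + X : (ZMod 2)[X]).natDegree ≤ 2 := by compute_degree
  refine h.polarFun_lt_one (Dvd.intro (X ^ 3 + X ^ 2 + X + 1) ?_) dvd_rfl (by omega) (by omega) hV
  linear_combination (X ^ 4 + X ^ 3 + X ^ 2 : (ZMod 2)[X]) * two_eq_zero_zmod

lemma polarFun₂_lt_one {V : ValuationSubring K} (hV : V ∈ ratPlaces K) :
    V.valuation (polarFun₂ y) < 1 := by
  have hd : (X ^ 5 + X ^ 4 + X ^ 3 + X : (ZMod 2)[X]).natDegree ≤ 5 := by compute_degree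
  have hd' : (X ^ 6 + X ^ 4 : (ZMod 2)[X]).natDegree ≤ 6 := by compute_degree
  refine h.polarFun_lt_one (Dvd.intro (X ^ 3 + X + 1) ?_) (Dvd.intro (X ^ 4 + X ^ 3) ?_)
    (by omega) (by omega) hV
  · linear_combination (X ^ 2 : (ZMod 2)[X]) * two_eq_zero_zmod
  · linear_combination (X ^ 5 : (ZMod 2)[X]) * two_eq_zero_zmod

lemma polarFun₃_lt_one {V : ValuationSubring K} (hV : V ∈ ratPlaces K) :
    V.valuation (polarFun₃ y) < 1 := by
  have hd : (X ^ 6 + X ^ 5 : (ZMod 2)[X]).natDegree ≤ 6 := by compute_degree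
  have hd' : (X ^ 10 + X ^ 6 + X ^ 2 + X : (ZMod 2)[X]).natDegree ≤ 10 := by compute_degree
  refine h.polarFun_lt_one (Dvd.intro (X ^ 4) ?_)
    (Dvd.intro (X ^ 8 + X ^ 7 + X ^ 6 + X ^ 5 + 1) ?_) (by omega) (by omega) hV
  · ring
  · linear_combination (X ^ 9 + X ^ 8 + X ^ 7 : (ZMod 2)[X]) * two_eq_zero_zmod

variable [Algebra (ZMod 2) K]

variable {D₀ : Derivation (ZMod 2) RF RF} {D : Derivation (ZMod 2) K K}
  (hD₀ : ∀ a : (ZMod 2)[X], D₀ (algebraMap _ RF a) = algebraMap _ RF (derivative a))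
  (hD : ∀ a, D (algebraMap RF K a) = algebraMap RF K (D₀ a))
include hD₀ hD

/-- The elliptic curve itself is the bottom of the tower. -/
lemma exists_isLevel_zero {K₀ : Type*} [Field K₀] [Algebra K₀ K] [Algebra (ZMod 2) K₀]
    {S : Submodule (ZMod 2) K₀} (hS : ∀ r ∈ S, algebraMap K₀ K r ∈
      Submodule.span (ZMod 2) {polarFun₁ y, polarFun₂ y, polarFun₃ y}) :
    ∃ v : Valuation K ℤᵐ⁰, IsLevel S ⊥ D v 0 := by
  obtain ⟨v, hv⟩ := h.exists_isRamVal
  have hDpoly : ∀ a : (ZMod 2)[X], D (algebraMap _ K a) = algebraMap _ K (derivative a) := by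
    intro a
    rw [← algebraMap_poly_eq, hD, hD₀, algebraMap_poly_eq]
  have hd0 : diffExp 0 = 0 := by simp [diffExp]
  refine ⟨v, ?_, ?_, ?_, ?_, ?_, ?_, ?_, ?_, ?_, ?_, ?_, ?_⟩
  · intro z hz
    rw [hd0, exp_zero]
    exact h.derivation_mem_finite hD₀ hD (V := v.valuationSubring) hv.x_mem hz
  -- `ramPoly` is a uniformizer with derivative `x ^ 6 + 1`, a unit because its degree is less than
  -- 7.
  · refine ⟨algebraMap _ K ramPoly, hv.ramPoly_eq, ?_⟩
    have hd : derivative ramPoly = X ^ 6 + 1 := by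
      unfold ramPoly
      simp only [derivative_add, derivative_X_pow, derivative_X, derivative_one, add_zero]
      have : (C ((7 : ℕ) : ZMod 2) : (ZMod 2)[X]) = 1 := by rw [← map_one C]; rfl
      rw [this]; norm_num
    have hdeg : (X ^ 6 + 1 : (ZMod 2)[X]).natDegree = 6 := by compute_degree!
    rw [hDpoly, hd, hd0, exp_zero]
    exact hv.poly_eq_one (fun h0 => by rw [h0] at hdeg; simp at hdeg) (by omega)
  · exact fun c hc => hv.perfect h hc
  · intro r hr hr0
    obtain ⟨a, b, c, e⟩ := exists_eq_of_mem_span_polarFun (hS r hr)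
    rw [e]
    refine hv.exists_simple_pole h (fun h0 => hr0 ?_)
    obtain ⟨rfl, rfl, rfl⟩ := h0
    simpa using e
  · intro V hV hVv z hz
    by_cases hx : algebraMap _ K (X : (ZMod 2)[X]) ∈ V
    · exact h.derivation_mem_finite hD₀ hD hx hz
    · have e := h.eq_infPlace hx
      subst e
      exact h.derivation_mem_infPlace hD₀ hD hz
  · intro V hV hVv
    by_cases hx : algebraMap _ K (X : (ZMod 2)[X]) ∈ V
    · refine ⟨_, hx, ?_⟩
      rw [hDpoly, derivative_X, map_one, inv_one]
      exact ⟨one_ne_zero, V.one_mem⟩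
    · have e := h.eq_infPlace hx
      subst e
      exact h.exists_derivation_unit_infPlace hD₀ hD
  · intro r hr
    obtain ⟨a, b, c, e⟩ := exists_eq_of_mem_span_polarFun (hS r hr)
    rw [e]
    exact regularAway.add (regularAway.add
      (regularAway.mul (hv.const_mem h a) (hv.polarFun₁_mem h))
      (regularAway.mul (hv.const_mem h b) (hv.polarFun₂_mem h)))
      (regularAway.mul (hv.const_mem h c) (hv.polarFun₃_mem h))
  · rw [hd0, hv.card_poleSpace_zero h]; norm_num
  · rw [hd0, zero_add, hv.card_poleSpace_one h]; norm_num
  · rw [hd0, zero_add]; exact hv.approx h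
  · rw [h.card_ratPlaces_base]; norm_num
  · intro V hV r hr
    obtain ⟨a, b, c, e⟩ := exists_eq_of_mem_span_polarFun (hS r hr)
    rw [e]
    have key : ∀ (ε : ZMod 2) {z : K}, V.valuation z < 1 →
        V.valuation (algebraMap _ K (C ε : (ZMod 2)[X]) * z) < 1 := by
      intro ε z hz
      have : ε = 0 ∨ ε = 1 := by revert ε; decide
      rcases this with rfl | rfl <;> simp [hz]
    exact V.valuation.map_add_lt (V.valuation.map_add_lt (key a (h.polarFun₁_lt_one hV))
      (key b (h.polarFun₂_lt_one hV))) (key c (h.polarFun₃_lt_one hV))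

end IsArtinSchreier

end Base

/-! ### Differentials as multiples of `dx` -/

section CoordDerivation

variable (k F : Type*) [Field k] [Field F] [Algebra k F] [Algebra k[X] F] [IsScalarTower k k[X] F]
  [Algebra.FormallyEtale k[X] F]

/-- The differentials of an étale extension of `k[X]` are the multiples of `dX`. -/
noncomputable def kaehlerEquiv : Ω[F⁄k] ≃ₗ[F] F :=
  (KaehlerDifferential.tensorKaehlerEquivOfFormallyEtale k k[X] F).symm ≪≫ₗ
    TensorProduct.AlgebraTensorModule.congr (LinearEquiv.refl F F)
      (KaehlerDifferential.polynomialEquiv k) ≪≫ₗ TensorProduct.AlgebraTensorModule.rid k[X] F F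

/-- The derivation `d / dX` on an étale extension of `k[X]`. -/
noncomputable def coordDerivation : Derivation k F F :=
  (kaehlerEquiv k F).toLinearMap.compDer (KaehlerDifferential.D k F)

variable {k F}

lemma kaehlerEquiv_D (z : F) :
    kaehlerEquiv k F (KaehlerDifferential.D k F z) = coordDerivation k F z := rfl

lemma coordDerivation_algebraMap (a : k[X]) :
    coordDerivation k F (algebraMap k[X] F a) = algebraMap k[X] F (derivative a) := by
  rw [← kaehlerEquiv_D, kaehlerEquiv, LinearEquiv.trans_apply, LinearEquiv.trans_apply,
    KaehlerDifferential.tensorKaehlerEquivOfFormallyEtale_symm_D_algebraMap]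
  simp [Algebra.smul_def]

lemma derivation_eq_coordDerivation_smul {M : Type*} [AddCommGroup M] [Module k M] [Module F M]
    [IsScalarTower k F M] (δ : Derivation k F M) (z : F) :
    δ z = coordDerivation k F z • δ (algebraMap k[X] F X) := by
  have h : KaehlerDifferential.D k F z =
      coordDerivation k F z • KaehlerDifferential.D k F (algebraMap k[X] F X) := by
    apply (kaehlerEquiv k F).injective
    rw [map_smul, kaehlerEquiv_D, kaehlerEquiv_D, coordDerivation_algebraMap]
    simp
  rw [← δ.liftKaehlerDifferential_comp_D z, h, map_smul, δ.liftKaehlerDifferential_comp_D]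

/-- `d / dX` of `L`, restricted to `F`, is a derivation with value `1` at `X`; such a derivation is
unique. -/
lemma coordDerivation_algebraMap_field {L : Type*} [Field L] [Algebra k L] [Algebra k[X] L]
    [IsScalarTower k k[X] L] [Algebra.FormallyEtale k[X] L] [Algebra F L] [IsScalarTower k[X] F L]
    [IsScalarTower k F L] (z : F) :
    coordDerivation k L (algebraMap F L z) = algebraMap F L (coordDerivation k F z) := by
  have := derivation_eq_coordDerivation_smul ((coordDerivation k L).compAlgebraMap F) z
  rw [Derivation.compAlgebraMap_apply, Derivation.compAlgebraMap_apply,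
    ← IsScalarTower.algebraMap_apply, coordDerivation_algebraMap, derivative_X, map_one,
    Algebra.smul_def, mul_one] at this
  exact this

end CoordDerivation

/-! ### Rational points and genus from the tower invariants -/

section Curve

open FunctionFieldCurve

variable {F : Type*} [Field F] [Algebra (ZMod 2) F]

lemma zmod_two_eq_zero_or_one (c : ZMod 2) : c = 0 ∨ c = 1 := by revert c; decide

lemma two_eq_zero_of_algebra : (2 : F) = 0 := by
  rw [← map_ofNat (algebraMap (ZMod 2) F) 2, show (OfNat.ofNat 2 : ZMod 2) = 0 from rfl, map_zero]

/-- A valuation ring of a field of characteristic two, as a place over `𝔽₂`. -/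
def placeOfNeTop (V : ValuationSubring F) (hV : V ≠ ⊤) : Place (ZMod 2) F where
  ring := V
  algebraMap_mem c := by
    rcases zmod_two_eq_zero_or_one c with rfl | rfl
    · rw [map_zero]; exact V.zero_mem
    · rw [map_one]; exact V.one_mem
  ne_top := hV

lemma isRational_iff (P : Place (ZMod 2) F) : P.IsRational ↔ P.ring ∈ ratPlaces F := by
  have h2 := two_eq_zero_of_algebra (F := F)
  refine ⟨fun h => ⟨P.ne_top, fun a ha => ?_⟩, fun h a ha => ?_⟩
  · obtain ⟨c, hc⟩ := h a ha
    rcases zmod_two_eq_zero_or_one c with rfl | rfl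
    · left; simpa using hc
    · right
      rw [map_one] at hc
      rwa [show a + 1 = a - 1 by linear_combination h2]
  · rcases h.2 a ha with h | h
    · exact ⟨0, by simpa using h⟩
    · refine ⟨1, ?_⟩
      rw [map_one]
      rwa [show a - 1 = a + 1 by linear_combination -h2]

lemma numRationalPoints_eq : numRationalPoints (ZMod 2) F = Nat.card (ratPlaces F) :=
  Nat.card_congr
    { toFun := fun P => ⟨P.1.ring, (isRational_iff P.1).1 P.2⟩
      invFun := fun V => ⟨placeOfNeTop V.1 V.2.1, (isRational_iff _).2 V.2⟩
      left_inv := fun _ => rfl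
      right_inv := fun _ => rfl }

variable {K : Type*} [Field K] [Algebra K F] [Algebra (ZMod 2) K]
  {S R : Submodule (ZMod 2) K} {D : Derivation (ZMod 2) F F} {v : Valuation F ℤᵐ⁰} {n : ℕ}

lemma IsLevel.valuationSubring_ne_top (hl : IsLevel S R D v n) : v.valuationSubring ≠ ⊤ := by
  intro ht
  obtain ⟨π, hπ, -⟩ := hl.exists_uniformizer
  have : π⁻¹ ∈ v.valuationSubring := ht ▸ ValuationSubring.mem_top _
  rw [Valuation.mem_valuationSubring_iff, map_inv₀, hπ, ← exp_neg, ← exp_zero, exp_le_exp] at this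
  omega

lemma IsLevel.numRationalPoints_eq (hl : IsLevel S R D v n) :
    numRationalPoints (ZMod 2) F = 5 * 2 ^ n := by
  rw [_root_.numRationalPoints_eq, hl.card_ratPlaces]

/-- The regular differentials at a place whose module of differentials is known locally. -/
lemma mem_regularDifferentials_iff (e : Ω[F⁄ZMod 2] ≃ₗ[F] F)
    (he : ∀ z, e (KaehlerDifferential.D (ZMod 2) F z) = D z) (P : Place (ZMod 2) F)
    (A : AddSubgroup F) (h1 : ∀ a ∈ P.ring, ∀ b ∈ P.ring, a * D b ∈ A)
    {b : F} (hb : b ∈ P.ring) (hb0 : D b ≠ 0) (h2 : ∀ z ∈ A, z * (D b)⁻¹ ∈ P.ring)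
    (ω : Ω[F⁄ZMod 2]) : ω ∈ P.regularDifferentials ↔ e ω ∈ A := by
  constructor
  · intro hω
    induction hω using Submodule.span_induction with
    | mem x hx =>
      obtain ⟨a, ha, b, hb, rfl⟩ := hx
      rw [map_smul, he]
      exact h1 a ha b hb
    | zero => rw [map_zero]; exact A.zero_mem
    | add x y _ _ hx hy => rw [map_add]; exact A.add_mem hx hy
    | smul c x _ hx =>
      rcases zmod_two_eq_zero_or_one c with rfl | rfl
      · rw [zero_smul, map_zero]; exact A.zero_mem
      · rwa [one_smul]
  · intro hω
    -- `ω` is `e ω / D b` times the differential of `b`.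
    refine Submodule.subset_span ⟨_, h2 _ hω, b, hb, ?_⟩
    apply e.injective
    rw [map_smul, he, smul_eq_mul, inv_mul_cancel_right₀ hb0]

lemma IsLevel.mem_iInf_regularDifferentials (hl : IsLevel S R D v n) (e : Ω[F⁄ZMod 2] ≃ₗ[F] F)
    (he : ∀ z, e (KaehlerDifferential.D (ZMod 2) F z) = D z) (ω : Ω[F⁄ZMod 2]) :
    ω ∈ (⨅ P : Place (ZMod 2) F, P.regularDifferentials) ↔ e ω ∈ poleSpace v (diffExp n) := by
  have hv : ∀ P : Place (ZMod 2) F, P.ring = v.valuationSubring →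
      (ω ∈ P.regularDifferentials ↔ v (e ω) ≤ exp (diffExp n)) := by
    intro P hP
    obtain ⟨π, hπ, hDπ⟩ := hl.exists_uniformizer
    refine mem_regularDifferentials_iff e he P
      { carrier := {z | v z ≤ exp (diffExp n)}
        add_mem' := fun ha hb => v.map_add_le ha hb
        zero_mem' := by simp
        neg_mem' := fun {a} ha => by simpa using ha } ?_ (b := π) ?_ ?_ ?_ ω
    · intro a ha b hb
      rw [hP, Valuation.mem_valuationSubring_iff] at ha hb
      change v (a * D b) ≤ _
      rw [map_mul, ← one_mul (exp (diffExp n))]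
      exact mul_le_mul' ha (hl.derivation_le b hb)
    · rw [hP, Valuation.mem_valuationSubring_iff, hπ, ← exp_zero, exp_le_exp]; omega
    · exact v.ne_zero_of_eq_exp hDπ
    · intro z hz
      rw [hP, Valuation.mem_valuationSubring_iff, map_mul, map_inv₀, hDπ]
      exact (mul_le_mul_left hz _).trans (mul_inv_cancel₀ exp_ne_zero).le
  have hV : ∀ P : Place (ZMod 2) F, P.ring ≠ v.valuationSubring →
      (ω ∈ P.regularDifferentials ↔ e ω ∈ P.ring) := by
    intro P hP
    obtain ⟨b, hb, hb0, hbi⟩ := hl.exists_derivation_unit _ P.ne_top hP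
    exact mem_regularDifferentials_iff e he P P.ring.toSubring.toAddSubgroup
      (fun a ha b hb => P.ring.mul_mem _ _ ha (hl.derivation_mem _ P.ne_top hP b hb)) hb hb0
      (fun z hz => P.ring.mul_mem _ _ hz hbi) ω
  rw [Submodule.mem_iInf]
  constructor
  · intro h
    refine ⟨fun V hV1 hV2 => (hV (placeOfNeTop V hV1) hV2).1 (h _),
      (hv (placeOfNeTop _ hl.valuationSubring_ne_top) rfl).1 (h _)⟩
  · rintro ⟨h1, h2⟩ P
    by_cases hP : P.ring = v.valuationSubring
    · exact (hv P hP).2 h2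
    · exact (hV P hP).2 (h1 _ P.ne_top hP)

/-- Over `𝔽₂` the dimension is read off from the number of elements, which is that of `L(dP)`. -/
lemma IsLevel.genus_eq (hl : IsLevel S R D v n) (e : Ω[F⁄ZMod 2] ≃ₗ[F] F)
    (he : ∀ z, e (KaehlerDifferential.D (ZMod 2) F z) = D z) :
    genus (ZMod 2) F = 7 * 2 ^ n - 6 := by
  have hcard : Nat.card (⨅ P : Place (ZMod 2) F, P.regularDifferentials :
      Submodule (ZMod 2) (Ω[F⁄ZMod 2])) = 2 ^ (7 * 2 ^ n - 6) := by
    rw [← hl.card_low]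
    exact Nat.card_congr (e.toEquiv.subtypeEquiv (hl.mem_iInf_regularDifferentials e he))
  have hfin : Finite (⨅ P : Place (ZMod 2) F, P.regularDifferentials :
      Submodule (ZMod 2) (Ω[F⁄ZMod 2])) := Nat.finite_of_card_ne_zero (by rw [hcard]; positivity)
  rw [Module.natCard_eq_pow_finrank (K := ZMod 2), Nat.card_zmod] at hcard
  exact Nat.pow_right_injective le_rfl hcard

end Curve

/-! ### Absolute irreducibility -/

section AbsolutelyIrreducible

open FunctionFieldCurve

variable {F : Type*} [Field F] [Algebra (ZMod 2) F]

/-- A curve with a rational place is absolutely irreducible. -/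
lemma isAbsolutelyIrreducible_of_mem_ratPlaces {V : ValuationSubring F} (hV : V ∈ ratPlaces F) :
    IsAbsolutelyIrreducible (ZMod 2) F := by
  let Ω := AlgebraicClosure F
  obtain ⟨W, hW⟩ := ValuationSubring.exists_comap_eq (L := Ω) V
  have hW1 : W ≠ ⊤ := by
    rintro rfl
    apply hV.1
    rw [← hW]
    ext; simp
  let φ : AlgebraicClosure (ZMod 2) →ₐ[ZMod 2] Ω := IsAlgClosed.lift
  -- Constants are integral over `𝔽₂`, and valuation rings are integrally closed.
  have hφ : ∀ a, φ a ∈ W := by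
    intro a
    have h1 : IsIntegral (ZMod 2) (φ a) :=
      (Algebra.IsIntegral.isIntegral (R := ZMod 2) a).map φ
    have h2 : IsIntegral W (φ a) := by
      obtain ⟨p, hp, hp0⟩ := h1
      let ι : ZMod 2 →+* W := (algebraMap (ZMod 2) Ω).codRestrict W.toSubring
        (placeOfNeTop W hW1).algebraMap_mem
      refine ⟨p.map ι, hp.map _, ?_⟩
      rw [eval₂_map, ← hp0]
      rfl
    obtain ⟨b, hb⟩ := IsIntegrallyClosed.isIntegral_iff.1 h2
    rw [← hb]; exact b.2
  have hφ1 : ∀ a, W.valuation (φ a) < 1 → a = 0 := by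
    intro a ha
    by_contra h0
    have : W.valuation (φ a * φ a⁻¹) < 1 := by
      rw [map_mul, mul_comm]
      exact mul_lt_one_of_nonneg_of_lt_one_right ((W.valuation_le_one_iff _).2 (hφ _)) zero_le ha
    rw [← map_mul, mul_inv_cancel₀ h0, map_one, map_one] at this
    exact lt_irrefl _ this
  let b := Module.Basis.ofVectorSpace (ZMod 2) (AlgebraicClosure (ZMod 2))
  have hind : LinearIndependent F (fun i => φ (b i)) := by
    rw [linearIndependent_iff']
    intro s g hg
    by_contra! hne
    obtain ⟨i₀, hi₀, hgi₀⟩ := hne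
    -- Dividing a relation by its largest coefficient makes it integral with one coefficient `1`.
    -- Since the residue field of `V` is `𝔽₂`, reduction yields a nontrivial relation over `𝔽₂`
    -- among basis elements.
    obtain ⟨j, hj, hmax⟩ := s.exists_max_image (fun i => V.valuation (g i)) ⟨i₀, hi₀⟩
    have hgj : g j ≠ 0 := by
      intro h0
      have := hmax i₀ hi₀
      rw [h0, map_zero, le_zero_iff, map_eq_zero] at this
      exact hgi₀ this
    have hmem : ∀ i ∈ s, g i / g j ∈ V := by
      intro i hi
      rw [← V.valuation_le_one_iff, map_div₀]
      exact div_le_one_of_le₀ (hmax i hi) zero_le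
    have hres : ∀ i ∈ s, ∃ c : ZMod 2, V.valuation (g i / g j - algebraMap (ZMod 2) F c) < 1 :=
      fun i hi => (isRational_iff (placeOfNeTop V hV.1)).2 hV _ (hmem i hi)
    choose! c hc using hres
    have hWlt : ∀ i ∈ s,
        W.valuation (algebraMap F Ω (g i / g j) - algebraMap (ZMod 2) Ω (c i)) < 1 := by
      intro i hi
      have := hc i hi
      rw [← hW, ValuationSubring.valuation_comap_lt_one_iff, map_sub,
        ← IsScalarTower.algebraMap_apply] at this
      exact this
    have hsum : ∑ i ∈ s, algebraMap F Ω (g i / g j) * φ (b i) = 0 := by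
      have : ∑ i ∈ s, algebraMap F Ω (g i / g j) * φ (b i) =
          algebraMap F Ω (g j)⁻¹ * ∑ i ∈ s, g i • φ (b i) := by
        rw [Finset.mul_sum]
        refine Finset.sum_congr rfl fun i _ => ?_
        rw [Algebra.smul_def, div_eq_mul_inv, map_mul]; ring
      rw [this, hg, mul_zero]
    have hlt : W.valuation (φ (∑ i ∈ s, c i • b i)) < 1 := by
      have e : φ (∑ i ∈ s, c i • b i) =
          - ∑ i ∈ s, (algebraMap F Ω (g i / g j) - algebraMap (ZMod 2) Ω (c i)) * φ (b i) := by
        simp only [sub_mul, Finset.sum_sub_distrib, hsum, zero_sub]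
        rw [neg_neg, map_sum]
        refine Finset.sum_congr rfl fun i _ => ?_
        rw [map_smul, Algebra.smul_def]
      rw [e, Valuation.map_neg]
      refine Valuation.map_sum_lt _ one_ne_zero fun i hi => ?_
      rw [map_mul, mul_comm]
      exact mul_lt_one_of_nonneg_of_lt_one_right ((W.valuation_le_one_iff _).2 (hφ _)) zero_le
        (hWlt i hi)
    have hcj := linearIndependent_iff'.1 b.linearIndependent s c (hφ1 _ hlt) j hj
    have := hc j hj
    rw [hcj, map_zero, sub_zero, div_self hgj, map_one] at this
    exact lt_irrefl _ this
  have hdis : φ.fieldRange.LinearDisjoint F := by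
    refine IntermediateField.LinearDisjoint.of_basis_left
      (b.map (AlgEquiv.ofInjectiveField φ).toLinearEquiv) ?_
    exact hind
  have : IsDomain (φ.range ⊗[ZMod 2] F) := hdis.isDomain
  exact (Algebra.TensorProduct.congr (AlgEquiv.ofInjectiveField φ)
    (AlgEquiv.refl (R := ZMod 2) (A₁ := F))).toMulEquiv.isDomain _

end AbsolutelyIrreducible

/-! ### Artin-Schreier classes in a quadratic extension -/

section ArtinSchreier

variable {F L : Type*} [Field F] [Field L] [Algebra F L] {w : L} {f : F}

lemma isSeparable_of_sq_add_self (h2 : (2 : F) = 0) (hw : w ^ 2 + w = algebraMap F L f) :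
    IsSeparable F w := by
  have hp : (X ^ 2 + X - C f : F[X]).Separable := by
    rw [separable_def]
    have : derivative (X ^ 2 + X - C f : F[X]) = 1 := by
      rw [derivative_sub, derivative_add, derivative_X_pow, derivative_X, derivative_C,
        Nat.cast_ofNat, h2, map_zero]
      ring
    rw [this]
    exact isCoprime_one_right
  refine hp.of_dvd (minpoly.dvd F w ?_)
  simp [hw]

namespace IsArtinSchreier

variable (h : IsArtinSchreier F L w f)
include h

lemma finrank_eq_two : Module.finrank F L = 2 := by
  let φ : (F × F) →ₗ[F] L :=
    LinearMap.coprod (Algebra.linearMap F L) (LinearMap.toSpanSingleton F L w)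
  have hφ : ∀ a b, φ (a, b) = algebraMap F L a + algebraMap F L b * w := fun a b => by
    simp [φ, Algebra.smul_def]
  have hb : Function.Bijective φ := by
    constructor
    · rintro ⟨a, b⟩ ⟨c, d⟩ e
      rw [hφ, hφ] at e
      obtain ⟨rfl, rfl⟩ := h.coords_unique e
      rfl
    · intro z
      obtain ⟨a, b, rfl⟩ := h.exists_coords z
      exact ⟨(a, b), hφ a b⟩
  rw [← (LinearEquiv.ofBijective φ hb).finrank_eq]
  simp

lemma isSeparable : Algebra.IsSeparable F L := by
  refine ⟨fun z => ?_⟩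
  obtain ⟨a, b, rfl⟩ := h.exists_coords z
  exact Field.isSeparable_add (isSeparable_algebraMap a) (Field.isSeparable_mul
    (isSeparable_algebraMap b) (isSeparable_of_sq_add_self h.two_eq_zero h.eq))

/-- The Artin-Schreier classes that become trivial in `L` are those of `0` and `f`. -/
lemma exists_root_of_exists_root {g : F} {z : L} (hz : z ^ 2 + z = algebraMap F L g) :
    ∃ a : F, a ^ 2 + a = g ∨ a ^ 2 + a = g + f := by
  obtain ⟨a, b, rfl⟩ := h.exists_coords z
  have e : algebraMap F L (a ^ 2 + a + b ^ 2 * f) + algebraMap F L (b ^ 2 + b) * w =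
      algebraMap F L g + algebraMap F L 0 * w := by
    rw [map_zero, zero_mul, add_zero, ← hz]
    simp only [map_add, map_mul, map_pow, ← h.eq]
    linear_combination (algebraMap F L b ^ 2 * w - algebraMap F L a * algebraMap F L b * w) *
      h.two_eq_zero_right
  obtain ⟨e1, e2⟩ := h.coords_unique e
  have h2 := h.two_eq_zero
  rcases mul_eq_zero.1 (show b * (b + 1) = 0 by linear_combination e2) with hb | hb
  · exact ⟨a, Or.inl (by rw [← e1, hb]; ring)⟩
  · exact ⟨a, Or.inr (by
      rw [← e1, eq_neg_of_add_eq_zero_left hb]; linear_combination - f * h2)⟩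

end IsArtinSchreier

end ArtinSchreier

/-! ### Subspaces over `𝔽₂` -/

section Submodule

variable {V : Type*} [AddCommGroup V] [Module (ZMod 2) V]

lemma Submodule.natCard_sup_span_singleton {R : Submodule (ZMod 2) V} {f : V} (hf : f ∉ R) :
    Nat.card (R ⊔ Submodule.span (ZMod 2) {f} : Submodule (ZMod 2) V) = 2 * Nat.card R := by
  let φ : R × ZMod 2 → (R ⊔ Submodule.span (ZMod 2) {f} : Submodule (ZMod 2) V) := fun p =>
    ⟨p.1 + p.2 • f, Submodule.add_mem_sup p.1.2
      (Submodule.smul_mem _ _ (Submodule.mem_span_singleton_self f))⟩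
  have hφ : Function.Bijective φ := by
    constructor
    · rintro ⟨r, c⟩ ⟨r', c'⟩ e
      have e' : (r : V) + c • f = r' + c' • f := congrArg Subtype.val e
      have hc : c = c' := by
        by_contra hne
        have h1 : c' - c ≠ 0 := sub_ne_zero.2 (Ne.symm hne)
        apply hf
        have : (c' - c) • f ∈ R := by
          have : (c' - c) • f = (r : V) - r' := by
            rw [sub_smul, sub_eq_sub_iff_add_eq_add, add_comm, ← e', add_comm]
          rw [this]; exact R.sub_mem r.2 r'.2
        exact (R.smul_mem_iff h1).1 this
      subst hc
      rw [Prod.mk.injEq]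
      exact ⟨Subtype.ext (add_right_cancel e'), rfl⟩
    · rintro ⟨z, hz⟩
      obtain ⟨r, hr, s, hs, rfl⟩ := Submodule.mem_sup.1 hz
      obtain ⟨c, rfl⟩ := Submodule.mem_span_singleton.1 hs
      exact ⟨(⟨r, hr⟩, c), rfl⟩
  rw [← Nat.card_congr (Equiv.ofBijective φ hφ), Nat.card_prod, Nat.card_zmod, mul_comm]

/-- Induction on the subspaces of a finite space, adding one vector at a time. -/
lemma Submodule.sup_span_induction {S R₀ : Submodule (ZMod 2) V} [Finite S] (hR₀ : R₀ ≤ S)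
    {Q : Submodule (ZMod 2) V → Prop} (h0 : Q R₀)
    (step : ∀ R f, R₀ ≤ R → R ≤ S → f ∈ S → f ∉ R → Q R → Q (R ⊔ Submodule.span (ZMod 2) {f}))
    {R : Submodule (ZMod 2) V} (h1 : R₀ ≤ R) (h2 : R ≤ S) : Q R := by
  classical
  have key : ∀ s : Finset V, (s : Set V) ⊆ S → Q (R₀ ⊔ Submodule.span (ZMod 2) (s : Set V)) := by
    intro s
    induction s using Finset.induction_on with
    | empty => intro _; simpa using h0
    | insert f s _ ih =>
      intro hs
      rw [Finset.coe_insert, Set.insert_subset_iff] at hs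
      rw [Finset.coe_insert, Submodule.span_insert, sup_comm (Submodule.span _ {f}), ← sup_assoc]
      by_cases hf : f ∈ R₀ ⊔ Submodule.span (ZMod 2) (s : Set V)
      · rw [sup_eq_left.2 ((Submodule.span_singleton_le_iff_mem _ _).2 hf)]
        exact ih hs.2
      · exact step _ f le_sup_left (sup_le hR₀ (Submodule.span_le.2 hs.2)) hs.1 hf (ih hs.2)
  have hfin : (R : Set V).Finite := (Set.toFinite (S : Set V)).subset h2
  have := key hfin.toFinset (by rw [hfin.coe_toFinset]; exact h2)
  rwa [hfin.coe_toFinset, Submodule.span_eq, sup_eq_right.2 h1] at this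

end Submodule

/-! ### Subspaces of `S` and intermediate fields -/

namespace SerreCurve

open IntermediateField

/-- The algebraic closure in which all fields are formed. -/
local notation "Ω" => AlgebraicClosure K

lemma two_eq_zero : (2 : K) = 0 := two_eq_zero_of_algebra

lemma two_eq_zero_closure : (2 : Ω) = 0 := by
  rw [← map_ofNat (algebraMap K Ω) 2, two_eq_zero, map_zero]

lemma add_eq_zero_iff_eq_closure {a b : Ω} : a + b = 0 ↔ a = b := by
  have h2 := two_eq_zero_closure
  constructor
  · intro h; linear_combination h - b * h2
  · intro h; linear_combination h + b * h2

lemma exists_root (r : K) : ∃ w : Ω, w ^ 2 + w = algebraMap K Ω r := by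
  have hd : (X ^ 2 + X - C (algebraMap K Ω r)).degree = 2 := by compute_degree!
  obtain ⟨w, hw⟩ := IsAlgClosed.exists_root (X ^ 2 + X - C (algebraMap K Ω r)) (by
    rw [hd]; norm_num)
  refine ⟨w, ?_⟩
  simpa [sub_eq_zero] using hw

lemma mem_adjoinRoots {A : Set K} {r : K} (hr : r ∈ A) {w : Ω}
    (hw : w ^ 2 + w = algebraMap K Ω r) : w ∈ adjoinRoots A :=
  subset_adjoin _ _ ⟨r, hr, add_eq_zero_iff_eq_closure.2 hw⟩

/-- The zeros of `T ^ 2 + T + r` differ by `1`, so a field containing one contains both. -/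
lemma adjoinRoots_le_iff {A : Set K} {M : IntermediateField K Ω} :
    adjoinRoots A ≤ M ↔ ∀ r ∈ A, ∃ w ∈ M, w ^ 2 + w = algebraMap K Ω r := by
  constructor
  · intro h r hr
    obtain ⟨w, hw⟩ := exists_root r
    exact ⟨w, h (mem_adjoinRoots hr hw), hw⟩
  · intro h
    refine adjoin_le_iff.2 ?_
    rintro u ⟨r, hr, hu⟩
    rw [add_eq_zero_iff_eq_closure] at hu
    obtain ⟨w, hwM, hw⟩ := h r hr
    have h2 := two_eq_zero_closure
    have h3 : (u + w) * (u + w + 1) = 0 := by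
      linear_combination hu + hw + (u * w + algebraMap K Ω r) * h2
    rcases mul_eq_zero.1 h3 with h4 | h4
    · rw [add_eq_zero_iff_eq_closure] at h4
      rw [h4]; exact hwM
    · rw [add_assoc, add_eq_zero_iff_eq_closure] at h4
      rw [h4]; exact M.add_mem hwM M.one_mem

lemma adjoinRoots_eq_FX_span (A : Set K) :
    adjoinRoots A = FX (Submodule.span (ZMod 2) A) := by
  refine le_antisymm (adjoin.mono _ _ _ fun w ⟨r, hr, hw⟩ => ⟨r, Submodule.subset_span hr, hw⟩)
    (adjoinRoots_le_iff.2 fun r hr => ?_)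
  induction hr using Submodule.span_induction with
  | mem r hr =>
    obtain ⟨w, hw⟩ := exists_root r
    exact ⟨w, mem_adjoinRoots hr hw, hw⟩
  | zero => exact ⟨0, zero_mem _, by simp⟩
  | add r s _ _ hr hs =>
    obtain ⟨u, hu, hu'⟩ := hr
    obtain ⟨w, hw, hw'⟩ := hs
    refine ⟨u + w, add_mem hu hw, ?_⟩
    rw [map_add, ← hu', ← hw']
    linear_combination u * w * two_eq_zero_closure
  | smul c r _ hr =>
    rcases zmod_two_eq_zero_or_one c with rfl | rfl
    · exact ⟨0, zero_mem _, by simp⟩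
    · rwa [one_smul]

lemma FX_mono {R R' : Submodule (ZMod 2) K} (h : R ≤ R') : FX R ≤ FX R' :=
  adjoin.mono _ _ _ fun _ ⟨r, hr, hw⟩ => ⟨r, h hr, hw⟩

lemma FX_bot : FX ⊥ = ⊥ :=
  eq_bot_iff.2 (adjoinRoots_le_iff.2 fun r hr => by
    rw [SetLike.mem_coe, Submodule.mem_bot] at hr
    exact ⟨0, zero_mem _, by simp [hr]⟩)

lemma FX_sup_span (R : Submodule (ZMod 2) K) {f : K} {w : Ω}
    (hw : w ^ 2 + w = algebraMap K Ω f) :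
    FX (R ⊔ Submodule.span (ZMod 2) {f}) = FX R ⊔ K⟮w⟯ := by
  refine le_antisymm (adjoinRoots_le_iff.2 fun r hr => ?_) (sup_le (FX_mono le_sup_left) ?_)
  · obtain ⟨s, hs, t, ht, rfl⟩ := Submodule.mem_sup.1 hr
    obtain ⟨c, rfl⟩ := Submodule.mem_span_singleton.1 ht
    obtain ⟨u, hu⟩ := exists_root s
    have huF : u ∈ FX R ⊔ K⟮w⟯ := le_sup_left (a := FX R) (mem_adjoinRoots hs hu)
    have hwF : w ∈ FX R ⊔ K⟮w⟯ := le_sup_right (a := FX R) (mem_adjoin_simple_self K w)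
    rcases zmod_two_eq_zero_or_one c with rfl | rfl
    · exact ⟨u, huF, by simpa using hu⟩
    · refine ⟨u + w, add_mem huF hwF, ?_⟩
      rw [one_smul, map_add, ← hu, ← hw]
      linear_combination u * w * two_eq_zero_closure
  · rw [adjoin_simple_le_iff]
    exact mem_adjoinRoots (Submodule.mem_sup_right (Submodule.mem_span_singleton_self f)) hw

lemma exists_coords_of_mem_sup {M : IntermediateField K Ω} {f : K} {w : Ω}
    (hw : w ^ 2 + w = algebraMap K Ω f) {z : Ω} (hz : z ∈ M ⊔ K⟮w⟯) :
    ∃ a b : M, z = a + b * w := by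
  have h2 := two_eq_zero_closure
  have hle : M ⊔ K⟮w⟯ ≤ (M⟮w⟯).restrictScalars K := by
    refine sup_le (fun a ha => ?_) ?_
    · exact (M⟮w⟯).algebraMap_mem ⟨a, ha⟩
    · rw [adjoin_simple_le_iff]
      exact mem_adjoin_simple_self M w
  have hz' : z ∈ Algebra.adjoin M {w} := by
    rw [← adjoin_simple_toSubalgebra_of_isAlgebraic (Algebra.IsAlgebraic.isAlgebraic w)]
    exact hle hz
  clear hz
  induction hz' using Algebra.adjoin_induction with
  | mem x hx => exact ⟨0, 1, by simpa using hx⟩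
  | algebraMap r => exact ⟨r, 0, by simp⟩
  | add x y _ _ hx hy =>
    obtain ⟨a, b, rfl⟩ := hx
    obtain ⟨c, d, rfl⟩ := hy
    refine ⟨a + c, b + d, ?_⟩
    push_cast
    ring
  | mul x y _ _ hx hy =>
    obtain ⟨a, b, rfl⟩ := hx
    obtain ⟨c, d, rfl⟩ := hy
    refine ⟨a * c + b * d * algebraMap K M f, a * d + b * c + b * d, ?_⟩
    push_cast
    rw [← hw]
    linear_combination (-(b * d * w) : Ω) * h2

/-- Adjoining a root of `T ^ 2 + T + f` that is not there yet. -/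
lemma isArtinSchreier_of_sup {M : IntermediateField K Ω} {f : K} {w : Ω}
    (hw : w ^ 2 + w = algebraMap K Ω f) (hwM : w ∉ M) {L : Type*} [Field L] [Algebra M L]
    (j : L →+* Ω) (hj : ∀ a : M, j (algebraMap M L a) = a) (hjL : ∀ z, j z ∈ M ⊔ K⟮w⟯)
    {w' : L} (hw' : j w' = w) : IsArtinSchreier M L w' (algebraMap K M f) where
  two_eq_zero := Subtype.ext two_eq_zero_closure
  eq := j.injective (by rw [map_add, map_pow, hw', hw, hj]; rfl)
  exists_coords z := by
    obtain ⟨a, b, e⟩ := exists_coords_of_mem_sup hw (hjL z)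
    exact ⟨a, b, j.injective (by rw [e, map_add, map_mul, hj, hj, hw'])⟩
  ne_algebraMap a e := hwM (by rw [← hw', ← e, hj]; exact a.2)

lemma relfinrank_sup_root {M : IntermediateField K Ω} {f : K} {w : Ω}
    (hw : w ^ 2 + w = algebraMap K Ω f) (hwM : w ∉ M) : relfinrank M (M ⊔ K⟮w⟯) = 2 := by
  rw [relfinrank_eq_finrank_of_le (le_sup_left : M ≤ M ⊔ K⟮w⟯)]
  have hwS : w ∈ M ⊔ K⟮w⟯ := le_sup_right (a := M) (mem_adjoin_simple_self K w)
  exact (isArtinSchreier_of_sup hw hwM (L := extendScalars (le_sup_left : M ≤ M ⊔ K⟮w⟯))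
    (algebraMap _ Ω) (fun a => rfl) (fun z => z.2) (w' := ⟨w, hwS⟩) rfl).finrank_eq_two

lemma exists_root_of_sup_root {M : IntermediateField K Ω} {f r : K} {w z : Ω}
    (hw : w ^ 2 + w = algebraMap K Ω f) (hwM : w ∉ M) (hz : z ∈ M ⊔ K⟮w⟯)
    (hzr : z ^ 2 + z = algebraMap K Ω r) :
    ∃ a ∈ M, a ^ 2 + a = algebraMap K Ω r ∨ a ^ 2 + a = algebraMap K Ω (r + f) := by
  have hwS : w ∈ M ⊔ K⟮w⟯ := le_sup_right (a := M) (mem_adjoin_simple_self K w)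
  let j : extendScalars (le_sup_left : M ≤ M ⊔ K⟮w⟯) →+* Ω := algebraMap _ Ω
  have hj : ∀ a : M, j (algebraMap M _ a) = a := fun a => rfl
  have has := isArtinSchreier_of_sup hw hwM j hj (fun z => z.2) (w' := ⟨w, hwS⟩) rfl
  have e : j (⟨z, hz⟩ ^ 2 + ⟨z, hz⟩) = j (algebraMap M _ (algebraMap K M r)) := by
    rw [hj, map_add, map_pow]
    exact hzr
  obtain ⟨a, ha⟩ := has.exists_root_of_exists_root (j.injective e)
  refine ⟨a, a.2, ha.imp (fun ha => ?_) fun ha => ?_⟩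
  · have := congrArg (algebraMap M Ω) ha
    rwa [map_add, map_pow, ← IsScalarTower.algebraMap_apply] at this
  · have := congrArg (algebraMap M Ω) ha
    rwa [map_add, map_pow, map_add, ← IsScalarTower.algebraMap_apply,
      ← IsScalarTower.algebraMap_apply, ← map_add] at this

/-- The elements `r` of `S` such that `T ^ 2 + T + r` has its zeros in `F`. -/
def rootSpace (F : IntermediateField K Ω) : Submodule (ZMod 2) K where
  carrier := {r | r ∈ S ∧ ∃ w ∈ F, w ^ 2 + w = algebraMap K Ω r}
  add_mem' := by
    rintro r s ⟨hr, u, hu, hu'⟩ ⟨hs, w, hw, hw'⟩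
    refine ⟨add_mem hr hs, u + w, add_mem hu hw, ?_⟩
    rw [map_add, ← hu', ← hw']
    linear_combination u * w * two_eq_zero_closure
  zero_mem' := ⟨zero_mem _, 0, zero_mem _, by simp⟩
  smul_mem' := by
    rintro c r ⟨hr, hr'⟩
    rcases zmod_two_eq_zero_or_one c with rfl | rfl
    · rw [zero_smul]; exact ⟨zero_mem _, 0, zero_mem _, by simp⟩
    · rw [one_smul]; exact ⟨hr, hr'⟩

lemma rootSpace_le (F : IntermediateField K Ω) : rootSpace F ≤ S := fun _ h => h.1

lemma FX_rootSpace_le (F : IntermediateField K Ω) : FX (rootSpace F) ≤ F :=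
  adjoinRoots_le_iff.2 fun _ h => h.2

instance finite_S : Finite S := by
  have : Module.Finite (ZMod 2) S := by
    unfold S
    exact Module.Finite.span_of_finite _ (by simp)
  exact Module.finite_of_finite (ZMod 2)

lemma finite_of_le_S {R : Submodule (ZMod 2) K} (h : R ≤ S) : Finite R :=
  Finite.of_injective _ (Submodule.inclusion_injective h)

/-- Vectors of `S` are added to `rootSpace F` one at a time. A vector outside the current root space
gives a quadratic extension, and by `exists_root_of_sup_root` the root space grows by this vector
only; degree and cardinality double together. -/
lemma rootSpace_sup_and_relfinrank (F : IntermediateField K Ω) {R : Submodule (ZMod 2) K}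
    (h1 : rootSpace F ≤ R) (h2 : R ≤ S) : rootSpace (F ⊔ FX R) = R ∧
      relfinrank F (F ⊔ FX R) * Nat.card (rootSpace F) = Nat.card R := by
  refine Submodule.sup_span_induction (rootSpace_le F) (Q := fun R => rootSpace (F ⊔ FX R) = R ∧
      relfinrank F (F ⊔ FX R) * Nat.card (rootSpace F) = Nat.card R) ?_ ?_ h1 h2
  · rw [sup_eq_left.2 (FX_rootSpace_le F), relfinrank_self, one_mul]
    exact ⟨rfl, rfl⟩
  · rintro R f - hRS hf hfR ⟨ih1, ih2⟩
    obtain ⟨w, hw⟩ := exists_root f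
    have hwM : w ∉ F ⊔ FX R := fun hwM => hfR (ih1 ▸ ⟨hf, w, hwM, hw⟩)
    have hwS : w ∈ F ⊔ FX R ⊔ K⟮w⟯ := le_sup_right (a := F ⊔ FX R) (mem_adjoin_simple_self K w)
    rw [FX_sup_span R hw, ← sup_assoc, Submodule.natCard_sup_span_singleton hfR, ← ih2,
      ← relfinrank_mul_relfinrank (le_sup_left : F ≤ F ⊔ FX R)
        (le_sup_left : F ⊔ FX R ≤ F ⊔ FX R ⊔ K⟮w⟯), relfinrank_sup_root hw hwM]
    refine ⟨le_antisymm ?_ ?_, by ring⟩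
    · rintro r ⟨hr, z, hz, hz'⟩
      obtain ⟨a, haM, ha⟩ := exists_root_of_sup_root hw hwM hz hz'
      rcases ha with ha | ha
      · refine Submodule.mem_sup_left ?_
        rw [← ih1]
        exact ⟨hr, a, haM, ha⟩
      · have : r + f ∈ R := by
          rw [← ih1]
          exact ⟨add_mem hr hf, a, haM, ha⟩
        have e : r = (r + f) - f := by ring
        rw [e]
        exact sub_mem (Submodule.mem_sup_left this)
          (Submodule.mem_sup_right (Submodule.mem_span_singleton_self f))
    · refine sup_le ?_ ((Submodule.span_singleton_le_iff_mem _ _).2 ⟨hf, w, hwS, hw⟩)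
      conv_lhs => rw [← ih1]
      rintro r ⟨hr, z, hz, hz'⟩
      exact ⟨hr, z, le_sup_left (a := F ⊔ FX R) hz, hz'⟩

section Correspondence

variable (h0 : rootSpace ⊥ = ⊥)
include h0

lemma rootSpace_FX {R : Submodule (ZMod 2) K} (hR : R ≤ S) : rootSpace (FX R) = R := by
  have := (rootSpace_sup_and_relfinrank ⊥ (h0 ▸ bot_le) hR).1
  rwa [bot_sup_eq] at this

lemma finrank_FX {R : Submodule (ZMod 2) K} (hR : R ≤ S) :
    Module.finrank K (FX R) = Nat.card R := by
  have := (rootSpace_sup_and_relfinrank ⊥ (h0 ▸ bot_le) hR).2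
  rw [bot_sup_eq, h0, relfinrank_bot_left] at this
  simpa using this

lemma FX_le_FX_iff {R R' : Submodule (ZMod 2) K} (hR : R ≤ S) (hR' : R' ≤ S) :
    FX R ≤ FX R' ↔ R ≤ R' := by
  refine ⟨fun h r hr => ?_, FX_mono⟩
  obtain ⟨w, hw⟩ := exists_root r
  rw [← rootSpace_FX h0 hR']
  exact ⟨hR hr, w, h (mem_adjoinRoots hr hw), hw⟩

lemma relfinrank_FX {R R' : Submodule (ZMod 2) K} (h : R ≤ R') (hR' : R' ≤ S) :
    relfinrank (FX R) (FX R') = Nat.card (R' ⧸ R.submoduleOf R') := by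
  have hR := h.trans hR'
  have h1 := (rootSpace_sup_and_relfinrank (FX R) ((rootSpace_FX h0 hR).le.trans h) hR').2
  rw [sup_eq_right.2 (FX_mono h), rootSpace_FX h0 hR] at h1
  have h2 := Submodule.card_eq_card_quotient_mul_card (R.submoduleOf R')
  rw [Nat.card_congr (Submodule.submoduleOfEquivOfLe h).toEquiv] at h2
  have := finite_of_le_S hR
  have hpos : 0 < Nat.card R := Nat.card_pos
  refine Nat.eq_of_mul_eq_mul_right hpos (h1.trans (h2.trans ?_))
  ring

/-- The degree of `FX S` over `F` is the index of `rootSpace F` in `S`, so `F` has the same degree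
over `K` as its subfield `FX (rootSpace F)`. -/
lemma FX_rootSpace {F : IntermediateField K Ω} (hF : F ≤ FX S) : FX (rootSpace F) = F := by
  have h1 := (rootSpace_sup_and_relfinrank F (rootSpace_le F) le_rfl).2
  rw [sup_eq_right.2 hF] at h1
  have h2 := relfinrank_mul_relfinrank (bot_le : ⊥ ≤ F) hF
  rw [relfinrank_bot_left, relfinrank_bot_left, finrank_FX h0 le_rfl, ← h1, mul_comm] at h2
  have hpos : 0 < Nat.card S := Nat.card_pos
  have hne : relfinrank F (FX S) ≠ 0 := by
    rintro e; rw [e, zero_mul] at h1; omega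
  have h3 := Nat.eq_of_mul_eq_mul_left (Nat.pos_of_ne_zero hne) h2
  have := finite_of_le_S (rootSpace_le F)
  have : FiniteDimensional K F :=
    FiniteDimensional.of_finrank_pos (by rw [h3]; exact Nat.card_pos)
  exact eq_of_le_of_finrank_eq (FX_rootSpace_le F) (by rw [finrank_FX h0 (rootSpace_le F), h3])

/-- The correspondence between subspaces and intermediate fields. -/
noncomputable def subspaceOrderIso : {R : Submodule (ZMod 2) K // R ≤ S} ≃o
    {F : IntermediateField K Ω // F ≤ FX S} where
  toFun R := ⟨FX R.1, FX_mono R.2⟩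
  invFun F := ⟨rootSpace F.1, rootSpace_le F.1⟩
  left_inv R := Subtype.ext (rootSpace_FX h0 R.2)
  right_inv F := Subtype.ext (FX_rootSpace h0 F.2)
  map_rel_iff' {R R'} := FX_le_FX_iff h0 R.2 R'.2

end Correspondence

end SerreCurve

/-- Moves the presentation of `𝔽₂(E)` to its copy `FX ⊥` in the algebraic closure. -/
lemma IsArtinSchreier.of_bijective {F L L' : Type*} [Field F] [Field L] [Field L'] [Algebra F L]
    [Algebra F L'] [Algebra L L'] [IsScalarTower F L L'] {w : L} {f : F}
    (h : IsArtinSchreier F L w f) (hs : Function.Surjective (algebraMap L L')) :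
    IsArtinSchreier F L' (algebraMap L L' w) f where
  two_eq_zero := h.two_eq_zero
  eq := by rw [← map_pow, ← map_add, h.eq, ← IsScalarTower.algebraMap_apply]
  exists_coords z := by
    obtain ⟨z, rfl⟩ := hs z
    obtain ⟨a, b, rfl⟩ := h.exists_coords z
    exact ⟨a, b, by
      rw [map_add, map_mul, ← IsScalarTower.algebraMap_apply, ← IsScalarTower.algebraMap_apply]⟩
  ne_algebraMap a e := h.ne_algebraMap a ((algebraMap L L').injective (by
    rw [← e, ← IsScalarTower.algebraMap_apply]))

/-! ### The tower over `𝔽₂(E)` -/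

namespace SerreCurve

open IntermediateField FunctionFieldCurve WeierstrassCurve.Affine

noncomputable instance algebraRatFunc : Algebra RF K := RatFunc.liftAlgebra (ZMod 2) K

lemma algebraMap_poly_eq_mk (a : (ZMod 2)[X]) : algebraMap (ZMod 2)[X] K a =
    algebraMap E.CoordinateRing K (CoordinateRing.mk E (C a)) := rfl

lemma algebraMap_X : algebraMap (ZMod 2)[X] K X = x := rfl

/-- The function field of `E` is the extension of `𝔽₂(x)` generated by `y`. -/
lemma isArtinSchreier_K : IsArtinSchreier RF K y (algebraMap (ZMod 2)[X] RF (X ^ 3 + X)) := by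
  have h2 : (2 : RF) = 0 := two_eq_zero_of_algebra
  have hYsq : CoordinateRing.mk E X ^ 2 + CoordinateRing.mk E X =
      CoordinateRing.mk E (C (X ^ 3 + X)) := by
    have h := CoordinateRing.smul_basis_mul_Y (W' := E) 0 1
    have ha : E.a₁ = 0 ∧ E.a₂ = 0 ∧ E.a₃ = 1 ∧ E.a₄ = 1 ∧ E.a₆ = 0 := ⟨rfl, rfl, rfl, rfl, rfl⟩
    obtain ⟨h1, h2, h3, h4, h6⟩ := ha
    rw [h1, h2, h3, h4, h6] at h
    simp only [map_zero, map_one, zero_mul, zero_smul, one_smul, one_mul, zero_add, add_zero,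
      zero_sub, neg_smul] at h
    rw [sq, h, CoordinateRing.smul]
    ring
  have hsq : y ^ 2 + y = algebraMap RF K (algebraMap (ZMod 2)[X] RF (X ^ 3 + X)) := by
    rw [algebraMap_poly_eq, algebraMap_poly_eq_mk, ← hYsq, map_add, map_pow]
    rfl
  have h2K : (2 : K) = 0 := two_eq_zero
  have hinj : Function.Injective (algebraMap E.CoordinateRing K) := IsFractionRing.injective _ _
  have hpoly : ∀ p q : (ZMod 2)[X], algebraMap E.CoordinateRing K
      (p • (1 : E.CoordinateRing) + q • CoordinateRing.mk E X) =
        algebraMap (ZMod 2)[X] K p + algebraMap (ZMod 2)[X] K q * y := by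
    intro p q
    rw [algebraMap_poly_eq_mk, algebraMap_poly_eq_mk,
      map_add, CoordinateRing.smul, CoordinateRing.smul, mul_one, map_mul]
    rfl
  have hne : ∀ a : RF, algebraMap RF K a ≠ y := by
    intro a ha
    obtain ⟨n, m, hm, rfl⟩ := IsFractionRing.div_surjective (A := (ZMod 2)[X]) a
    have hm0 : m ≠ 0 := nonZeroDivisors.ne_zero hm
    have hmK : algebraMap (ZMod 2)[X] K m ≠ 0 := algebraMap_poly_ne_zero hm0
    rw [map_div₀, algebraMap_poly_eq, algebraMap_poly_eq, div_eq_iff hmK] at ha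
    refine hm0 (CoordinateRing.smul_basis_eq_zero (W' := E) (p := -n) (q := m) (hinj ?_)).2
    rw [hpoly, map_zero, map_neg, ha]
    ring
  refine ⟨h2, hsq, fun z => ?_, hne⟩
  obtain ⟨c, c', hc', rfl⟩ := IsFractionRing.div_surjective (A := E.CoordinateRing) z
  have hc0 : algebraMap E.CoordinateRing K c' ≠ 0 := by
    rw [Ne, map_eq_zero_iff _ hinj]; exact nonZeroDivisors.ne_zero hc'
  obtain ⟨p, q, rfl⟩ := CoordinateRing.exists_smul_basis_eq c
  obtain ⟨r, s, rfl⟩ := CoordinateRing.exists_smul_basis_eq c'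
  rw [hpoly] at hc0 ⊢
  rw [hpoly]
  set g : (ZMod 2)[X] := X ^ 3 + X
  rw [algebraMap_poly_eq] at hsq
  -- The conjugate of the denominator, used to rationalize the fraction; it is nonzero because `y`
  -- is not in `𝔽₂(x)`.
  have hconj : algebraMap (ZMod 2)[X] K r + algebraMap (ZMod 2)[X] K s +
      algebraMap (ZMod 2)[X] K s * y ≠ 0 := by
    intro h0
    by_cases hs : s = 0
    · subst hs
      simp only [map_zero, zero_mul, add_zero] at h0 hc0
      exact hc0 h0
    · have hsK : algebraMap (ZMod 2)[X] K s ≠ 0 := algebraMap_poly_ne_zero hs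
      refine hne (-(algebraMap _ RF (r + s)) / algebraMap _ RF s) ?_
      rw [map_div₀, map_neg, algebraMap_poly_eq, algebraMap_poly_eq, div_eq_iff hsK, map_add]
      linear_combination -h0
  have hN : algebraMap (ZMod 2)[X] K (r ^ 2 + r * s + s ^ 2 * g) =
      (algebraMap (ZMod 2)[X] K r + algebraMap (ZMod 2)[X] K s * y) *
      (algebraMap (ZMod 2)[X] K r + algebraMap (ZMod 2)[X] K s +
        algebraMap (ZMod 2)[X] K s * y) := by
    simp only [map_add, map_mul, map_pow]
    rw [← hsq]
    linear_combination (-(algebraMap (ZMod 2)[X] K r * algebraMap (ZMod 2)[X] K s * y)) * h2K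
  have hN0 : algebraMap (ZMod 2)[X] K (r ^ 2 + r * s + s ^ 2 * g) ≠ 0 := by
    rw [hN]; exact mul_ne_zero hc0 hconj
  refine ⟨algebraMap _ RF (p * r + p * s + q * s * g) /
      algebraMap _ RF (r ^ 2 + r * s + s ^ 2 * g),
    algebraMap _ RF (p * s + q * r) / algebraMap _ RF (r ^ 2 + r * s + s ^ 2 * g), ?_⟩
  rw [map_div₀, map_div₀, algebraMap_poly_eq, algebraMap_poly_eq, algebraMap_poly_eq,
    div_mul_eq_mul_div, ← add_div, div_eq_div_iff hc0 hN0, hN]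
  simp only [map_add, map_mul]
  rw [← hsq]
  ring

lemma f₁_eq : f₁ = polarFun₁ y := by
  unfold f₁ polarFun₁ polarFun ramPoly
  simp only [map_add, map_pow, map_one, algebraMap_X]
  ring

lemma f₂_eq : f₂ = polarFun₂ y := by
  unfold f₂ polarFun₂ polarFun ramPoly
  simp only [map_add, map_pow, map_one, algebraMap_X]
  ring

lemma f₃_eq : f₃ = polarFun₃ y := by
  unfold f₃ polarFun₃ polarFun ramPoly
  simp only [map_add, map_pow, map_one, algebraMap_X]
  congr 1
  · ring
  · linear_combination (-x ^ 8 - x ^ 7 - x) * two_eq_zero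

instance isScalarTower_intermediateField (M : IntermediateField K (AlgebraicClosure K)) :
    IsScalarTower (ZMod 2)[X] RF M :=
  IsScalarTower.of_algebraMap_eq fun a => by
    rw [IsScalarTower.algebraMap_apply (ZMod 2)[X] K M, IsScalarTower.algebraMap_apply RF K M,
      algebraMap_poly_eq]

instance formallyEtale_ratFunc : Algebra.FormallyEtale (ZMod 2)[X] RF :=
  Algebra.FormallyEtale.of_isLocalization (nonZeroDivisors (ZMod 2)[X])

instance isSeparable_adjoinRoots (A : Set K) : Algebra.IsSeparable K (adjoinRoots A) := by
  refine (isSeparable_adjoin_iff_isSeparable K _).2 ?_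
  rintro w ⟨r, -, hw⟩
  exact isSeparable_of_sq_add_self two_eq_zero (add_eq_zero_iff_eq_closure.1 hw)

/-- `FX R` is separable over `𝔽₂(x)`, a localization of `𝔽₂[X]`; this makes `dx` a basis of the
differentials. -/
instance formallyEtale_FX (R : Submodule (ZMod 2) K) : Algebra.FormallyEtale (ZMod 2)[X] (FX R) := by
  have h1 : Algebra.IsSeparable RF K := isArtinSchreier_K.isSeparable
  have h2 : Algebra.IsSeparable K (FX R) := isSeparable_adjoinRoots _
  have h3 : Algebra.IsSeparable RF (FX R) := Algebra.IsSeparable.trans RF K (FX R)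
  have h4 : Algebra.FormallyEtale RF (FX R) := Algebra.FormallyEtale.of_isSeparable RF (FX R)
  exact Algebra.FormallyEtale.comp (ZMod 2)[X] RF (FX R)

lemma exists_isLevel_FX_bot :
    ∃ v, IsLevel S ⊥ (coordDerivation (ZMod 2) (FX ⊥)) v 0 := by
  have hs : Function.Surjective (algebraMap K (FX ⊥)) := by
    rintro ⟨z, hz⟩
    rw [FX_bot, mem_bot] at hz
    obtain ⟨a, rfl⟩ := hz
    exact ⟨a, rfl⟩
  refine (isArtinSchreier_K.of_bijective hs).exists_isLevel_zero
    (D₀ := coordDerivation (ZMod 2) RF) coordDerivation_algebraMap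
    coordDerivation_algebraMap_field fun r hr => ?_
  have hmap : ∀ m a b, algebraMap K (FX ⊥) (polarFun y m a b) =
      polarFun (algebraMap K (FX ⊥) y) m a b := by
    intro m a b
    simp only [polarFun, map_div₀, map_add, map_mul, map_pow, ← IsScalarTower.algebraMap_apply]
  unfold S at hr
  induction hr using Submodule.span_induction with
  | mem r hr =>
    refine Submodule.subset_span ?_
    rcases hr with rfl | rfl | rfl
    · left; rw [f₁_eq]; exact hmap _ _ _
    · right; left; rw [f₂_eq]; exact hmap _ _ _
    · right; right; rw [f₃_eq]; exact hmap _ _ _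
  | zero => rw [map_zero]; exact zero_mem _
  | add r s _ _ hr hs => rw [map_add]; exact add_mem hr hs
  | smul c r _ hr =>
    rcases zmod_two_eq_zero_or_one c with rfl | rfl
    · rw [zero_smul, map_zero]; exact zero_mem _
    · rwa [one_smul]

/-- The input to the correspondence: by the simple poles on `E`, `S` injects into `K` modulo the
elements `a ^ 2 + a`. -/
lemma rootSpace_bot : rootSpace ⊥ = ⊥ := by
  obtain ⟨v, hl⟩ := exists_isLevel_FX_bot
  refine eq_bot_iff.2 fun r ⟨hr, w, hw, hw'⟩ => ?_
  by_contra hr0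
  rw [← FX_bot] at hw
  exact hl.root_not_mem hr hr0 ⟨w, hw⟩ (Subtype.ext hw')

lemma exists_isLevel_FX {R : Submodule (ZMod 2) K} (hR : R ≤ S) :
    ∃ n v, Nat.card R = 2 ^ n ∧ IsLevel S R (coordDerivation (ZMod 2) (FX R)) v n := by
  refine Submodule.sup_span_induction (bot_le : ⊥ ≤ S) (Q := fun R => ∃ n v,
    Nat.card R = 2 ^ n ∧ IsLevel S R (coordDerivation (ZMod 2) (FX R)) v n) ?_ ?_ bot_le hR
  · obtain ⟨v, hv⟩ := exists_isLevel_FX_bot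
    exact ⟨0, v, by simp, hv⟩
  · rintro R f - hRS hf hfR ⟨n, v, hn, hl⟩
    obtain ⟨w, hw⟩ := exists_root f
    have hle : FX R ≤ FX (R ⊔ Submodule.span (ZMod 2) {f}) := FX_mono le_sup_left
    let : Algebra (FX R) (FX (R ⊔ Submodule.span (ZMod 2) {f})) := (inclusion hle).toAlgebra
    let : Module (FX R) (FX (R ⊔ Submodule.span (ZMod 2) {f})) := Algebra.toModule
    have : IsScalarTower K (FX R) (FX (R ⊔ Submodule.span (ZMod 2) {f})) :=
      IsScalarTower.of_algebraMap_eq fun _ => rfl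
    have : IsScalarTower (ZMod 2)[X] (FX R) (FX (R ⊔ Submodule.span (ZMod 2) {f})) :=
      IsScalarTower.of_algebraMap_eq fun _ => rfl
    have hwM : w ∉ FX R := fun hwM =>
      hfR (by rw [← rootSpace_FX rootSpace_bot hRS]; exact ⟨hf, w, hwM, hw⟩)
    have hwS : w ∈ FX (R ⊔ Submodule.span (ZMod 2) {f}) :=
      mem_adjoinRoots (Submodule.mem_sup_right (Submodule.mem_span_singleton_self f)) hw
    have has := isArtinSchreier_of_sup hw hwM
      (algebraMap (FX (R ⊔ Submodule.span (ZMod 2) {f})) (AlgebraicClosure K))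
      (fun a => rfl) (fun z => by rw [← FX_sup_span R hw]; exact z.2) (w' := ⟨w, hwS⟩) rfl
    obtain ⟨v', hv'⟩ := hl.step has (coordDerivation_algebraMap_field) hf hfR le_sup_left
      (Submodule.mem_sup_right (Submodule.mem_span_singleton_self f))
    exact ⟨n + 1, v', by rw [Submodule.natCard_sup_span_singleton hfR, hn, pow_succ, mul_comm],
      hv'⟩

end SerreCurve

/-! ### Invariants of the curves `X_R` -/

namespace SerreCurve

open FunctionFieldCurve

/-- A nontrivial combination acquires a simple pole after adding some `g ^ 2 + g`; zero does not. -/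
lemma independent_f {a b c : ZMod 2} (h : a • f₁ + b • f₂ + c • f₃ = 0) :
    a = 0 ∧ b = 0 ∧ c = 0 := by
  obtain ⟨v, hv⟩ := isArtinSchreier_K.exists_isRamVal
  by_contra hne
  obtain ⟨g, hg⟩ := hv.exists_simple_pole isArtinSchreier_K hne
  have hs : ∀ (ε : ZMod 2) (z : K), algebraMap (ZMod 2)[X] K (C ε) * z = ε • z := by
    intro ε z
    rcases zmod_two_eq_zero_or_one ε with rfl | rfl <;> simp
  rw [hs, hs, hs, ← f₁_eq, ← f₂_eq, ← f₃_eq, h, zero_add] at hg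
  exact v.sq_add_self_ne g hg

lemma natCard_span_singleton {f : K} (hf : f ∈ ({f₁, f₂, f₃} : Set K)) :
    Nat.card (Submodule.span (ZMod 2) {f}) = 2 := by
  have hf0 : f ∉ (⊥ : Submodule (ZMod 2) K) := by
    rw [Submodule.mem_bot]
    rintro h0
    rcases hf with rfl | rfl | rfl
    · have := (independent_f (a := 1) (b := 0) (c := 0) (by simp [h0])).1
      exact one_ne_zero this
    · have := (independent_f (a := 0) (b := 1) (c := 0) (by simp [h0])).2.1
      exact one_ne_zero this
    · have := (independent_f (a := 0) (b := 0) (c := 1) (by simp [h0])).2.2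
      exact one_ne_zero this
  have := Submodule.natCard_sup_span_singleton hf0
  rw [bot_sup_eq] at this
  rw [this]; simp

lemma natCard_span_pair : Nat.card (Submodule.span (ZMod 2) {f₁, f₂}) = 4 := by
  have hf : f₂ ∉ Submodule.span (ZMod 2) {f₁} := by
    intro h
    obtain ⟨c, hc⟩ := Submodule.mem_span_singleton.1 h
    have := (independent_f (a := c) (b := 1) (c := 0) (by
      rw [hc, one_smul, zero_smul]; linear_combination f₂ * two_eq_zero)).2.1
    exact one_ne_zero this
  have := Submodule.natCard_sup_span_singleton hf
  rw [← Submodule.span_union, Set.singleton_union, natCard_span_singleton (by simp)] at this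
  exact this

/-- Absolute irreducibility, genus and number of points of the curve `X_R`. -/
lemma invariants_FX {R : Submodule (ZMod 2) K} (hR : R ≤ S) :
    IsAbsolutelyIrreducible (ZMod 2) (FX R) ∧
      genus (ZMod 2) (FX R) + 6 = 7 * Nat.card R ∧
      numRationalPoints (ZMod 2) (FX R) = 5 * Nat.card R := by
  obtain ⟨n, v, hn, hl⟩ := exists_isLevel_FX hR
  have hpos : 1 ≤ 2 ^ n := Nat.one_le_two_pow
  refine ⟨?_, ?_, ?_⟩
  · have hcard := hl.card_ratPlaces
    have : Nonempty (ratPlaces (FX R)) := by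
      by_contra hne
      rw [not_nonempty_iff] at hne
      rw [Nat.card_of_isEmpty] at hcard
      omega
    obtain ⟨V, hV⟩ := this
    exact isAbsolutelyIrreducible_of_mem_ratPlaces hV
  · rw [hl.genus_eq (kaehlerEquiv (ZMod 2) (FX R)) kaehlerEquiv_D, hn]
    omega
  · rw [hl.numRationalPoints_eq, hn]

lemma span_le_S {A : Set K} (hA : A ⊆ {f₁, f₂, f₃}) : Submodule.span (ZMod 2) A ≤ S :=
  Submodule.span_mono hA

end SerreCurve

open FunctionFieldCurve SerreCurve in
theorem mainTheorem2 :
    -- the subspaces of `S` correspond to the fields between `𝔽₂(E)` and `𝔽₂(X_{123})`,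
    -- compatibly with inclusion
    (∃ e : {R : Submodule (ZMod 2) K // R ≤ S} ≃o
          {F : IntermediateField K (AlgebraicClosure K) // F ≤ FX₁₂₃},
        ∀ R, (e R : IntermediateField K (AlgebraicClosure K)) = FX R.1) ∧
    FX ⊥ = ⊥ ∧ FX S = FX₁₂₃ ∧
    -- degrees
    (∀ R R' : Submodule (ZMod 2) K, R ≤ R' → R' ≤ S →
      IntermediateField.relfinrank (FX R) (FX R') = Nat.card (R' ⧸ R.submoduleOf R')) ∧
    -- the curves `X_R`
    (∀ R : Submodule (ZMod 2) K, R ≤ S →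
      IsAbsolutelyIrreducible (ZMod 2) (FX R) ∧
      (genus (ZMod 2) (FX R) : ℤ) = 1 + 7 * ((Nat.card R : ℤ) - 1) ∧
      numRationalPoints (ZMod 2) (FX R) = 5 * Nat.card R) ∧
    -- the curves `X_j`
    (∀ f ∈ ({f₁, f₂, f₃} : Set K),
      genus (ZMod 2) (adjoinRoots {f}) = 8 ∧
      numRationalPoints (ZMod 2) (adjoinRoots {f}) = 10) ∧
    -- the curve `X_{12}`
    genus (ZMod 2) FX₁₂ = 22 ∧ numRationalPoints (ZMod 2) FX₁₂ = 20 := by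
  have h123 : FX₁₂₃ = FX S := adjoinRoots_eq_FX_span _
  have h12 : FX₁₂ = FX (Submodule.span (ZMod 2) {f₁, f₂}) := adjoinRoots_eq_FX_span _
  refine ⟨?_, FX_bot, h123.symm, fun R R' h hR' => relfinrank_FX rootSpace_bot h hR',
    fun R hR => ?_, fun f hf => ?_, ?_⟩
  · rw [h123]
    exact ⟨subspaceOrderIso rootSpace_bot, fun R => rfl⟩
  · obtain ⟨h1, h2, h3⟩ := invariants_FX hR
    exact ⟨h1, by omega, h3⟩
  · obtain ⟨-, h2, h3⟩ := invariants_FX (span_le_S (Set.singleton_subset_iff.2 hf))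
    rw [natCard_span_singleton hf] at h2 h3
    rw [adjoinRoots_eq_FX_span]
    exact ⟨by omega, h3⟩
  · obtain ⟨-, h2, h3⟩ := invariants_FX (span_le_S (A := {f₁, f₂}) (by
      intro z; simp only [Set.mem_insert_iff, Set.mem_singleton_iff]; tauto))
    rw [natCard_span_pair] at h2 h3
    rw [h12]
    exact ⟨by omega, h3⟩
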